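/- Let $d\ge 1$ be an integer and $\alpha>1$ a real number, and write $(t,x)=\sum_j t_jx_j$, $|x|=\max_j|x_j|$ on $\mathbb R^d$. An $N$-function is an even, continuous, convex function $N:\mathbb R\to\mathbb R$, strictly increasing on $[0,\infty)$, with $N(u)=0\iff u=0$ and $N(u)/u\to\infty$ as $u\to\infty$. For measurable $f:\mathbb R^d\to\mathbb C$ put $$\|f\|_{L(N)}=\inf_{v>0}v^{-1}\Bigl(1+\int_{\mathbb R^d}N(v|f(x)|)\,dx\Bigr),$$ and let $L(N)$ be the space of measurable $f$ with $\|f\|_{L(N)}<\infty$. Let $\psi:[\alpha,\infty)\to(0,\infty)$ be continuous and strictly increasing with $\psi(p)\to\infty$ as $p\to\infty$, and such that $p\mapsto p\log\psi(p)$ is convex. Let $N[\psi]$ denote any $N$-function such that $$N[\psi](u)=\exp\Bigl(\sup_{p\ge\alpha}\bigl(p\log|u|-p\log\psi(p)\bigr)\Bigr)\quad\text{for } |u|\ge e^2,$$ and let $N^{(\alpha)}[\psi]$ denote any $N$-function for which there are constants $C_1,\dots,C_5$ with $0<C_2<C_5$ such that it equals $C_1|u|^\alpha$ for $|u|\le C_2$,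 $C_3+C_4|u|$ for $C_2<|u|\le C_5$, and $N[\psi](u)$ for $|u|>C_5$. Put $\psi_d(p)=p^d\psi(p)$ and $N^{(\alpha)}_d[\psi]=N^{(\alpha)}[\psi_d]$. For $M\ge1$ let $S_M$ be the Fourier partial-integral operator $$S_M[f](x)=\lim_{R\to\infty}(2\pi)^{-d}\int_{|t|\le M}e^{-i(t,x)}\int_{|y|\le R}e^{i(t,y)}f(y)\,dy\,dt .$$ Then $N$-functions $N^{(\alpha)}[\psi]$ and $N^{(\alpha)}_d[\psi]$ as described exist. For any choice of them there is a finite constant $C_7$ (depending only on $d,\alpha,\psi$ and the choice) such that for every $f\in L(N^{(\alpha)}[\psi])$ and every real $M\ge1$: the limit defining $S_M[f](x)$ exists for every $x\in\mathbb R^d$; if the truncated transforms $t\mapsto\int_{|y|\le R}e^{i(t,y)}f(y)\,dy$ converge in $L^1(\{|t|\le M\})$ as $R\to\infty$ to a function $F$, then $S_M[f](x)=(2\pi)^{-d}\int_{|t|\le M}e^{-i(t,x)}F(t)\,dt$ for every $x$; and $S_M[f]\in L(N^{(\alpha)}_d[\psi])$ with $$\|S_M[f]\|_{L(N^{(\alpha)}_d[\psi])}\le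 C_7\,\|f\|_{L(N^{(\alpha)}[\psi])}.$$ -/

import Mathlib

open MeasureTheory Filter Topology
open scoped ENNReal NNReal

noncomputable section

namespace ExpOrlicz

/-- Orlicz `N`-functions: even, continuous, convex, strictly increasing on `[0, ∞)`, vanishing only
at `0`, with superlinear growth (for a convex function this is the divergence of its derivative at
infinity). -/
structure IsNFunction (N : ℝ → ℝ) : Prop where
  even : ∀ u, N (-u) = N u
  continuous : Continuous N
  convex : ConvexOn ℝ Set.univ N
  strictMono : StrictMonoOn N (Set.Ici 0)
  zero_iff : ∀ u, N u = 0 ↔ u = 0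
  superlinear : Tendsto (fun u => N u / u) atTop atTop

/-- The class `Ψ` of continuous, positive, strictly increasing functions `ψ` on `[α, ∞)` that tend
to infinity and for which `p ↦ p log ψ(p)` is convex. -/
structure IsPsi (α : ℝ) (ψ : ℝ → ℝ) : Prop where
  continuousOn : ContinuousOn ψ (Set.Ici α)
  pos : ∀ p, α ≤ p → 0 < ψ p
  strictMonoOn : StrictMonoOn ψ (Set.Ici α)
  convexOn : ConvexOn ℝ (Set.Ici α) (fun p => p * Real.log (ψ p))
  tendsto : Tendsto ψ atTop atTop

/-- Young-Fenchel (Legendre) transform `φ^*(z) = sup_{p ≥ α} (p z - φ(p))` of a function on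
`[α, ∞)`. -/
def youngFenchel (α : ℝ) (φ : ℝ → ℝ) (z : ℝ) : ℝ :=
  ⨆ p : Set.Ici α, ((p : ℝ) * z - φ p)

/-- `N` is an `N`-function `N([ψ], ·)`: it is given by `exp ([p log ψ(p)]^* (log |u|))` for
`|u| ≥ e²`, and is otherwise an arbitrary `N`-function. -/
def IsExpNFunction (α : ℝ) (ψ N : ℝ → ℝ) : Prop :=
  IsNFunction N ∧ ∀ u : ℝ, Real.exp 2 ≤ |u| →
    N u = Real.exp (youngFenchel α (fun p => p * Real.log (ψ p)) (Real.log |u|))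

/-- `A` is a modification `N^{(α)}` of the `N`-function `N`: an `N`-function equal to a multiple of
`|u|^α` near zero, to `N` for large `|u|`, and affine in `|u|` in between. -/
def IsModification (α : ℝ) (N A : ℝ → ℝ) : Prop :=
  IsNFunction A ∧ ∃ c₁ c₂ c₃ c₄ c₅ : ℝ, 0 < c₂ ∧ c₂ < c₅ ∧
    (∀ u : ℝ, |u| ≤ c₂ → A u = c₁ * |u| ^ α) ∧
    (∀ u : ℝ, c₂ < |u| → |u| ≤ c₅ → A u = c₃ + c₄ * |u|) ∧
    (∀ u : ℝ, c₅ < |u| → A u = N u)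

/-- `A` is an `N`-function `N^{(α)}[ψ]`. -/
def IsModifiedExpNFunction (α : ℝ) (ψ A : ℝ → ℝ) : Prop :=
  ∃ N : ℝ → ℝ, IsExpNFunction α ψ N ∧ IsModification α N A

/-- The function `ψ_d(p) = p^d ψ(p)`. -/
def psiPow (d : ℕ) (ψ : ℝ → ℝ) (p : ℝ) : ℝ := p ^ d * ψ p

/-- The Orlicz norm `inf_{v > 0} v⁻¹ (1 + ∫ N(v |f(x)|) dx)` on `ℝ^d`, with values in `[0, ∞]`. -/
def orliczNorm {d : ℕ} (N : ℝ → ℝ) (f : (Fin d → ℝ) → ℂ) : ℝ≥0∞ :=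
  ⨅ v : Set.Ioi (0 : ℝ),
    ENNReal.ofReal (v : ℝ)⁻¹ * (1 + ∫⁻ x, ENNReal.ofReal (N ((v : ℝ) * ‖f x‖)))

/-- Membership in the Orlicz space `L(N)` on `ℝ^d`. -/
def MemOrlicz {d : ℕ} (N : ℝ → ℝ) (f : (Fin d → ℝ) → ℂ) : Prop :=
  AEStronglyMeasurable f volume ∧ orliczNorm N f < ∞

/-- The cube `{x : max_j |x_j| ≤ R}` in `ℝ^d`. -/
def cube (d : ℕ) (R : ℝ) : Set (Fin d → ℝ) := {x | ∀ j, |x j| ≤ R}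

/-- The truncated Fourier transform `∫_{|x| ≤ R} exp(i (t, x)) f(x) dx`. -/
def truncFourier {d : ℕ} (R : ℝ) (f : (Fin d → ℝ) → ℂ) (t : Fin d → ℝ) : ℂ :=
  ∫ x in cube d R, Complex.exp (Complex.I * ((∑ j, t j * x j : ℝ) : ℂ)) * f x

/-- The inverse Fourier integral `(2π)^{-d} ∫_{|t| ≤ M} exp(-i (t, x)) F(t) dt` over a cube. -/
def invFourierCube {d : ℕ} (M : ℝ) (F : (Fin d → ℝ) → ℂ) (x : Fin d → ℝ) : ℂ :=
  ((2 * Real.pi : ℝ) : ℂ)⁻¹ ^ d *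
    ∫ t in cube d M, Complex.exp (-(Complex.I * ((∑ j, t j * x j : ℝ) : ℂ))) * F t

/-- The Fourier partial integral `S_M[f](x)`, the limit as `R → ∞` of
`(2π)^{-d} ∫_{|t| ≤ M} exp(-i (t, x)) ∫_{|y| ≤ R} exp(i (t, y)) f(y) dy dt`. The limit is taken
outside the integral over `t`, because for `f` in `L^p` with `p > 2` the Fourier transform
need not be a function. -/
def partialIntegral {d : ℕ} (M : ℝ) (f : (Fin d → ℝ) → ℂ) (x : Fin d → ℝ) : ℂ :=
  limUnder atTop (fun R : ℝ => invFourierCube M (truncFourier R f) x)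

/-- `F` is the Fourier transform of `f` on the cube `{|t| ≤ M}`, that is, the limit in
`L^1({|t| ≤ M})` of the truncated Fourier transforms of `f`. -/
def IsFourierOnCube {d : ℕ} (M : ℝ) (f F : (Fin d → ℝ) → ℂ) : Prop :=
  AEStronglyMeasurable F (volume.restrict (cube d M)) ∧
    Tendsto (fun R : ℝ => ∫⁻ t in cube d M, ‖truncFourier R f t - F t‖ₑ) atTop (𝓝 0)

end ExpOrlicz

end

/-! On `L^α` the operator `S_M` is convolution with the product kernel `∏ sin(M s_j) / (π s_j)`
(`cubeOp`), which lies in every `L^q` with `q > 1`. The theorem rests on one quantitative fact: the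
one-dimensional factor has norm `O(p)` on `L^p` as `p → ∞`, uniformly in `M`. In `d` variables this
gives `O(p^d)`, and that is exactly the passage from `ψ` to `ψ_d`.

The linear growth comes from M. Riesz' argument for even exponents
(`lintegral_conjPoisson_real_pow_le`). The Cauchy transform `F` of a real function is analytic in
the upper half plane, so `∫ F^(2m) = 0` on horizontal lines. An elementary inequality bounds `(Re
F)^(2m)` by `2 Re F^(2m)` plus `(21 m |Im F|)^(2m)`, and `Im F` is a Poisson integral. Modulation
and a limit transfer the bound to the Dirichlet kernel, duality (`DirichletBound.conj`) supplies an
exponent close to 1, and Fubini (`lintegral_cubeOp_rpow_le`) treats `d` variables.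

Up to constants, `N^(α)[ψ](u)` is `sup_{p ≥ α} (|u| / ψ(p))^p`. What is needed is therefore a
modular inequality for suprema of powers, and this does not follow exponent by exponent, because the
maximizing `p` depends on the point. On a bounded range `[a, b]` of exponents it is obtained by real
interpolation (`lintegral_powerSup_le`): the supremum is comparable to an average over dilations of
`min(v^r, v^s)` with `r < a` and `b < s`, and for that function one splits `f` at each height. The
half-line `[α, ∞)` is covered by intervals of bounded length, on which the interpolation constant
stays bounded. An extra factor 2 inside the power gains `2^(-p)` and makes the sum over the
intervals converge (`exists_lintegral_iSup_cubeOp_le`).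

The weights `w(p) = ψ(p)^(-p)` then give the modular inequality for the suprema, `exists_supPow_le`
and `exists_le_supPow` carry it over to the modified `N`-functions, and rescaling turns it into the
norm inequality (`orliczNorm_cubeOp_le`). -/

/-- Bounded measurable functions that vanish outside a ball. -/
structure IsBddCompact {X E : Type*} [Norm X] [MeasurableSpace X] [Norm E] [Zero E]
    [MeasurableSpace E] (f : X → E) : Prop where
  measurable : Measurable f
  bdd : ∃ C : ℝ, 0 ≤ C ∧ ∀ x, ‖f x‖ ≤ C
  supp : ∃ R : ℝ, 0 ≤ R ∧ ∀ x, R < ‖x‖ → f x = 0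

lemma IsBddCompact.integrable {X E : Type*} [NormedAddCommGroup X] [ProperSpace X]
    [MeasurableSpace X] [BorelSpace X] [NormedAddCommGroup E] [MeasurableSpace E] [BorelSpace E]
    [SecondCountableTopology E]
    {f : X → E} (hf : IsBddCompact f) (μ : Measure X) [IsFiniteMeasureOnCompacts μ] :
    Integrable f μ := by
  obtain ⟨C, hC0, hC⟩ := hf.bdd
  obtain ⟨R, hR0, hR⟩ := hf.supp
  have h1 : IntegrableOn f (Metric.closedBall 0 R) μ := by
    refine Measure.integrableOn_of_bounded (M := C) ?_ hf.measurable.aestronglyMeasurable ?_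
    · exact (isCompact_closedBall (0 : X) R).measure_lt_top.ne
    · exact ae_of_all _ hC
  refine (integrableOn_iff_integrable_of_support_subset ?_).1 h1
  intro x hx
  by_contra h
  exact hx (hR x (by simpa using h))

/-! ### Cauchy transforms and the vanishing of integrals of their even powers -/

/-- The Cauchy transform `∫ f(t) / (z - t) dt`. -/
noncomputable def cauchyTransform (f : ℝ → ℝ) (z : ℂ) : ℂ := ∫ t : ℝ, (f t : ℂ) * (z - t)⁻¹

lemma im_le_norm_sub_ofReal (z : ℂ) (t : ℝ) : z.im ≤ ‖z - t‖ := by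
  have := Complex.abs_im_le_norm (z - t)
  simp only [Complex.sub_im, Complex.ofReal_im, sub_zero] at this
  exact (le_abs_self _).trans this

lemma sub_ofReal_ne_zero {z : ℂ} (hz : 0 < z.im) (t : ℝ) : z - t ≠ 0 := by
  have := im_le_norm_sub_ofReal z t
  exact norm_pos_iff.1 (by linarith)

lemma cauchyTransform_differentiableAt {f : ℝ → ℝ} (hf : IsBddCompact f) {z : ℂ}
    (hz : 0 < z.im) : DifferentiableAt ℂ (cauchyTransform f) z := by
  have hfm := hf.measurable
  -- On this neighbourhood `|w - t|` stays above `z.im / 2` for every real `t`, which dominates the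
  -- differentiated integrand.
  have hs : {w : ℂ | z.im / 2 < w.im} ∈ 𝓝 z :=
    (isOpen_lt continuous_const Complex.continuous_im).mem_nhds (by simp; linarith)
  have key := hasDerivAt_integral_of_dominated_loc_of_deriv_le (𝕜 := ℂ) (μ := volume)
    (F := fun (w : ℂ) (t : ℝ) => (f t : ℂ) * (w - t)⁻¹)
    (F' := fun (w : ℂ) (t : ℝ) => (f t : ℂ) * (-1 / (w - t) ^ 2))
    (bound := fun t => ‖f t‖ * (1 / (z.im / 2) ^ 2)) (x₀ := z) hs ?_ ?_ ?_ ?_ ?_ ?_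
  · exact key.2.differentiableAt
  · exact Eventually.of_forall fun w => by
      apply Measurable.aestronglyMeasurable; fun_prop
  · refine Integrable.mono' (g := fun t => ‖f t‖ * (1 / z.im)) ((hf.integrable volume).norm.mul_const _)
      (by apply Measurable.aestronglyMeasurable; fun_prop) (ae_of_all _ fun t => ?_)
    rw [norm_mul, norm_inv, Complex.norm_real, one_div]
    gcongr
    exact im_le_norm_sub_ofReal z t
  · apply Measurable.aestronglyMeasurable; fun_prop
  · refine ae_of_all _ fun t w hw => ?_
    rw [norm_mul, norm_div, norm_neg, norm_one, norm_pow, Complex.norm_real]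
    gcongr
    exact (le_of_lt hw).trans (im_le_norm_sub_ofReal w t)
  · exact (hf.integrable volume).norm.mul_const _
  · refine ae_of_all _ fun t w hw => ?_
    have hw0 : 0 < w.im := lt_trans (by linarith) hw
    exact ((((hasDerivAt_id w).sub_const (t : ℂ)).fun_inv
      (sub_ofReal_ne_zero hw0 t)).const_mul (f t : ℂ))

/-- On the support `|t| ≤ R`, so `|z| ≤ |z - t| + R ≤ |z - t| (1 + R / ε)`. The decay at infinity
closes the contour below. -/
lemma cauchyTransform_bound {f : ℝ → ℝ} (hf : IsBddCompact f) {ε : ℝ} (hε : 0 < ε) :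
    ∃ C : ℝ, 0 ≤ C ∧ ∀ z : ℂ, ε ≤ z.im → ‖cauchyTransform f z‖ ≤ C / ‖z‖ := by
  obtain ⟨R, hR0, hR⟩ := hf.supp
  refine ⟨(∫ t, ‖f t‖) * (1 + R / ε), by positivity, fun z hz => ?_⟩
  have hz0 : 0 < ‖z‖ := lt_of_lt_of_le (by linarith) (Complex.abs_im_le_norm z |>.trans' (le_abs_self _))
  rw [mul_div_assoc, ← integral_mul_const]
  refine norm_integral_le_of_norm_le ((hf.integrable volume).norm.mul_const _)
    (ae_of_all _ fun t => ?_)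
  rw [norm_mul, norm_inv, Complex.norm_real]
  by_cases ht : R < ‖t‖
  · simp [hR t ht]
  · gcongr
    have h1 := im_le_norm_sub_ofReal z t
    have hpos : 0 < ‖z - t‖ := by linarith
    rw [le_div_iff₀ hz0, inv_mul_le_iff₀ hpos]
    have h2 : ‖z‖ ≤ ‖z - t‖ + ‖t‖ := by
      have := norm_add_le (z - t) (t : ℂ)
      simpa using this
    have h3 : R ≤ ‖z - t‖ * (R / ε) := by
      rw [mul_div_assoc', le_div_iff₀ hε]; nlinarith
    nlinarith [not_lt.1 ht]

lemma measurable_cauchyTransform_line {f : ℝ → ℝ} (hf : IsBddCompact f) (ε : ℝ) :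
    Measurable fun x : ℝ => cauchyTransform f (x + ε * Complex.I) := by
  have hfm := hf.measurable
  apply StronglyMeasurable.measurable
  refine StronglyMeasurable.integral_prod_right' (f := fun p : ℝ × ℝ =>
    (f p.2 : ℂ) * ((p.1 + ε * Complex.I : ℂ) - p.2)⁻¹) ?_
  apply Measurable.stronglyMeasurable
  fun_prop

lemma cauchyTransform_line_bound {f : ℝ → ℝ} (hf : IsBddCompact f) {ε : ℝ} (hε : 0 < ε) :
    ∃ C : ℝ, 0 ≤ C ∧ ∀ x : ℝ,
      ‖cauchyTransform f (x + ε * Complex.I)‖ ^ 2 ≤ C * (1 + x ^ 2)⁻¹ := by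
  obtain ⟨C, hC0, hC⟩ := cauchyTransform_bound hf hε
  refine ⟨C ^ 2 * (1 + 1 / ε ^ 2), by positivity, fun x => ?_⟩
  have h := hC (x + ε * Complex.I) (by simp)
  have hn : ‖(x + ε * Complex.I : ℂ)‖ ^ 2 = x ^ 2 + ε ^ 2 := by
    rw [← Complex.normSq_eq_norm_sq, Complex.normSq_add_mul_I]
  calc _ ≤ (C / ‖(x + ε * Complex.I : ℂ)‖) ^ 2 := by gcongr
    _ = C ^ 2 * (x ^ 2 + ε ^ 2)⁻¹ := by rw [div_pow, hn]; rfl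
    _ ≤ C ^ 2 * ((1 + 1 / ε ^ 2) * (1 + x ^ 2)⁻¹) := by
        gcongr
        rw [← div_eq_mul_inv, inv_eq_one_div, div_le_div_iff₀ (by positivity) (by positivity)]
        have : (1 + 1 / ε ^ 2) * (x ^ 2 + ε ^ 2) = 1 + x ^ 2 + (ε ^ 2 + x ^ 2 / ε ^ 2) := by
          field_simp; ring
        rw [this]
        have : 0 ≤ ε ^ 2 + x ^ 2 / ε ^ 2 := by positivity
        linarith
    _ = _ := by ring

lemma integrable_norm_cauchyTransform_line_pow {f : ℝ → ℝ} (hf : IsBddCompact f) {ε : ℝ}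
    (hε : 0 < ε) {m : ℕ} (hm : 1 ≤ m) :
    Integrable fun x : ℝ => ‖cauchyTransform f (x + ε * Complex.I)‖ ^ (2 * m) := by
  obtain ⟨C, hC0, hC⟩ := cauchyTransform_line_bound hf hε
  have hmeas := measurable_cauchyTransform_line hf ε
  refine Integrable.mono' (integrable_inv_one_add_sq.const_mul (C ^ m))
    (by apply Measurable.aestronglyMeasurable; fun_prop) (ae_of_all _ fun x => ?_)
  rw [norm_pow, norm_norm, pow_mul]
  refine (pow_le_pow_left₀ (by positivity) (hC x) m).trans ?_
  rw [mul_pow]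
  gcongr
  have h1 : (1 + x ^ 2)⁻¹ ≤ 1 := inv_le_one_of_one_le₀ (by nlinarith)
  calc ((1 + x ^ 2)⁻¹) ^ m ≤ ((1 + x ^ 2)⁻¹) ^ 1 :=
        pow_le_pow_of_le_one (by positivity) h1 hm
    _ = _ := pow_one _

/-- Cauchy's theorem on the rectangle `[-X, X] × [ε, X]`: on the three other sides the integrand is
`O(X^(-2))` and their total length is at most `4 X`. -/
lemma integral_cauchyTransform_line_pow {f : ℝ → ℝ} (hf : IsBddCompact f) {ε : ℝ}
    (hε : 0 < ε) {m : ℕ} (hm : 1 ≤ m) :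
    ∫ x : ℝ, cauchyTransform f (x + ε * Complex.I) ^ (2 * m) = 0 := by
  have hmeas := measurable_cauchyTransform_line hf ε
  have hint : Integrable fun x : ℝ => cauchyTransform f (x + ε * Complex.I) ^ (2 * m) := by
    rw [← integrable_norm_iff (by apply Measurable.aestronglyMeasurable; fun_prop)]
    simpa only [norm_pow] using integrable_norm_cauchyTransform_line_pow hf hε hm
  have h1 := intervalIntegral_tendsto_integral (μ := volume) (l := atTop) hint tendsto_neg_atTop_atBot tendsto_id
  refine tendsto_nhds_unique h1 ?_
  obtain ⟨C, hC0, hC⟩ := cauchyTransform_bound hf hε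
  have hbd : ∀ X : ℝ, 1 ≤ X → ∀ z : ℂ, ε ≤ z.im → X ≤ ‖z‖ →
      ‖cauchyTransform f z ^ (2 * m)‖ ≤ C ^ (2 * m) / X ^ 2 := by
    intro X hX z hz hXz
    rw [norm_pow]
    calc ‖cauchyTransform f z‖ ^ (2 * m) ≤ (C / X) ^ (2 * m) := by
          gcongr
          exact (hC z hz).trans (by gcongr)
      _ = C ^ (2 * m) / X ^ (2 * m) := div_pow _ _ _
      _ ≤ _ := by
          gcongr
          omega
  refine squeeze_zero_norm' (a := fun X => 4 * C ^ (2 * m) / X) ?_ ?_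
  · filter_upwards [eventually_ge_atTop (max 1 ε)] with X hX
    have hX1 : 1 ≤ X := (le_max_left _ _).trans hX
    have hXε : ε ≤ X := (le_max_right _ _).trans hX
    have hXpos : 0 < X := by linarith
    have hrect := Complex.integral_boundary_rect_eq_zero_of_differentiableOn
      (fun z => cauchyTransform f z ^ (2 * m)) ⟨-X, ε⟩ ⟨X, X⟩ ?_
    · simp only at hrect
      have hA : ‖∫ x in (-X)..X, cauchyTransform f (x + X * Complex.I) ^ (2 * m)‖
          ≤ C ^ (2 * m) / X ^ 2 * |X - -X| := by
        refine intervalIntegral.norm_integral_le_of_norm_le_const fun x _ => ?_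
        refine hbd X hX1 _ (by simpa using hXε) ?_
        have := Complex.abs_im_le_norm (x + X * Complex.I)
        simp only [Complex.add_im, Complex.ofReal_im, Complex.mul_im, Complex.ofReal_re,
          Complex.I_im, mul_one, Complex.I_re, mul_zero, add_zero, zero_add] at this
        exact (le_abs_self _).trans this
      have hV : ∀ s : ℝ, |s| = X →
          ‖Complex.I • ∫ y in ε..X, cauchyTransform f (s + y * Complex.I) ^ (2 * m)‖
          ≤ C ^ (2 * m) / X ^ 2 * |X - ε| := by
        intro s hs
        rw [norm_smul, Complex.norm_I, one_mul]
        refine intervalIntegral.norm_integral_le_of_norm_le_const fun y hy => ?_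
        rw [Set.uIoc_of_le hXε] at hy
        refine hbd X hX1 _ (by simpa using hy.1.le) ?_
        have := Complex.abs_re_le_norm (s + y * Complex.I)
        simp only [Complex.add_re, Complex.ofReal_re, Complex.mul_re, Complex.I_re, mul_zero,
          Complex.ofReal_im, Complex.I_im, mul_one, sub_self, add_zero, hs] at this
        exact this
      have h2 := hV X (abs_of_pos hXpos)
      have h3 := hV (-X) (by rw [abs_neg, abs_of_pos hXpos])
      have heq : (∫ x in (-X)..X, cauchyTransform f (x + ε * Complex.I) ^ (2 * m)) =
          (∫ x in (-X)..X, cauchyTransform f (x + X * Complex.I) ^ (2 * m)) -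
          (Complex.I • ∫ y in ε..X, cauchyTransform f ((X : ℝ) + y * Complex.I) ^ (2 * m)) +
          Complex.I • ∫ y in ε..X, cauchyTransform f ((-X : ℝ) + y * Complex.I) ^ (2 * m) := by
        linear_combination hrect
      simp only [id]
      rw [heq]
      refine (norm_add_le _ _).trans ((add_le_add ((norm_sub_le _ _).trans
        (add_le_add hA h2)) h3).trans ?_)
      rw [abs_of_nonneg (by linarith), abs_of_nonneg (by linarith)]
      have hK : 0 ≤ C ^ (2 * m) / X ^ 2 := by positivity
      calc _ ≤ C ^ (2 * m) / X ^ 2 * (4 * X) := by nlinarith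
        _ = _ := by field_simp
    · intro z hz
      have hz2 : ε ≤ z.im := by
        have := hz.2
        simp only [Set.mem_preimage] at this
        rw [Set.uIcc_of_le hXε] at this
        exact this.1
      exact ((cauchyTransform_differentiableAt hf (hε.trans_le hz2)).pow _).differentiableWithinAt
  · exact tendsto_const_nhds.div_atTop tendsto_id

/-! ### M. Riesz' inequality for even exponents -/

/-- The right side collects the absolute values of all binomial terms of `(x + i y)^n` except `x^n`.
-/
lemma norm_pow_sub_re_pow_le (z : ℂ) (n : ℕ) :
    ‖z ^ n - (z.re : ℂ) ^ n‖ ≤ (|z.re| + |z.im|) ^ n - |z.re| ^ n := by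
  induction n with
  | zero => simp
  | succ n ih =>
    have h1 : z ^ (n + 1) - (z.re : ℂ) ^ (n + 1)
        = z * (z ^ n - (z.re : ℂ) ^ n) + (z - z.re) * (z.re : ℂ) ^ n := by ring
    have h2 : ‖z - z.re‖ = |z.im| := by
      have : z - z.re = (z.im : ℂ) * Complex.I := by
        apply Complex.ext <;> simp
      rw [this]; simp
    rw [h1]
    refine (norm_add_le _ _).trans ?_
    rw [norm_mul, norm_mul, h2, norm_pow, Complex.norm_real, Real.norm_eq_abs]
    have h3 := Complex.norm_le_abs_re_add_abs_im z
    calc _ ≤ (|z.re| + |z.im|) * ((|z.re| + |z.im|) ^ n - |z.re| ^ n) + |z.im| * |z.re| ^ n := by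
          gcongr
      _ = _ := by ring

lemma exp_third_le : Real.exp (1 / 3) ≤ 3 / 2 := by
  have h : Real.exp (1 / 3) ^ 3 ≤ (3 / 2) ^ 3 := by
    rw [← Real.exp_nat_mul]
    norm_num
    linarith [Real.exp_one_lt_d9]
  exact le_of_pow_le_pow_left₀ (by norm_num) (by norm_num) h

/-- If `|x| ≥ 6 m |y|`, then `z^(2m)` differs from `x^(2m)` by at most half of it. Otherwise `|z| ≤
7 m |y|` and the last term absorbs everything. The constant is linear in `m`, and this is the origin
of the factor `p` per variable. -/
lemma re_pow_le_re_pow_add_im_pow (z : ℂ) {m : ℕ} (hm : 1 ≤ m) :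
    z.re ^ (2 * m) ≤ 2 * (z ^ (2 * m)).re + (21 * m * |z.im|) ^ (2 * m) := by
  have hm' : (1 : ℝ) ≤ m := by exact_mod_cast hm
  have habs : |z.re| ^ (2 * m) = z.re ^ (2 * m) := by rw [pow_mul, sq_abs, ← pow_mul]
  rcases le_total (6 * m * |z.im|) |z.re| with h | h
  · have h1 := norm_pow_sub_re_pow_le z (2 * m)
    -- The threshold `6 m` makes `(1 + 1 / (6 m))^(2m)` at most `e^(1/3) ≤ 3/2`.
    have h2 : (|z.re| + |z.im|) ^ (2 * m) ≤ 3 / 2 * |z.re| ^ (2 * m) := by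
      have h3 : |z.re| + |z.im| ≤ |z.re| * Real.exp (1 / (6 * m)) := by
        have h4 : |z.im| ≤ |z.re| * (1 / (6 * m)) := by
          rw [mul_one_div, le_div_iff₀ (by positivity)]; linarith
        have h5 := Real.add_one_le_exp (1 / (6 * m : ℝ))
        nlinarith [abs_nonneg z.re]
      calc _ ≤ (|z.re| * Real.exp (1 / (6 * m))) ^ (2 * m) := by gcongr
        _ = |z.re| ^ (2 * m) * Real.exp (1 / 3) := by
            rw [mul_pow, ← Real.exp_nat_mul]
            congr 2
            push_cast; field_simp; norm_num
        _ ≤ _ := by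
            rw [mul_comm]; gcongr; exact exp_third_le
    have h3 := (abs_le.1 ((Complex.abs_re_le_norm _).trans h1)).1
    rw [Complex.sub_re, ← Complex.ofReal_pow, Complex.ofReal_re] at h3
    have : 0 ≤ (21 * m * |z.im|) ^ (2 * m) := by positivity
    linarith
  · have h1 : ‖z‖ ^ (2 * m) ≤ (7 * m * |z.im|) ^ (2 * m) := by
      gcongr
      refine (Complex.norm_le_abs_re_add_abs_im z).trans ?_
      nlinarith [abs_nonneg z.im]
    have h2 : z.re ^ (2 * m) ≤ (7 * m * |z.im|) ^ (2 * m) := by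
      rw [← habs]
      exact (pow_le_pow_left₀ (abs_nonneg _) (Complex.abs_re_le_norm z) _).trans h1
    have h3 : -(z ^ (2 * m)).re ≤ (7 * m * |z.im|) ^ (2 * m) := by
      refine le_trans ((neg_le_abs _).trans (Complex.abs_re_le_norm _)) ?_
      rwa [norm_pow]
    have h4 : (21 * m * |z.im|) ^ (2 * m) = 3 ^ (2 * m) * (7 * m * |z.im|) ^ (2 * m) := by
      rw [← mul_pow]; ring
    have h5 : (3 : ℝ) ≤ 3 ^ (2 * m) := le_self_pow₀ (by norm_num) (by omega)
    have h6 : 0 ≤ (7 * m * |z.im|) ^ (2 * m) := by positivity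
    rw [h4]
    nlinarith

/-- The conjugate Poisson integral, without its factor `1 / π`. -/
noncomputable def conjPoisson {E : Type*} [NormedAddCommGroup E] [NormedSpace ℝ E] (ε : ℝ)
    (f : ℝ → E) (x : ℝ) : E :=
  ∫ t : ℝ, ((x - t) / ((x - t) ^ 2 + ε ^ 2)) • f t

lemma integrable_cauchyTransform_integrand {f : ℝ → ℝ} (hf : IsBddCompact f) {z : ℂ}
    (hz : 0 < z.im) : Integrable fun t : ℝ => (f t : ℂ) * (z - t)⁻¹ := by
  have hfm := hf.measurable
  refine Integrable.mono' (g := fun t => ‖f t‖ * (1 / z.im)) ((hf.integrable volume).norm.mul_const _)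
      (by apply Measurable.aestronglyMeasurable; fun_prop) (ae_of_all _ fun t => ?_)
  rw [norm_mul, norm_inv, Complex.norm_real, one_div]
  gcongr
  exact im_le_norm_sub_ofReal z t

lemma cauchyTransform_re {f : ℝ → ℝ} (hf : IsBddCompact f) {ε : ℝ} (hε : 0 < ε) (x : ℝ) :
    (cauchyTransform f (x + ε * Complex.I)).re = conjPoisson ε f x := by
  have hi := integrable_cauchyTransform_integrand hf (z := x + ε * Complex.I) (by simpa using hε)
  have h := integral_re hi
  simp only [RCLike.re_eq_complex_re] at h
  rw [cauchyTransform, ← h, conjPoisson]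
  congr 1; ext t
  rw [Complex.re_ofReal_mul, Complex.inv_re, Complex.normSq_apply]
  simp [mul_comm, sq]

/-- `Im (z - t)⁻¹` is `-π` times the Cauchy density with centre `x` and scale `ε`, so the Poisson
integral is an expectation and Jensen's inequality becomes available. -/
lemma cauchyTransform_im {f : ℝ → ℝ} (hf : IsBddCompact f) {ε : ℝ≥0} (hε : 0 < ε) (x : ℝ) :
    (cauchyTransform f (x + ε * Complex.I)).im
      = -(Real.pi * ∫ t, f t ∂(ProbabilityTheory.cauchyMeasure x ε)) := by
  have hi := integrable_cauchyTransform_integrand hf (z := x + (ε : ℝ) * Complex.I)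
    (by simpa using hε)
  have h := integral_im hi
  simp only [RCLike.im_eq_complex_im] at h
  have h2 : (cauchyTransform f (x + ε * Complex.I)).im
    = (∫ (t : ℝ), (f t : ℂ) * ((x + (ε : ℝ) * Complex.I : ℂ) - t)⁻¹).im := rfl
  rw [h2, ← h, ProbabilityTheory.cauchyMeasure_of_scale_ne_zero _ hε.ne',
    integral_withDensity_eq_integral_toReal_smul (ProbabilityTheory.measurable_cauchyPDF _ _)
      (ae_of_all _ fun t => by simp [ProbabilityTheory.cauchyPDF]),
    ← integral_const_mul, ← integral_neg]
  congr 1; ext t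
  rw [Complex.im_ofReal_mul, Complex.inv_im, Complex.normSq_apply]
  have hd : 0 < (x - t) ^ 2 + (ε : ℝ) ^ 2 := by positivity
  have hd' : (t - x) ^ 2 + (ε : ℝ) ^ 2 = (x - t) ^ 2 + (ε : ℝ) ^ 2 := by ring
  rw [ProbabilityTheory.cauchyPDF, ENNReal.toReal_ofReal, ProbabilityTheory.cauchyPDFReal_def, hd']
  · simp only [Complex.sub_im, Complex.add_im, Complex.ofReal_im, Complex.mul_im, Complex.ofReal_re,
      Complex.I_im, mul_one, Complex.I_re, mul_zero, add_zero, zero_add, sub_zero, Complex.sub_re,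
      Complex.add_re, Complex.mul_re, sub_self, smul_eq_mul]
    rw [← sq, ← sq]
    have := Real.pi_pos
    field_simp
  · exact (ProbabilityTheory.cauchyPDF_pos _ hε.ne' _).le

lemma enorm_integral_pow_le {μ : Measure ℝ} [IsProbabilityMeasure μ] {f : ℝ → ℝ}
    (hf : Measurable f) {n : ℕ} (hn : 1 ≤ n) :
    ‖∫ t, f t ∂μ‖ₑ ^ n ≤ ∫⁻ t, ‖f t‖ₑ ^ n ∂μ := by
  have h1 : eLpNorm f 1 μ ≤ eLpNorm f ((n : ℝ≥0) : ℝ≥0∞) μ :=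
    eLpNorm_le_eLpNorm_of_exponent_le (by exact_mod_cast hn) hf.aestronglyMeasurable
  have h2 := eLpNorm_nnreal_pow_eq_lintegral (μ := μ) (f := f) (p := (n : ℝ≥0))
    (by exact_mod_cast (by omega : n ≠ 0))
  simp only [NNReal.coe_natCast, ENNReal.rpow_natCast] at h2
  rw [← h2]
  gcongr
  refine le_trans ?_ h1
  rw [eLpNorm_one_eq_lintegral_enorm]
  exact enorm_integral_le_lintegral_enorm _

/-- Jensen's inequality for each `x`, then Tonelli: the density is symmetric in `x` and `t`, so it
also integrates to 1 in `x`. -/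
lemma lintegral_poisson_pow_le {f : ℝ → ℝ} (hf : Measurable f) {ε : ℝ≥0} (hε : ε ≠ 0) {n : ℕ}
    (hn : 1 ≤ n) :
    ∫⁻ x, ‖∫ t, f t ∂(ProbabilityTheory.cauchyMeasure x ε)‖ₑ ^ n ≤ ∫⁻ t, ‖f t‖ₑ ^ n := by
  have hsymm : ∀ x t, ProbabilityTheory.cauchyPDF x ε t = ProbabilityTheory.cauchyPDF t ε x := by
    intro x t
    rw [ProbabilityTheory.cauchyPDF, ProbabilityTheory.cauchyPDF,
      ProbabilityTheory.cauchyPDFReal_def, ProbabilityTheory.cauchyPDFReal_def]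
    congr 3; ring
  have hm : Measurable fun p : ℝ × ℝ => ProbabilityTheory.cauchyPDF p.1 ε p.2 := by
    unfold ProbabilityTheory.cauchyPDF ProbabilityTheory.cauchyPDFReal
    fun_prop
  calc _ ≤ ∫⁻ x, ∫⁻ t, ‖f t‖ₑ ^ n ∂(ProbabilityTheory.cauchyMeasure x ε) :=
        lintegral_mono fun x => enorm_integral_pow_le hf hn
    _ = ∫⁻ x, ∫⁻ t, ProbabilityTheory.cauchyPDF x ε t * ‖f t‖ₑ ^ n := by
        refine lintegral_congr fun x => ?_
        rw [ProbabilityTheory.cauchyMeasure_of_scale_ne_zero _ hε,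
          lintegral_withDensity_eq_lintegral_mul _ (by fun_prop) (by fun_prop)]
        rfl
    _ = ∫⁻ t, ∫⁻ x, ProbabilityTheory.cauchyPDF x ε t * ‖f t‖ₑ ^ n := by
        refine lintegral_lintegral_swap ?_
        apply Measurable.aemeasurable
        exact hm.mul (by fun_prop)
    _ = ∫⁻ t, ‖f t‖ₑ ^ n := by
        refine lintegral_congr fun t => ?_
        simp_rw [hsymm _ t]
        rw [lintegral_mul_const _ (by fun_prop),
          ProbabilityTheory.lintegral_cauchyPDF_eq_one _ hε, one_mul]

lemma enorm_pow_even (x : ℝ) (m : ℕ) : ‖x‖ₑ ^ (2 * m) = ENNReal.ofReal (x ^ (2 * m)) := by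
  rw [← ofReal_norm, ← ENNReal.ofReal_pow (norm_nonneg _), Real.norm_eq_abs, pow_mul,
    sq_abs, ← pow_mul]

/-- M. Riesz' inequality for even exponents and real functions. -/
lemma lintegral_conjPoisson_real_pow_le {f : ℝ → ℝ} (hf : IsBddCompact f) {ε : ℝ≥0} (hε : 0 < ε)
    {m : ℕ} (hm : 1 ≤ m) :
    ∫⁻ x, ‖conjPoisson ε f x‖ₑ ^ (2 * m)
      ≤ ENNReal.ofReal (66 * m) ^ (2 * m) * ∫⁻ t, ‖f t‖ₑ ^ (2 * m) := by
  have hε' : (0 : ℝ) < ε := hε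
  set P : ℝ → ℝ := fun x => ∫ t, f t ∂(ProbabilityTheory.cauchyMeasure x ε) with hP
  have hmeas := measurable_cauchyTransform_line hf ε
  have hnint := integrable_norm_cauchyTransform_line_pow hf hε' hm
  have hPim : ∀ x : ℝ, |(cauchyTransform f (x + (ε : ℝ) * Complex.I)).im| = Real.pi * |P x| := by
    intro x
    rw [cauchyTransform_im hf hε, abs_neg, abs_mul, abs_of_pos Real.pi_pos]
  have hint : Integrable fun x : ℝ => cauchyTransform f (x + (ε : ℝ) * Complex.I) ^ (2 * m) := by
    rw [← integrable_norm_iff (by apply Measurable.aestronglyMeasurable; fun_prop)]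
    simpa only [norm_pow] using hnint
  have hvint : Integrable fun x : ℝ => conjPoisson ε f x ^ (2 * m) := by
    simp_rw [← cauchyTransform_re hf hε']
    refine hnint.mono' (by apply Measurable.aestronglyMeasurable; fun_prop)
      (ae_of_all _ fun x => ?_)
    rw [norm_pow]
    gcongr
    exact Complex.abs_re_le_norm _
  have huint : Integrable fun x : ℝ => (21 * m * (Real.pi * |P x|)) ^ (2 * m) := by
    simp_rw [← hPim]
    refine (hnint.const_mul ((21 * m) ^ (2 * m))).mono'
      (by apply Measurable.aestronglyMeasurable; fun_prop) (ae_of_all _ fun x => ?_)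
    rw [mul_pow, norm_mul, norm_pow, norm_pow, Real.norm_of_nonneg (by positivity)]
    gcongr
    rw [Real.norm_eq_abs, abs_abs]
    exact Complex.abs_im_le_norm _
  have hre : ∫ x : ℝ, (cauchyTransform f (x + (ε : ℝ) * Complex.I) ^ (2 * m)).re = 0 := by
    have h := integral_re hint
    simp only [RCLike.re_eq_complex_re] at h
    rw [h, integral_cauchyTransform_line_pow hf hε' hm, Complex.zero_re]
  have hreint : Integrable fun x : ℝ =>
      (cauchyTransform f (x + (ε : ℝ) * Complex.I) ^ (2 * m)).re := hint.re
  -- Integrating the pointwise inequality removes the term with `Re F^(2m)`, whose integral is zero.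
  have hle : ∫ x, conjPoisson ε f x ^ (2 * m) ≤ ∫ x, (21 * m * (Real.pi * |P x|)) ^ (2 * m) := by
    have h1 : ∫ x, conjPoisson ε f x ^ (2 * m) ≤
        ∫ x : ℝ, (2 * (cauchyTransform f (x + (ε : ℝ) * Complex.I) ^ (2 * m)).re +
          (21 * m * (Real.pi * |P x|)) ^ (2 * m)) := by
      refine integral_mono hvint ((hreint.const_mul 2).add huint) fun (x : ℝ) => ?_
      have := re_pow_le_re_pow_add_im_pow (cauchyTransform f (x + (ε : ℝ) * Complex.I)) hm
      rw [hPim, cauchyTransform_re hf hε'] at this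
      exact this
    rw [integral_add (hreint.const_mul 2) huint, integral_const_mul, hre] at h1
    linarith
  calc ∫⁻ x, ‖conjPoisson ε f x‖ₑ ^ (2 * m)
      = ENNReal.ofReal (∫ x, conjPoisson ε f x ^ (2 * m)) := by
        rw [ofReal_integral_eq_lintegral_ofReal hvint
          (ae_of_all _ fun x => (even_two_mul m).pow_nonneg _)]
        exact lintegral_congr fun x => enorm_pow_even _ _
    _ ≤ ENNReal.ofReal (∫ x, (21 * m * (Real.pi * |P x|)) ^ (2 * m)) :=
        ENNReal.ofReal_le_ofReal hle
    _ = ∫⁻ x, ENNReal.ofReal (21 * m * Real.pi) ^ (2 * m) * ‖P x‖ₑ ^ (2 * m) := by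
        rw [ofReal_integral_eq_lintegral_ofReal huint (ae_of_all _ fun x => by positivity)]
        refine lintegral_congr fun x => ?_
        rw [← mul_assoc, ENNReal.ofReal_pow (by positivity), ENNReal.ofReal_mul (by positivity),
          mul_pow, ← Real.norm_eq_abs, ofReal_norm]
    _ ≤ ENNReal.ofReal (66 * m) ^ (2 * m) * ∫⁻ x, ‖P x‖ₑ ^ (2 * m) := by
        rw [lintegral_const_mul' _ _ (ENNReal.pow_ne_top ENNReal.ofReal_ne_top)]
        gcongr ?_ ^ _ * _
        refine ENNReal.ofReal_le_ofReal ?_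
        -- `21 π < 66`.
        have := Real.pi_lt_d4
        nlinarith [(Nat.cast_nonneg m : (0 : ℝ) ≤ m)]
    _ ≤ _ := by
        refine mul_le_mul' le_rfl ?_
        exact lintegral_poisson_pow_le hf.measurable hε.ne' (by omega)

lemma IsBddCompact.re {f : ℝ → ℂ} (hf : IsBddCompact f) : IsBddCompact fun t => (f t).re := by
  have hfm := hf.measurable
  obtain ⟨C, hC0, hC⟩ := hf.bdd
  obtain ⟨R, hR0, hR⟩ := hf.supp
  exact ⟨by fun_prop, ⟨C, hC0, fun x => (Complex.abs_re_le_norm _).trans (hC x)⟩,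
    ⟨R, hR0, fun x hx => by simp [hR x hx]⟩⟩

lemma IsBddCompact.im {f : ℝ → ℂ} (hf : IsBddCompact f) : IsBddCompact fun t => (f t).im := by
  have hfm := hf.measurable
  obtain ⟨C, hC0, hC⟩ := hf.bdd
  obtain ⟨R, hR0, hR⟩ := hf.supp
  exact ⟨by fun_prop, ⟨C, hC0, fun x => (Complex.abs_im_le_norm _).trans (hC x)⟩,
    ⟨R, hR0, fun x hx => by simp [hR x hx]⟩⟩

lemma abs_conjPoisson_kernel_le (s : ℝ) {ε : ℝ} (hε : 0 < ε) :
    |s / (s ^ 2 + ε ^ 2)| ≤ 1 / ε := by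
  rw [abs_div, abs_of_pos (by positivity : 0 < s ^ 2 + ε ^ 2),
    div_le_div_iff₀ (by positivity) hε]
  nlinarith [sq_nonneg (|s| - ε), sq_abs s, abs_nonneg s]

lemma integrable_conjPoisson {f : ℝ → ℂ} (hf : IsBddCompact f) {ε : ℝ} (hε : 0 < ε) (x : ℝ) :
    Integrable fun t : ℝ => ((x - t) / ((x - t) ^ 2 + ε ^ 2)) • f t := by
  have hfm := hf.measurable
  refine ((hf.integrable volume).norm.const_mul (1 / ε)).mono'
    (by apply Measurable.aestronglyMeasurable; fun_prop) (ae_of_all _ fun t => ?_)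
  rw [norm_smul]
  gcongr
  exact abs_conjPoisson_kernel_le _ hε

lemma measurable_conjPoisson {f : ℝ → ℂ} (hf : Measurable f) (ε : ℝ) :
    Measurable (conjPoisson ε f) := by
  apply StronglyMeasurable.measurable
  refine StronglyMeasurable.integral_prod_right' (f := fun p : ℝ × ℝ =>
    ((p.1 - p.2) / ((p.1 - p.2) ^ 2 + ε ^ 2)) • f p.2) ?_
  apply Measurable.stronglyMeasurable
  fun_prop

lemma ENNReal.add_pow_le_two_pow (a b : ℝ≥0∞) (n : ℕ) :
    (a + b) ^ n ≤ 2 ^ n * (a ^ n + b ^ n) := by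
  rcases le_total a b with h | h
  · calc _ ≤ (2 * b) ^ n := by gcongr; rw [two_mul]; gcongr
      _ ≤ _ := by rw [mul_pow]; gcongr; exact le_add_self
  · calc _ ≤ (2 * a) ^ n := by gcongr; rw [two_mul]; gcongr
      _ ≤ _ := by rw [mul_pow]; gcongr; exact le_self_add

/-- Real and imaginary parts are treated separately. Here `264 = 4 · 66`: one factor 2 comes from
`(a + b)^n ≤ 2^n (a^n + b^n)`, the other absorbs the sum of two equal terms. -/
lemma lintegral_conjPoisson_pow_le {f : ℝ → ℂ} (hf : IsBddCompact f) {ε : ℝ≥0} (hε : 0 < ε)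
    {m : ℕ} (hm : 1 ≤ m) :
    ∫⁻ x, ‖conjPoisson ε f x‖ₑ ^ (2 * m)
      ≤ ENNReal.ofReal (264 * m) ^ (2 * m) * ∫⁻ t, ‖f t‖ₑ ^ (2 * m) := by
  have hε' : (0 : ℝ) < ε := hε
  have hre : ∀ x, (conjPoisson ε f x).re = conjPoisson ε (fun t => (f t).re) x := by
    intro x
    have h := integral_re (integrable_conjPoisson hf hε' x)
    simp only [RCLike.re_eq_complex_re] at h
    rw [conjPoisson, ← h, conjPoisson]
    simp only [Complex.smul_re]
  have him : ∀ x, (conjPoisson ε f x).im = conjPoisson ε (fun t => (f t).im) x := by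
    intro x
    have h := integral_im (integrable_conjPoisson hf hε' x)
    simp only [RCLike.im_eq_complex_im] at h
    rw [conjPoisson, ← h, conjPoisson]
    simp only [Complex.smul_im]
  have hm1 := measurable_conjPoisson hf.measurable ε
  have hb : ∀ x, ‖conjPoisson ε f x‖ₑ ^ (2 * m) ≤ 2 ^ (2 * m) *
      (‖conjPoisson ε (fun t => (f t).re) x‖ₑ ^ (2 * m) +
        ‖conjPoisson ε (fun t => (f t).im) x‖ₑ ^ (2 * m)) := by
    intro x
    refine le_trans ?_ (ENNReal.add_pow_le_two_pow _ _ _)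
    gcongr
    rw [← hre, ← him]
    have h := Complex.norm_le_abs_re_add_abs_im (conjPoisson ε f x)
    simp only [← Real.norm_eq_abs] at h
    rw [← ofReal_norm, ← ofReal_norm, ← ofReal_norm,
      ← ENNReal.ofReal_add (norm_nonneg _) (norm_nonneg _)]
    exact ENNReal.ofReal_le_ofReal h
  have hmr : Measurable fun x => ‖conjPoisson ε (fun t => (f t).re) x‖ₑ ^ (2 * m) := by
    simp_rw [← hre]; fun_prop
  have hcmp : ∀ g : ℝ → ℝ, (∀ t, |g t| ≤ ‖f t‖) →
      ∫⁻ t, ‖g t‖ₑ ^ (2 * m) ≤ ∫⁻ t, ‖f t‖ₑ ^ (2 * m) := by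
    intro g hg
    refine lintegral_mono fun t => ?_
    gcongr
    rw [← ofReal_norm, ← ofReal_norm]
    exact ENNReal.ofReal_le_ofReal (hg t)
  calc _ ≤ ∫⁻ x, 2 ^ (2 * m) * (‖conjPoisson ε (fun t => (f t).re) x‖ₑ ^ (2 * m) +
        ‖conjPoisson ε (fun t => (f t).im) x‖ₑ ^ (2 * m)) := lintegral_mono hb
    _ = 2 ^ (2 * m) * ((∫⁻ x, ‖conjPoisson ε (fun t => (f t).re) x‖ₑ ^ (2 * m)) +
        ∫⁻ x, ‖conjPoisson ε (fun t => (f t).im) x‖ₑ ^ (2 * m)) := by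
        rw [lintegral_const_mul' _ _ (by finiteness), lintegral_add_left hmr]
    _ ≤ 2 ^ (2 * m) * (ENNReal.ofReal (66 * m) ^ (2 * m) * (∫⁻ t, ‖f t‖ₑ ^ (2 * m)) +
        ENNReal.ofReal (66 * m) ^ (2 * m) * (∫⁻ t, ‖f t‖ₑ ^ (2 * m))) := by
        gcongr
        · exact (lintegral_conjPoisson_real_pow_le hf.re hε hm).trans (by
            refine mul_le_mul' le_rfl ?_; exact hcmp _ fun t => Complex.abs_re_le_norm _)
        · exact (lintegral_conjPoisson_real_pow_le hf.im hε hm).trans (by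
            refine mul_le_mul' le_rfl ?_; exact hcmp _ fun t => Complex.abs_im_le_norm _)
    _ = 2 * (ENNReal.ofReal (132 * m) ^ (2 * m) * ∫⁻ t, ‖f t‖ₑ ^ (2 * m)) := by
        have : ENNReal.ofReal (132 * m) = 2 * ENNReal.ofReal (66 * m) := by
          rw [← ENNReal.ofReal_ofNat 2, ← ENNReal.ofReal_mul (by norm_num)]; congr 1; ring
        rw [this, mul_pow]; ring
    _ ≤ _ := by
        have : ENNReal.ofReal (264 * m) = 2 * ENNReal.ofReal (132 * m) := by
          rw [← ENNReal.ofReal_ofNat 2, ← ENNReal.ofReal_mul (by norm_num)]; congr 1; ring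
        rw [this, mul_pow, mul_assoc]
        gcongr
        exact le_self_pow₀ (by norm_num) (by omega)

/-- Fatou's lemma in the form used for every passage to the limit below. -/
lemma lintegral_le_of_tendsto {X : Type*} [MeasurableSpace X] {μ : Measure X}
    {F : ℕ → X → ℝ≥0∞} {G : X → ℝ≥0∞} {C : ℝ≥0∞} (hF : ∀ n, Measurable (F n))
    (h : ∀ x, Tendsto (fun n => F n x) atTop (𝓝 (G x))) (hb : ∀ n, ∫⁻ x, F n x ∂μ ≤ C) :
    ∫⁻ x, G x ∂μ ≤ C := by
  calc ∫⁻ x, G x ∂μ = ∫⁻ x, liminf (fun n => F n x) atTop ∂μ :=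
        lintegral_congr fun x => ((h x).liminf_eq).symm
    _ ≤ liminf (fun n => ∫⁻ x, F n x ∂μ) atTop := lintegral_liminf_le hF
    _ ≤ liminf (fun _ : ℕ => C) atTop := liminf_le_liminf (Eventually.of_forall hb)
    _ = C := liminf_const _

/-! ### The one-dimensional Dirichlet operator -/

/-- The one-dimensional Dirichlet kernel `sin (M s) / (π s)`. -/
noncomputable def dirichletKernel (M s : ℝ) : ℝ := M / Real.pi * Real.sinc (M * s)

/-- The one-dimensional Fourier partial integral as a convolution. -/
noncomputable def dirichletOp (M : ℝ) (f : ℝ → ℂ) (x : ℝ) : ℂ :=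
  ∫ t : ℝ, dirichletKernel M (x - t) • f t

lemma continuous_dirichletKernel (M : ℝ) : Continuous (dirichletKernel M) := by
  unfold dirichletKernel
  fun_prop

lemma abs_dirichletKernel_le {M : ℝ} (hM : 0 < M) (s : ℝ) :
    |dirichletKernel M s| ≤ M / Real.pi := by
  rw [dirichletKernel, abs_mul, abs_of_pos (div_pos hM Real.pi_pos)]
  exact mul_le_of_le_one_right (by positivity) (Real.abs_sinc_le_one _)

lemma dirichletKernel_neg (M s : ℝ) : dirichletKernel M (-s) = dirichletKernel M s := by
  rw [dirichletKernel, mul_neg, Real.sinc_neg, dirichletKernel]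

lemma dirichletKernel_of_ne_zero {M s : ℝ} (hM : 0 < M) (hs : s ≠ 0) :
    dirichletKernel M s = Real.sin (M * s) / (Real.pi * s) := by
  rw [dirichletKernel, Real.sinc_of_ne_zero (mul_ne_zero hM.ne' hs)]
  have := Real.pi_pos
  field_simp

lemma IsBddCompact.mul_unimodular {X : Type*} [NormedAddCommGroup X] [MeasurableSpace X]
    {f c : X → ℂ} (hf : IsBddCompact f) (hc : Measurable c) (h1 : ∀ x, ‖c x‖ ≤ 1) :
    IsBddCompact fun x => c x * f x := by
  obtain ⟨C, hC0, hC⟩ := hf.bdd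
  obtain ⟨R, hR0, hR⟩ := hf.supp
  refine ⟨hc.mul hf.measurable, ⟨C, hC0, fun x => ?_⟩, ⟨R, hR0, fun x hx => by simp [hR x hx]⟩⟩
  rw [norm_mul]
  calc _ ≤ 1 * C := by gcongr; exacts [h1 x, hC x]
    _ = C := one_mul C

lemma measurable_dirichletOp {f : ℝ → ℂ} (hf : Measurable f) (M : ℝ) :
    Measurable (dirichletOp M f) := by
  have := (continuous_dirichletKernel M).measurable
  apply StronglyMeasurable.measurable
  refine StronglyMeasurable.integral_prod_right' (f := fun p : ℝ × ℝ =>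
    dirichletKernel M (p.1 - p.2) • f p.2) ?_
  apply Measurable.stronglyMeasurable
  fun_prop

/-- The function `t ↦ exp(i a t)`. -/
noncomputable def expChar (a t : ℝ) : ℂ := Complex.exp ((a * t : ℝ) * Complex.I)

lemma norm_expChar (a t : ℝ) : ‖expChar a t‖ = 1 := Complex.norm_exp_ofReal_mul_I _

lemma measurable_expChar (a : ℝ) : Measurable (expChar a) := by
  unfold expChar; fun_prop

/-- Regularization of `dirichletOp` as a combination of modulated conjugate Poisson integrals. -/
noncomputable def smoothDirichletOp (M ε : ℝ) (f : ℝ → ℂ) (x : ℝ) : ℂ :=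
  (2 * Real.pi * Complex.I)⁻¹ *
    (expChar M x * conjPoisson ε (fun t => expChar (-M) t * f t) x
      - expChar (-M) x * conjPoisson ε (fun t => expChar M t * f t) x)

/-- The two modulations combine to `e^(iM(x-t)) - e^(-iM(x-t)) = 2i sin M(x-t)`, which multiplies
the conjugate Poisson kernel. -/
lemma smoothDirichletOp_eq {f : ℝ → ℂ} (hf : IsBddCompact f) {M ε : ℝ} (hε : 0 < ε) (x : ℝ) :
    smoothDirichletOp M ε f x =
      ∫ t, ((x - t) / ((x - t) ^ 2 + ε ^ 2) * Real.sin (M * (x - t)) / Real.pi) • f t := by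
  have h1 := integrable_conjPoisson (hf.mul_unimodular (measurable_expChar (-M))
    fun x => (norm_expChar _ x).le) hε x
  have h2 := integrable_conjPoisson (hf.mul_unimodular (measurable_expChar M)
    fun x => (norm_expChar _ x).le) hε x
  rw [smoothDirichletOp, conjPoisson, conjPoisson, ← integral_const_mul, ← integral_const_mul,
    ← integral_sub (h1.const_mul _) (h2.const_mul _), ← integral_const_mul]
  congr 1; ext t
  have hs : (expChar M x * expChar (-M) t - expChar (-M) x * expChar M t)
      = 2 * Complex.I * (Real.sin (M * (x - t)) : ℂ) := by
    rw [expChar, expChar, expChar, expChar, ← Complex.exp_add, ← Complex.exp_add,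
      Complex.ofReal_sin, Complex.sin]
    have e1 : ((M * x : ℝ) * Complex.I + (-M * t : ℝ) * Complex.I) =
      ((M * (x - t) : ℝ) : ℂ) * Complex.I := by push_cast; ring
    have e2 : ((-M * x : ℝ) * Complex.I + (M * t : ℝ) * Complex.I) =
      -((M * (x - t) : ℝ) : ℂ) * Complex.I := by push_cast; ring
    rw [e1, e2]
    have := Complex.I_sq
    linear_combination (-Complex.exp (-((M * (x - t) : ℝ) : ℂ) * Complex.I)
      + Complex.exp (((M * (x - t) : ℝ) : ℂ) * Complex.I)) * this
  have hpi : (Real.pi : ℂ) ≠ 0 := by exact_mod_cast Real.pi_ne_zero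
  simp only [Complex.real_smul]
  rw [show expChar M x * (((x - t) / ((x - t) ^ 2 + ε ^ 2) : ℝ) * (expChar (-M) t * f t)) -
      expChar (-M) x * (((x - t) / ((x - t) ^ 2 + ε ^ 2) : ℝ) * (expChar M t * f t)) =
      (expChar M x * expChar (-M) t - expChar (-M) x * expChar M t) *
        ((((x - t) / ((x - t) ^ 2 + ε ^ 2) : ℝ) : ℂ) * f t) by ring, hs]
  push_cast
  have hI := Complex.I_ne_zero
  field_simp

/-- Dominated convergence: `s² / (s² + ε²) ≤ 1` and `|sin Ms| ≤ M |s|` bound all regularized kernels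
by `M / π`. -/
lemma tendsto_smoothDirichletOp {f : ℝ → ℂ} (hf : IsBddCompact f) {M : ℝ} (hM : 0 < M) (x : ℝ) :
    Tendsto (fun n : ℕ => smoothDirichletOp M (1 / ((n : ℝ) + 1)) f x) atTop
      (𝓝 (dirichletOp M f x)) := by
  have hfm := hf.measurable
  have he : ∀ n : ℕ, (0 : ℝ) < 1 / ((n : ℝ) + 1) := fun n => Nat.one_div_pos_of_nat
  simp_rw [fun n => smoothDirichletOp_eq hf (M := M) (he n) x]
  rw [dirichletOp]
  refine tendsto_integral_of_dominated_convergence (fun t => (M / Real.pi) * ‖f t‖) (fun n => ?_)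
    ((hf.integrable volume).norm.const_mul _) (fun n => ae_of_all _ fun t => ?_) ?_
  · apply Measurable.aestronglyMeasurable; fun_prop
  · rw [norm_smul]
    gcongr
    set s := x - t
    have hn := he n
    set ε := (1 / ((n : ℝ) + 1))
    have hd : 0 < s ^ 2 + ε ^ 2 := by positivity
    have hsin : |Real.sin (M * s)| ≤ M * |s| := by
      refine (Real.abs_sin_le_abs).trans ?_
      rw [abs_mul, abs_of_pos hM]
    rw [Real.norm_eq_abs, abs_div, abs_mul, abs_div, abs_of_pos hd, abs_of_pos Real.pi_pos]
    gcongr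
    rw [div_mul_eq_mul_div, div_le_iff₀ hd]
    calc |s| * |Real.sin (M * s)| ≤ |s| * (M * |s|) := by gcongr
      _ = M * s ^ 2 := by rw [← sq_abs s]; ring
      _ ≤ _ := by nlinarith [sq_nonneg ε]
  · have hne : ∀ᵐ t ∂(volume : Measure ℝ), t ≠ x := by
      simp [ae_iff]
    filter_upwards [hne] with t ht
    have hs : x - t ≠ 0 := sub_ne_zero.2 (Ne.symm ht)
    refine Tendsto.smul_const ?_ _
    rw [dirichletKernel_of_ne_zero hM hs]
    have h0 : Tendsto (fun n : ℕ => 1 / ((n : ℝ) + 1)) atTop (𝓝 0) :=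
      tendsto_one_div_add_atTop_nhds_zero_nat
    have h1 : Tendsto (fun n : ℕ => (x - t) / ((x - t) ^ 2 + (1 / ((n : ℝ) + 1)) ^ 2) *
        Real.sin (M * (x - t)) / Real.pi) atTop
        (𝓝 ((x - t) / ((x - t) ^ 2 + 0 ^ 2) * Real.sin (M * (x - t)) / Real.pi)) := by
      refine ((tendsto_const_nhds.div (tendsto_const_nhds.add (h0.pow 2)) ?_).mul_const _).div_const _
      positivity
    convert h1 using 2
    have := Real.pi_pos
    field_simp
    ring

lemma lintegral_smoothDirichletOp_pow_le {f : ℝ → ℂ} (hf : IsBddCompact f) {M : ℝ} {ε : ℝ≥0}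
    (hε : 0 < ε) {m : ℕ} (hm : 1 ≤ m) :
    ∫⁻ x, ‖smoothDirichletOp M ε f x‖ₑ ^ (2 * m)
      ≤ ENNReal.ofReal (1056 * m) ^ (2 * m) * ∫⁻ t, ‖f t‖ₑ ^ (2 * m) := by
  have h1 := hf.mul_unimodular (measurable_expChar (-M)) fun x => (norm_expChar _ x).le
  have h2 := hf.mul_unimodular (measurable_expChar M) fun x => (norm_expChar _ x).le
  have hm1 := measurable_conjPoisson h1.measurable ε
  have hb : ∀ x, ‖smoothDirichletOp M ε f x‖ₑ ^ (2 * m) ≤ 2 ^ (2 * m) *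
      (‖conjPoisson ε (fun t => expChar (-M) t * f t) x‖ₑ ^ (2 * m) +
        ‖conjPoisson ε (fun t => expChar M t * f t) x‖ₑ ^ (2 * m)) := by
    intro x
    refine le_trans ?_ (ENNReal.add_pow_le_two_pow _ _ _)
    gcongr
    rw [← ofReal_norm, ← ofReal_norm, ← ofReal_norm,
      ← ENNReal.ofReal_add (norm_nonneg _) (norm_nonneg _)]
    refine ENNReal.ofReal_le_ofReal ?_
    rw [smoothDirichletOp, norm_mul]
    have hc : ‖(2 * Real.pi * Complex.I : ℂ)⁻¹‖ ≤ 1 := by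
      rw [norm_inv, norm_mul, norm_mul, Complex.norm_I, Complex.norm_real,
        Real.norm_of_nonneg Real.pi_pos.le]
      refine inv_le_one_of_one_le₀ ?_
      have := Real.pi_gt_three
      simp; linarith
    refine (mul_le_of_le_one_left (norm_nonneg _) hc).trans ((norm_sub_le _ _).trans ?_)
    rw [norm_mul, norm_mul, norm_expChar, norm_expChar, one_mul, one_mul]
  have hnorm : ∀ a, ∫⁻ t, ‖expChar a t * f t‖ₑ ^ (2 * m) = ∫⁻ t, ‖f t‖ₑ ^ (2 * m) := by
    intro a
    refine lintegral_congr fun t => ?_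
    rw [← ofReal_norm, norm_mul, norm_expChar, one_mul, ofReal_norm]
  calc _ ≤ _ := lintegral_mono hb
    _ = 2 ^ (2 * m) * ((∫⁻ x, ‖conjPoisson ε (fun t => expChar (-M) t * f t) x‖ₑ ^ (2 * m)) +
        ∫⁻ x, ‖conjPoisson ε (fun t => expChar M t * f t) x‖ₑ ^ (2 * m)) := by
        rw [lintegral_const_mul' _ _ (by finiteness), lintegral_add_left (by fun_prop)]
    _ ≤ 2 ^ (2 * m) * (ENNReal.ofReal (264 * m) ^ (2 * m) * (∫⁻ t, ‖f t‖ₑ ^ (2 * m)) +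
        ENNReal.ofReal (264 * m) ^ (2 * m) * (∫⁻ t, ‖f t‖ₑ ^ (2 * m))) := by
        refine mul_le_mul' le_rfl (add_le_add ?_ ?_)
        · exact (lintegral_conjPoisson_pow_le h1 hε hm).trans_eq (by rw [hnorm])
        · exact (lintegral_conjPoisson_pow_le h2 hε hm).trans_eq (by rw [hnorm])
    _ = 2 * (ENNReal.ofReal (528 * m) ^ (2 * m) * ∫⁻ t, ‖f t‖ₑ ^ (2 * m)) := by
        have : ENNReal.ofReal (528 * m) = 2 * ENNReal.ofReal (264 * m) := by
          rw [← ENNReal.ofReal_ofNat 2, ← ENNReal.ofReal_mul (by norm_num)]; congr 1; ring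
        rw [this, mul_pow]; ring
    _ ≤ _ := by
        have : ENNReal.ofReal (1056 * m) = 2 * ENNReal.ofReal (528 * m) := by
          rw [← ENNReal.ofReal_ofNat 2, ← ENNReal.ofReal_mul (by norm_num)]; congr 1; ring
        rw [this, mul_pow, mul_assoc]
        gcongr
        exact le_self_pow₀ (by norm_num) (by omega)

/-- The constant depends neither on `ε` nor on `M`, because `M` enters only through unimodular
factors; Fatou's lemma then lets `ε → 0`. -/
lemma lintegral_dirichletOp_pow_le {f : ℝ → ℂ} (hf : IsBddCompact f) {M : ℝ} (hM : 0 < M)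
    {m : ℕ} (hm : 1 ≤ m) :
    ∫⁻ x, ‖dirichletOp M f x‖ₑ ^ (2 * m)
      ≤ ENNReal.ofReal (1056 * m) ^ (2 * m) * ∫⁻ t, ‖f t‖ₑ ^ (2 * m) := by
  have hmeas : ∀ ε, Measurable (smoothDirichletOp M ε f) := by
    intro ε
    have hfm := hf.measurable
    have h1 := measurable_expChar M
    have h2 := measurable_expChar (-M)
    have h3 := measurable_conjPoisson (f := fun t => expChar (-M) t * f t) (by fun_prop) ε
    have h4 := measurable_conjPoisson (f := fun t => expChar M t * f t) (by fun_prop) ε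
    unfold smoothDirichletOp
    fun_prop
  refine lintegral_le_of_tendsto
    (F := fun (n : ℕ) x => ‖smoothDirichletOp M (1 / ((n : ℝ) + 1)) f x‖ₑ ^ (2 * m))
    (fun n => ?_) (fun x => ?_) fun n => ?_
  · have := hmeas (1 / ((n : ℝ) + 1))
    fun_prop
  · exact (ENNReal.continuous_pow _).continuousAt.tendsto.comp
      ((continuous_enorm.tendsto _).comp (tendsto_smoothDirichletOp hf hM x))
  · exact lintegral_smoothDirichletOp_pow_le hf (ε := ⟨1 / ((n : ℝ) + 1), by positivity⟩)
      (Nat.one_div_pos_of_nat (α := ℝ)) hm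

/-! ### Bounds for other exponents by duality -/

/-- `dirichletOp M` is bounded on `L^p` with constant `C` (tested on bounded functions with
compact support). -/
def DirichletBound (M p : ℝ) (C : ℝ≥0) : Prop :=
  ∀ f : ℝ → ℂ, IsBddCompact f →
    ∫⁻ x, ‖dirichletOp M f x‖ₑ ^ p ≤ (C : ℝ≥0∞) ^ p * ∫⁻ t, ‖f t‖ₑ ^ p

lemma dirichletBound_even {M : ℝ} (hM : 0 < M) {m : ℕ} (hm : 1 ≤ m) :
    DirichletBound M (2 * m) (1056 * m) := by
  intro f hf
  have h := lintegral_dirichletOp_pow_le hf hM hm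
  have e : (2 * m : ℝ) = ((2 * m : ℕ) : ℝ) := by push_cast; ring
  have e2 : ENNReal.ofReal (1056 * m) = ((1056 * m : ℝ≥0) : ℝ≥0∞) := by
    rw [ENNReal.ofReal]; congr 1
    ext; push_cast; rw [Real.coe_toNNReal _ (by positivity)]
  rw [e]
  simp_rw [ENNReal.rpow_natCast]
  rwa [← e2]

lemma dirichletOp_bound {f : ℝ → ℂ} (hf : IsBddCompact f) {M : ℝ} (hM : 0 < M) (x : ℝ) :
    ‖dirichletOp M f x‖ ≤ M / Real.pi * ∫ t, ‖f t‖ := by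
  rw [← integral_const_mul]
  refine norm_integral_le_of_norm_le ((hf.integrable volume).norm.const_mul _)
    (ae_of_all _ fun t => ?_)
  rw [norm_smul]
  gcongr
  exact abs_dirichletKernel_le hM _

/-- The kernel is even, so the operator is its own transpose. -/
lemma integral_dirichletOp_mul {f g : ℝ → ℂ} (hf : IsBddCompact f) (hg : IsBddCompact g) {M : ℝ}
    (hM : 0 < M) :
    ∫ x, dirichletOp M f x * g x = ∫ t, f t * dirichletOp M g t := by
  have hfm := hf.measurable
  have hgm := hg.measurable
  have hkm := (continuous_dirichletKernel M).measurable
  simp_rw [dirichletOp, ← integral_mul_const, ← integral_const_mul]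
  rw [integral_integral_swap]
  · congr 1; ext t; congr 1; ext x
    rw [show x - t = -(t - x) by ring, dirichletKernel_neg, Complex.real_smul, Complex.real_smul]
    ring
  · have := ((hg.integrable volume).norm.mul_prod (hf.integrable volume).norm).const_mul (M / Real.pi)
    refine this.mono' (by apply Measurable.aestronglyMeasurable; fun_prop)
      (ae_of_all _ fun p => ?_)
    simp only [Function.uncurry]
    rw [norm_mul, norm_smul, Real.norm_eq_abs]
    have := abs_dirichletKernel_le hM (p.1 - p.2)
    calc _ ≤ M / Real.pi * ‖f p.2‖ * ‖g p.1‖ := by gcongr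
      _ = _ := by ring

/-- Division by `J^(1/q)`; finiteness of `J` is essential and explains the localization in the
duality argument. -/
lemma ENNReal.le_of_le_mul_rpow {p q : ℝ} (hpq : p.HolderConjugate q) {J A : ℝ≥0∞}
    (hJ : J ≠ ∞) (h : J ≤ A * J ^ (1 / q)) : J ≤ A ^ p := by
  rcases eq_or_ne J 0 with rfl | h0
  · exact zero_le
  have h1 : J = J ^ (1 / p) * J ^ (1 / q) := by
    rw [← ENNReal.rpow_add _ _ h0 hJ, one_div, one_div, hpq.inv_add_inv_eq_one, ENNReal.rpow_one]
  have h2 : J ^ (1 / p) ≤ A := by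
    have hz : J ^ (1 / q) ≠ 0 := by
      simp [ENNReal.rpow_eq_zero_iff, h0, hJ]
    have ht : J ^ (1 / q) ≠ ∞ := ENNReal.rpow_ne_top_of_nonneg (one_div_nonneg.2 hpq.symm.nonneg) hJ
    exact (ENNReal.mul_le_mul_iff_left hz ht).1 (h1.symm.trans_le h)
  calc J = (J ^ (1 / p)) ^ p := by
        rw [← ENNReal.rpow_mul, one_div, inv_mul_cancel₀ hpq.ne_zero, ENNReal.rpow_one]
    _ ≤ A ^ p := ENNReal.rpow_le_rpow h2 hpq.nonneg

/-- The usual extremal test function for `‖Tf‖_p`, cut off to a ball so that it is an admissible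
bounded function and the quantity to be absorbed is finite. The ball then exhausts the line. -/
lemma DirichletBound.conj {M p q : ℝ} {C : ℝ≥0} (hM : 0 < M) (hpq : p.HolderConjugate q)
    (h : DirichletBound M q C) : DirichletBound M p C := by
  intro f hf
  have hp1 := hpq.lt
  have hTm := measurable_dirichletOp hf.measurable M
  have hloc : ∀ R : ℝ, 0 ≤ R → ∫⁻ x, (Metric.closedBall (0 : ℝ) R).indicator
      (fun x => ‖dirichletOp M f x‖ₑ ^ p) x ≤ (C : ℝ≥0∞) ^ p * ∫⁻ t, ‖f t‖ₑ ^ p := by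
    intro R hR
    set K := M / Real.pi * ∫ t, ‖f t‖ with hK
    have hK0 : 0 ≤ K := by
      have := Real.pi_pos
      have : 0 ≤ ∫ t, ‖f t‖ := integral_nonneg fun _ => norm_nonneg _
      positivity
    set B := Metric.closedBall (0 : ℝ) R with hB
    have hBm : MeasurableSet B := Metric.isClosed_closedBall.measurableSet
    -- This choice gives `Tf · g = |Tf|^p` and `|g|^q = |Tf|^p` on the ball.
    set g : ℝ → ℂ := B.indicator fun x => ((‖dirichletOp M f x‖ ^ (p - 2) : ℝ) : ℂ) *
      (starRingEnd ℂ) (dirichletOp M f x) with hgdef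
    have hgn : ∀ x ∈ B, ‖g x‖ = ‖dirichletOp M f x‖ ^ (p - 1) := by
      intro x hx
      rw [hgdef, Set.indicator_of_mem hx, norm_mul, Complex.norm_real, RCLike.norm_conj,
        Real.norm_of_nonneg (by positivity)]
      rcases eq_or_ne (dirichletOp M f x) 0 with h0 | h0
      · rw [h0, norm_zero, mul_zero, Real.zero_rpow (by linarith)]
      · rw [← Real.rpow_add_one (norm_ne_zero_iff.2 h0)]
        congr 1; ring
    have hg0 : ∀ x, x ∉ B → g x = 0 := fun x hx => Set.indicator_of_notMem hx _
    have hmul : ∀ x, dirichletOp M f x * g x =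
        ((B.indicator (fun x => ‖dirichletOp M f x‖ ^ p) x : ℝ) : ℂ) := by
      intro x
      by_cases hx : x ∈ B
      · rw [hgdef, Set.indicator_of_mem hx, Set.indicator_of_mem hx, mul_left_comm,
          Complex.mul_conj, Complex.normSq_eq_norm_sq, ← Complex.ofReal_mul]
        congr 1
        rcases eq_or_ne (dirichletOp M f x) 0 with h0 | h0
        · rw [h0, norm_zero, Real.zero_rpow hpq.ne_zero]; simp
        · rw [← Real.rpow_natCast, ← Real.rpow_add (norm_pos_iff.2 h0)]
          congr 1; push_cast; ring
      · rw [hg0 x hx, Set.indicator_of_notMem hx]; simp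
    have hg : IsBddCompact g := by
      refine ⟨?_, ⟨K ^ (p - 1), by positivity, fun x => ?_⟩, ⟨R, hR, fun x hx => ?_⟩⟩
      · refine Measurable.indicator ?_ hBm
        have : Measurable (starRingEnd ℂ) := Complex.continuous_conj.measurable
        fun_prop
      · by_cases hx : x ∈ B
        · rw [hgn x hx]
          exact Real.rpow_le_rpow (norm_nonneg _) (dirichletOp_bound hf hM x) (by linarith)
        · rw [hg0 x hx, norm_zero]; positivity
      · exact hg0 x (by simpa [hB] using hx)
    have hind : ∀ x, B.indicator (fun x => ‖dirichletOp M f x‖ₑ ^ p) x =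
        ENNReal.ofReal (B.indicator (fun x => ‖dirichletOp M f x‖ ^ p) x) := by
      intro x
      by_cases hx : x ∈ B
      · rw [Set.indicator_of_mem hx, Set.indicator_of_mem hx,
          ← ENNReal.ofReal_rpow_of_nonneg (norm_nonneg _) hpq.nonneg, ofReal_norm]
      · rw [Set.indicator_of_notMem hx, Set.indicator_of_notMem hx, ENNReal.ofReal_zero]
    set J := ∫⁻ x, B.indicator (fun x => ‖dirichletOp M f x‖ₑ ^ p) x with hJ
    have hrint : Integrable fun x => B.indicator (fun x => ‖dirichletOp M f x‖ ^ p) x := by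
      rw [integrable_indicator_iff hBm]
      refine Measure.integrableOn_of_bounded (M := K ^ p) ?_ ?_ (ae_of_all _ fun x => ?_)
      · exact (isCompact_closedBall (0 : ℝ) R).measure_lt_top.ne
      · apply Measurable.aestronglyMeasurable; fun_prop
      · rw [Real.norm_of_nonneg (by positivity)]
        exact Real.rpow_le_rpow (norm_nonneg _) (dirichletOp_bound hf hM x) hpq.nonneg
    have hnn : ∀ x, 0 ≤ B.indicator (fun x => ‖dirichletOp M f x‖ ^ p) x :=
      fun x => Set.indicator_nonneg (fun x _ => by positivity) x
    have hJeq : J = ENNReal.ofReal (∫ x, B.indicator (fun x => ‖dirichletOp M f x‖ ^ p) x) := by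
      rw [hJ, ofReal_integral_eq_lintegral_ofReal hrint (ae_of_all _ hnn)]
      exact lintegral_congr hind
    have hJtop : J ≠ ∞ := by rw [hJeq]; exact ENNReal.ofReal_ne_top
    have hgq : ∫⁻ x, ‖g x‖ₑ ^ q = J := by
      refine lintegral_congr fun x => ?_
      by_cases hx : x ∈ B
      · rw [Set.indicator_of_mem hx, ← ofReal_norm, hgn x hx, ← ofReal_norm,
          ENNReal.ofReal_rpow_of_nonneg (by positivity) hpq.symm.nonneg,
          ENNReal.ofReal_rpow_of_nonneg (by positivity) hpq.nonneg, ← Real.rpow_mul (norm_nonneg _),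
          hpq.sub_one_mul_conj]
      · rw [Set.indicator_of_notMem hx, hg0 x hx, enorm_zero, ENNReal.zero_rpow_of_pos hpq.symm.pos]
    have hTg := measurable_dirichletOp hg.measurable M
    have hfm := hf.measurable
    -- Transposition, Hölder's inequality, and the assumed `L^q` bound applied to `g`.
    have key : J ≤ (C * (∫⁻ t, ‖f t‖ₑ ^ p) ^ (1 / p)) * J ^ (1 / q) := by
      calc J = ‖∫ x, dirichletOp M f x * g x‖ₑ := by
            simp_rw [hmul]
            rw [integral_complex_ofReal, ← ofReal_norm, Complex.norm_real,
              Real.norm_of_nonneg (integral_nonneg hnn), hJeq]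
        _ = ‖∫ t, f t * dirichletOp M g t‖ₑ := by rw [integral_dirichletOp_mul hf hg hM]
        _ ≤ ∫⁻ t, ‖f t‖ₑ * ‖dirichletOp M g t‖ₑ := by
            refine (enorm_integral_le_lintegral_enorm _).trans_eq ?_
            simp_rw [enorm_mul]
        _ ≤ (∫⁻ t, ‖f t‖ₑ ^ p) ^ (1 / p) * (∫⁻ t, ‖dirichletOp M g t‖ₑ ^ q) ^ (1 / q) :=
            ENNReal.lintegral_mul_le_Lp_mul_Lq volume hpq (by fun_prop) (by fun_prop)
        _ ≤ (∫⁻ t, ‖f t‖ₑ ^ p) ^ (1 / p) * ((C : ℝ≥0∞) ^ q * J) ^ (1 / q) := by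
            refine mul_le_mul' le_rfl (ENNReal.rpow_le_rpow ?_ (one_div_nonneg.2 hpq.symm.nonneg))
            rw [← hgq]
            exact h g hg
        _ = _ := by
            rw [ENNReal.mul_rpow_of_nonneg _ _ (one_div_nonneg.2 hpq.symm.nonneg),
              ← ENNReal.rpow_mul, one_div q, mul_inv_cancel₀ hpq.symm.ne_zero, ENNReal.rpow_one]
            ring
    refine (ENNReal.le_of_le_mul_rpow hpq hJtop key).trans_eq ?_
    rw [ENNReal.mul_rpow_of_nonneg _ _ hpq.nonneg, ← ENNReal.rpow_mul, one_div,
      inv_mul_cancel₀ hpq.ne_zero, ENNReal.rpow_one]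
  refine lintegral_le_of_tendsto (F := fun (n : ℕ) => (Metric.closedBall (0 : ℝ) n).indicator
      (fun x => ‖dirichletOp M f x‖ₑ ^ p)) (fun n => ?_) (fun x => ?_) fun n => hloc n n.cast_nonneg
  · exact Measurable.indicator (by fun_prop) Metric.isClosed_closedBall.measurableSet
  · refine tendsto_const_nhds.congr' ?_
    filter_upwards [eventually_ge_atTop ⌈‖x‖⌉₊] with n hn
    rw [Set.indicator_of_mem]
    simpa using Nat.ceil_le.1 hn

/-! ### Several variables by iteration -/

/-- The Dirichlet kernel of the cube `{|t| ≤ M}`. -/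
noncomputable def cubeKernel {d : ℕ} (M : ℝ) (s : Fin d → ℝ) : ℝ := ∏ j, dirichletKernel M (s j)

/-- The Fourier partial integral as a convolution. -/
noncomputable def cubeOp {d : ℕ} (M : ℝ) (f : (Fin d → ℝ) → ℂ) (x : Fin d → ℝ) : ℂ :=
  ∫ y, cubeKernel M (x - y) • f y

lemma continuous_cubeKernel {d : ℕ} (M : ℝ) : Continuous (cubeKernel (d := d) M) := by
  have := continuous_dirichletKernel M
  unfold cubeKernel
  fun_prop

lemma abs_cubeKernel_le {d : ℕ} {M : ℝ} (hM : 0 < M) (s : Fin d → ℝ) :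
    |cubeKernel M s| ≤ (M / Real.pi) ^ d := by
  rw [cubeKernel, Finset.abs_prod]
  calc _ ≤ ∏ _j : Fin d, M / Real.pi :=
        Finset.prod_le_prod (fun _ _ => abs_nonneg _) fun j _ => abs_dirichletKernel_le hM _
    _ = _ := by simp [div_pow]

lemma integrable_cubeKernel_smul {d : ℕ} {f : (Fin d → ℝ) → ℂ} (hf : Integrable f) {M : ℝ}
    (hM : 0 < M) (x : Fin d → ℝ) : Integrable fun y => cubeKernel M (x - y) • f y := by
  have := (continuous_cubeKernel (d := d) M)
  refine (hf.norm.const_mul ((M / Real.pi) ^ d)).mono' ?_ (ae_of_all _ fun t => ?_)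
  · exact (this.comp (continuous_const.sub continuous_id)).aestronglyMeasurable.smul hf.aestronglyMeasurable
  rw [norm_smul]
  gcongr
  exact abs_cubeKernel_le hM _

lemma measurable_cubeOp {d : ℕ} {f : (Fin d → ℝ) → ℂ} (hf : Measurable f) (M : ℝ) :
    Measurable (cubeOp M f) := by
  have := (continuous_cubeKernel (d := d) M).measurable
  apply StronglyMeasurable.measurable
  refine StronglyMeasurable.integral_prod_right' (f := fun p : (Fin d → ℝ) × (Fin d → ℝ) =>
    cubeKernel M (p.1 - p.2) • f p.2) ?_
  apply Measurable.stronglyMeasurable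
  fun_prop

lemma norm_cubeOp_le {d : ℕ} {f : (Fin d → ℝ) → ℂ} {C R M : ℝ} (hM : 0 < M) 
    (hfC : ∀ x, ‖f x‖ ≤ C) (hR : ∀ x, R < ‖x‖ → f x = 0) (x : Fin d → ℝ) :
    ‖cubeOp M f x‖ ≤ (M / Real.pi) ^ d * C * volume.real (Metric.closedBall (0 : Fin d → ℝ) R) := by
  have h : cubeOp M f x = ∫ y in Metric.closedBall (0 : Fin d → ℝ) R, cubeKernel M (x - y) • f y := by
    rw [cubeOp, setIntegral_eq_integral_of_forall_compl_eq_zero]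
    intro y hy
    rw [hR y (by simpa using hy), smul_zero]
  rw [h]
  refine norm_setIntegral_le_of_norm_le_const (isCompact_closedBall _ _).measure_lt_top
    fun y _ => ?_
  rw [norm_smul]
  gcongr
  · exact abs_cubeKernel_le hM _
  · exact hfC y

lemma coe_piFinSuccAbove_symm (d : ℕ) :
    ⇑(MeasurableEquiv.piFinSuccAbove (fun _ : Fin (d + 1) => ℝ) 0).symm =
      fun p : ℝ × (Fin d → ℝ) => (Fin.cons p.1 p.2 : Fin (d + 1) → ℝ) := by
  funext p
  exact Fin.insertNth_zero' _ _

lemma measurableEmbedding_finCons (d : ℕ) : MeasurableEmbedding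
    fun p : ℝ × (Fin d → ℝ) => (Fin.cons p.1 p.2 : Fin (d + 1) → ℝ) := by
  rw [← coe_piFinSuccAbove_symm]
  exact MeasurableEquiv.measurableEmbedding _

lemma measurable_finCons {d : ℕ} :
    Measurable fun p : ℝ × (Fin d → ℝ) => (Fin.cons p.1 p.2 : Fin (d + 1) → ℝ) :=
  (measurableEmbedding_finCons d).measurable

lemma measurePreserving_finCons (d : ℕ) :
    MeasurePreserving (fun p : ℝ × (Fin d → ℝ) => (Fin.cons p.1 p.2 : Fin (d + 1) → ℝ))
      (volume.prod volume) volume := by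
  rw [← coe_piFinSuccAbove_symm]
  exact (volume_preserving_piFinSuccAbove (fun _ : Fin (d + 1) => ℝ) 0).symm

lemma norm_tail_le_norm_cons {d : ℕ} (a : ℝ) (b : Fin d → ℝ) :
    ‖b‖ ≤ ‖(Fin.cons a b : Fin (d + 1) → ℝ)‖ :=
  (pi_norm_le_iff_of_nonneg (norm_nonneg _)).2 fun j => by
    simpa using norm_le_pi_norm (Fin.cons a b : Fin (d + 1) → ℝ) j.succ

lemma norm_head_le_norm_cons {d : ℕ} (a : ℝ) (b : Fin d → ℝ) :
    ‖a‖ ≤ ‖(Fin.cons a b : Fin (d + 1) → ℝ)‖ := by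
  simpa using norm_le_pi_norm (Fin.cons a b : Fin (d + 1) → ℝ) 0

lemma IsBddCompact.slice {d : ℕ} {f : (Fin (d + 1) → ℝ) → ℂ} (hf : IsBddCompact f) (a : ℝ) :
    IsBddCompact fun b : Fin d → ℝ => f (Fin.cons a b) := by
  obtain ⟨C, hC0, hC⟩ := hf.bdd
  obtain ⟨R, hR0, hR⟩ := hf.supp
  refine ⟨hf.measurable.comp (measurable_finCons.comp measurable_prodMk_left),
    ⟨C, hC0, fun x => hC _⟩, ⟨R, hR0, fun x hx => hR _ (hx.trans_le (norm_tail_le_norm_cons _ _))⟩⟩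

/-- The kernel is a product, so Fubini separates the first variable from the others. -/
lemma cubeOp_cons {d : ℕ} {f : (Fin (d + 1) → ℝ) → ℂ} (hf : IsBddCompact f) {M : ℝ} (hM : 0 < M)
    (a : ℝ) (b : Fin d → ℝ) :
    cubeOp M f (Fin.cons a b) = dirichletOp M (fun t => cubeOp M (fun y => f (Fin.cons t y)) b) a := by
  have hint := integrable_cubeKernel_smul (hf.integrable volume) hM (Fin.cons a b)
  have hmp := measurePreserving_finCons d
  rw [cubeOp, ← hmp.integral_comp (measurableEmbedding_finCons d), integral_prod]
  · rw [dirichletOp]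
    congr 1; ext t
    rw [cubeOp, ← integral_smul]
    congr 1; ext y
    rw [← mul_smul, cubeKernel, cubeKernel, Fin.prod_univ_succ]
    simp
  · exact hmp.integrable_comp_of_integrable hint

lemma measurable_cubeOp_slice {d : ℕ} {f : (Fin (d + 1) → ℝ) → ℂ} (hf : Measurable f) (M : ℝ) :
    Measurable fun q : ℝ × (Fin d → ℝ) => cubeOp M (fun y => f (Fin.cons q.1 y)) q.2 := by
  have := (continuous_cubeKernel (d := d) M).measurable
  apply StronglyMeasurable.measurable
  have h1 : Measurable fun p : (ℝ × (Fin d → ℝ)) × (Fin d → ℝ) => (p.1.1, p.2) := by fun_prop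
  have h2 : Measurable fun p : (ℝ × (Fin d → ℝ)) × (Fin d → ℝ) => p.1.2 - p.2 := by fun_prop
  exact StronglyMeasurable.integral_prod_right'
    (f := fun p : (ℝ × (Fin d → ℝ)) × (Fin d → ℝ) =>
      cubeKernel M (p.1.2 - p.2) • f (Fin.cons p.1.1 p.2))
    ((this.comp h2).smul (hf.comp (measurable_finCons.comp h1))).stronglyMeasurable

/-- After the operator has acted in the last `d` variables, the result is still an admissible input,
in the first variable, for the one-dimensional bound. -/
lemma isBddCompact_cubeOp_slice {d : ℕ} {f : (Fin (d + 1) → ℝ) → ℂ} (hf : IsBddCompact f) {M : ℝ}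
    (hM : 0 < M) (b : Fin d → ℝ) :
    IsBddCompact fun t : ℝ => cubeOp M (fun y => f (Fin.cons t y)) b := by
  obtain ⟨K, hK0, hK⟩ := hf.bdd
  obtain ⟨R, hR0, hR⟩ := hf.supp
  have hpi := Real.pi_pos
  constructor
  · exact Measurable.comp (g := fun q : ℝ × (Fin d → ℝ) =>
      cubeOp M (fun y => f (Fin.cons q.1 y)) q.2) (f := fun t : ℝ => (t, b))
      (measurable_cubeOp_slice hf.measurable M) measurable_prodMk_right
  · refine ⟨(M / Real.pi) ^ d * K * volume.real (Metric.closedBall (0 : Fin d → ℝ) R),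
      by positivity, fun t => ?_⟩
    exact norm_cubeOp_le hM (fun y => hK _)
      (fun y hy => hR _ (hy.trans_le (norm_tail_le_norm_cons t y))) b
  · refine ⟨R, hR0, fun t ht => ?_⟩
    rw [cubeOp]
    simp [hR _ (ht.trans_le (norm_head_le_norm_cons t _))]

/-- Each coordinate costs one factor `C`. With `C` of order `p` this is the source of `p^d`. -/
lemma lintegral_cubeOp_rpow_le {M p : ℝ} {C : ℝ≥0} (hM : 0 < M) (hp : 0 < p)
    (h : DirichletBound M p C) (d : ℕ) :
    ∀ f : (Fin d → ℝ) → ℂ, IsBddCompact f →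
      ∫⁻ x, ‖cubeOp M f x‖ₑ ^ p ≤ ((C ^ d : ℝ≥0) : ℝ≥0∞) ^ p * ∫⁻ y, ‖f y‖ₑ ^ p := by
  induction d with
  | zero =>
    intro f hf
    -- In dimension zero the volume is a Dirac mass and the kernel is an empty product.
    have h1 : ∀ x, cubeOp M f x = f x := by
      intro x
      rw [cubeOp, Measure.volume_pi_eq_dirac, integral_dirac]
      simp [cubeKernel, Subsingleton.elim x isEmptyElim]
    simp [h1]
  | succ d ih =>
    intro f hf
    have hmp := measurePreserving_finCons d
    have hfm := hf.measurable
    have hTm := measurable_cubeOp hfm M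
    have hcons := measurable_finCons (d := d)
    have hgm := measurable_cubeOp_slice hfm M
    have hg := isBddCompact_cubeOp_slice hf hM
    calc ∫⁻ x, ‖cubeOp M f x‖ₑ ^ p
        = ∫⁻ b : Fin d → ℝ, ∫⁻ a : ℝ, ‖cubeOp M f (Fin.cons a b)‖ₑ ^ p := by
          rw [← hmp.lintegral_comp (by fun_prop), lintegral_prod_symm]
          apply Measurable.aemeasurable
          fun_prop
      _ ≤ ∫⁻ b : Fin d → ℝ, (C : ℝ≥0∞) ^ p *
            ∫⁻ t : ℝ, ‖cubeOp M (fun y => f (Fin.cons t y)) b‖ₑ ^ p := by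
          refine lintegral_mono fun b => ?_
          simp_rw [cubeOp_cons hf hM]
          exact h _ (hg b)
      _ = (C : ℝ≥0∞) ^ p * ∫⁻ t : ℝ, ∫⁻ b : Fin d → ℝ,
            ‖cubeOp M (fun y => f (Fin.cons t y)) b‖ₑ ^ p := by
          rw [lintegral_const_mul' _ _ (ENNReal.rpow_ne_top_of_nonneg hp.le ENNReal.coe_ne_top),
            lintegral_lintegral_swap]
          apply Measurable.aemeasurable
          exact ((hgm.comp measurable_swap).enorm.pow_const p)
      _ ≤ (C : ℝ≥0∞) ^ p * ∫⁻ t : ℝ, ((C ^ d : ℝ≥0) : ℝ≥0∞) ^ p *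
            ∫⁻ y : Fin d → ℝ, ‖f (Fin.cons t y)‖ₑ ^ p := by
          gcongr with t
          exact ih _ (hf.slice t)
      _ = _ := by
          rw [lintegral_const_mul' _ _ (ENNReal.rpow_ne_top_of_nonneg hp.le ENNReal.coe_ne_top),
            ← mul_assoc, ← ENNReal.mul_rpow_of_nonneg _ _ hp.le, ← ENNReal.coe_mul, ← pow_succ',
            ← hmp.lintegral_comp (f := fun y => ‖f y‖ₑ ^ p) (by fun_prop), lintegral_prod]
          apply Measurable.aemeasurable
          fun_prop

/-! ### Interpolation of modular inequalities -/

/-- The Orlicz-type function `sup_{a ≤ p ≤ b} w(p) u^p`. -/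
noncomputable def powerSup (w : ℝ → ℝ≥0∞) (a b : ℝ) (u : ℝ≥0∞) : ℝ≥0∞ :=
  ⨆ p ∈ Set.Icc a b, w p * u ^ p

lemma powerSup_mono (w : ℝ → ℝ≥0∞) {a b : ℝ} (ha : 0 < a) : Monotone (powerSup w a b) := by
  intro u v huv
  refine iSup₂_mono fun p hp => ?_
  gcongr
  exact ha.le.trans hp.1

lemma powerSup_zero (w : ℝ → ℝ≥0∞) {a b : ℝ} (ha : 0 < a) : powerSup w a b 0 = 0 := by
  rw [powerSup]
  simp only [ENNReal.iSup_eq_zero]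
  intro p hp
  rw [ENNReal.zero_rpow_of_pos (ha.trans_le hp.1), mul_zero]

/-- Leaving the comparison of exponents as a hypothesis covers both contractions (`c = a`) and
expansions (`c = b`). -/
lemma powerSup_mul_le (w : ℝ → ℝ≥0∞) {a b c l : ℝ} (ha : 0 < a) (hl : 0 < l)
    (h : ∀ p ∈ Set.Icc a b, l ^ p ≤ l ^ c) (u : ℝ≥0∞) :
    powerSup w a b (ENNReal.ofReal l * u) ≤ ENNReal.ofReal (l ^ c) * powerSup w a b u := by
  simp only [powerSup, ENNReal.mul_iSup]
  refine iSup₂_mono fun p hp => ?_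
  rw [ENNReal.mul_rpow_of_nonneg _ _ (ha.le.trans hp.1), ENNReal.ofReal_rpow_of_pos hl]
  calc _ = ENNReal.ofReal (l ^ p) * (w p * u ^ p) := by ring
    _ ≤ _ := mul_le_mul' (ENNReal.ofReal_le_ofReal (h p hp)) le_rfl

lemma le_powerSup_mul (w : ℝ → ℝ≥0∞) {a b c l : ℝ} (ha : 0 < a) (hl : 0 < l)
    (h : ∀ p ∈ Set.Icc a b, l ^ c ≤ l ^ p) (u : ℝ≥0∞) :
    ENNReal.ofReal (l ^ c) * powerSup w a b u ≤ powerSup w a b (ENNReal.ofReal l * u) := by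
  simp only [powerSup, ENNReal.mul_iSup]
  refine iSup₂_mono fun p hp => ?_
  rw [ENNReal.mul_rpow_of_nonneg _ _ (ha.le.trans hp.1), ENNReal.ofReal_rpow_of_pos hl]
  calc _ ≤ ENNReal.ofReal (l ^ p) * (w p * u ^ p) :=
        mul_le_mul' (ENNReal.ofReal_le_ofReal (h p hp)) le_rfl
    _ = _ := by ring

lemma div_rpow_div_self {u σ c : ℝ} (hu : 0 < u) (hσ : 0 < σ) :
    (σ / u) ^ c / σ = u ^ (-c) * σ ^ (c - 1) := by
  rw [Real.div_rpow hσ.le hu.le, Real.rpow_sub_one hσ.ne', Real.rpow_neg hu.le]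
  field_simp

lemma lintegral_Ioc_div_rpow {u c : ℝ} (hu : 0 < u) (hc : 0 < c) :
    ∫⁻ σ in Set.Ioc 0 u, ENNReal.ofReal ((σ / u) ^ c / σ) = ENNReal.ofReal (1 / c) := by
  have h1 : IntervalIntegrable (fun σ : ℝ => σ ^ (c - 1)) volume 0 u :=
    intervalIntegral.intervalIntegrable_rpow' (by linarith)
  have h2 : IntegrableOn (fun σ : ℝ => u ^ (-c) * σ ^ (c - 1)) (Set.Ioc 0 u) :=
    ((intervalIntegrable_iff_integrableOn_Ioc_of_le hu.le).1 h1).const_mul _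
  have h3 : ∫⁻ σ in Set.Ioc 0 u, ENNReal.ofReal ((σ / u) ^ c / σ) =
      ∫⁻ σ in Set.Ioc 0 u, ENNReal.ofReal (u ^ (-c) * σ ^ (c - 1)) :=
    setLIntegral_congr_fun measurableSet_Ioc fun σ hσ => by
      rw [div_rpow_div_self hu hσ.1]
  rw [h3, ← ofReal_integral_eq_lintegral_ofReal h2, integral_const_mul,
    ← intervalIntegral.integral_of_le hu.le, integral_rpow (Or.inl (by linarith))]
  · congr 1
    rw [sub_add_cancel, Real.zero_rpow hc.ne', sub_zero, Real.rpow_neg hu.le]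
    have := Real.rpow_pos_of_pos hu c
    field_simp
  · rw [Filter.EventuallyLE, ae_restrict_iff' measurableSet_Ioc]
    refine ae_of_all _ fun σ hσ => ?_
    have := hσ.1
    simp only [Pi.zero_apply]
    positivity

lemma lintegral_Ioi_div_rpow {u c : ℝ} (hu : 0 < u) (hc : 0 < c) :
    ∫⁻ σ in Set.Ioi u, ENNReal.ofReal ((σ / u) ^ (-c) / σ) = ENNReal.ofReal (1 / c) := by
  have h2 : IntegrableOn (fun σ : ℝ => u ^ c * σ ^ (-c - 1)) (Set.Ioi u) :=
    (integrableOn_Ioi_rpow_of_lt (by linarith) hu).const_mul _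
  have h3 : ∫⁻ σ in Set.Ioi u, ENNReal.ofReal ((σ / u) ^ (-c) / σ) =
      ∫⁻ σ in Set.Ioi u, ENNReal.ofReal (u ^ c * σ ^ (-c - 1)) :=
    setLIntegral_congr_fun measurableSet_Ioi fun σ hσ => by
      rw [div_rpow_div_self hu (hu.trans hσ), neg_neg]
  rw [h3, ← ofReal_integral_eq_lintegral_ofReal h2, integral_const_mul,
    integral_Ioi_rpow_of_lt (by linarith) hu]
  · congr 1
    rw [sub_add_cancel, Real.rpow_neg hu.le]
    have := Real.rpow_pos_of_pos hu c
    field_simp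
  · rw [Filter.EventuallyLE, ae_restrict_iff' measurableSet_Ioi]
    refine ae_of_all _ fun σ hσ => ?_
    have : 0 < σ := hu.trans hσ
    simp only [Pi.zero_apply]
    positivity

/-- `min (v^r) (v^s)`. -/
noncomputable def minPow (r s : ℝ) (v : ℝ≥0∞) : ℝ≥0∞ := min (v ^ r) (v ^ s)

lemma minPow_mono {r s : ℝ} (hr : 0 ≤ r) (hs : 0 ≤ s) : Monotone (minPow r s) := fun _ _ h =>
  min_le_min (ENNReal.rpow_le_rpow h hr) (ENNReal.rpow_le_rpow h hs)

lemma measurable_minPow (r s : ℝ) : Measurable (minPow r s) := by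
  unfold minPow; fun_prop

/-- Averaging `minPow` over dilations with weight `powerSup` dominates `powerSup`. -/
lemma powerSup_le_lintegral (w : ℝ → ℝ≥0∞) {r a b s : ℝ} (hr : 0 < r) (hra : r < a) (hab : a ≤ b)
    (hbs : b < s) {u : ℝ} (hu : 0 ≤ u) :
    powerSup w a b (ENNReal.ofReal u) ≤ ENNReal.ofReal (b - r) *
      ∫⁻ σ in Set.Ioi (0 : ℝ), minPow r s (ENNReal.ofReal (u / σ)) *
        (powerSup w a b (ENNReal.ofReal σ) * ENNReal.ofReal (1 / σ)) := by
  rcases hu.eq_or_lt with rfl | hu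
  · rw [ENNReal.ofReal_zero, powerSup_zero w (hr.trans hra)]; exact zero_le
  have hb : 0 < b - r := by linarith
  -- The range `σ ≤ u` suffices: there `minPow` is at least `(σ/u)^(-r)` and the supremum loses at
  -- most `(σ/u)^b`, and `(σ/u)^(b-r) dσ/σ` has integral `1/(b-r)`.
  have h1 : ∫⁻ σ in Set.Ioc 0 u, ENNReal.ofReal ((σ / u) ^ (b - r) / σ) *
      powerSup w a b (ENNReal.ofReal u) ≤
      ∫⁻ σ in Set.Ioc 0 u, minPow r s (ENNReal.ofReal (u / σ)) *
        (powerSup w a b (ENNReal.ofReal σ) * ENNReal.ofReal (1 / σ)) := by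
    refine setLIntegral_mono' measurableSet_Ioc fun σ hσ => ?_
    have hσ0 := hσ.1
    have hl : 0 < σ / u := by positivity
    have hl1 : σ / u ≤ 1 := (div_le_one hu).2 hσ.2
    have hm : ENNReal.ofReal ((σ / u) ^ (-r)) ≤ minPow r s (ENNReal.ofReal (u / σ)) := by
      have e : u / σ = (σ / u)⁻¹ := (inv_div σ u).symm
      rw [minPow, ENNReal.ofReal_rpow_of_pos (by positivity),
        ENNReal.ofReal_rpow_of_pos (by positivity), le_min_iff, e, Real.inv_rpow hl.le,
        Real.inv_rpow hl.le, ← Real.rpow_neg hl.le, ← Real.rpow_neg hl.le]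
      refine ⟨le_rfl, ENNReal.ofReal_le_ofReal ?_⟩
      exact Real.rpow_le_rpow_of_exponent_ge hl hl1 (by linarith)
    have hP := le_powerSup_mul w (a := a) (b := b) (c := b) (hr.trans hra) hl
      (fun p hp => Real.rpow_le_rpow_of_exponent_ge hl hl1 hp.2) (ENNReal.ofReal u)
    rw [← ENNReal.ofReal_mul hl.le, div_mul_cancel₀ _ hu.ne'] at hP
    calc _ = ENNReal.ofReal ((σ / u) ^ (-r)) * ((ENNReal.ofReal ((σ / u) ^ b) *
            powerSup w a b (ENNReal.ofReal u)) * ENNReal.ofReal (1 / σ)) := by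
          have e : (σ / u) ^ (b - r) / σ = (σ / u) ^ (-r) * (σ / u) ^ b * (1 / σ) := by
            rw [← Real.rpow_add hl]; ring_nf
          rw [e, ENNReal.ofReal_mul (by positivity), ENNReal.ofReal_mul (by positivity)]
          ring
      _ ≤ _ := by gcongr
  have h2 : ENNReal.ofReal (1 / (b - r)) * powerSup w a b (ENNReal.ofReal u) ≤
      ∫⁻ σ in Set.Ioi (0 : ℝ), minPow r s (ENNReal.ofReal (u / σ)) *
        (powerSup w a b (ENNReal.ofReal σ) * ENNReal.ofReal (1 / σ)) := by
    rw [← lintegral_Ioc_div_rpow hu hb, ← lintegral_mul_const]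
    · exact h1.trans (lintegral_mono_set fun σ hσ => hσ.1)
    · fun_prop
  calc _ = ENNReal.ofReal (b - r) *
        (ENNReal.ofReal (1 / (b - r)) * powerSup w a b (ENNReal.ofReal u)) := by
        rw [← mul_assoc, ← ENNReal.ofReal_mul hb.le, mul_one_div_cancel hb.ne', ENNReal.ofReal_one,
          one_mul]
    _ ≤ _ := by gcongr

/-- For `σ ≤ u` the integrand is at most `(σ/u)^(a-r) / σ` times the supremum at `u`, for `σ > u` at
most `(σ/u)^(-(s-b)) / σ` times it. The gaps `r < a` and `b < s` make both integrals converge. -/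
lemma lintegral_le_powerSup (w : ℝ → ℝ≥0∞) {r a b s : ℝ} (hr : 0 < r) (hra : r < a) (hab : a ≤ b)
    (hbs : b < s) {u : ℝ} (hu : 0 ≤ u) :
      ∫⁻ σ in Set.Ioi (0 : ℝ), minPow r s (ENNReal.ofReal (u / σ)) *
        (powerSup w a b (ENNReal.ofReal σ) * ENNReal.ofReal (1 / σ)) ≤
      ENNReal.ofReal (1 / (a - r) + 1 / (s - b)) * powerSup w a b (ENNReal.ofReal u) := by
  rcases hu.eq_or_lt with rfl | hu
  · simp [minPow, hr, (show 0 < s by linarith)]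
  have ha : 0 < a - r := by linarith
  have hb : 0 < s - b := by linarith
  have hsplit : Set.Ioi (0 : ℝ) = Set.Ioc 0 u ∪ Set.Ioi u := (Set.Ioc_union_Ioi_eq_Ioi hu.le).symm
  rw [hsplit]
  refine (lintegral_union_le _ _ _).trans ?_
  rw [ENNReal.ofReal_add (by positivity) (by positivity), add_mul]
  have hu' : ∀ σ, σ / u * u = σ := fun σ => div_mul_cancel₀ _ hu.ne'
  have e : ∀ σ, u / σ = (σ / u)⁻¹ := fun σ => (inv_div σ u).symm
  refine add_le_add ?_ ?_
  · rw [← lintegral_Ioc_div_rpow hu ha, ← lintegral_mul_const]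
    swap
    · fun_prop
    refine setLIntegral_mono' measurableSet_Ioc fun σ hσ => ?_
    have hσ0 := hσ.1
    have hl : 0 < σ / u := by positivity
    have hl1 : σ / u ≤ 1 := (div_le_one hu).2 hσ.2
    have hP := powerSup_mul_le w (a := a) (b := b) (c := a) (hr.trans hra) hl
      (fun p hp => Real.rpow_le_rpow_of_exponent_ge hl hl1 hp.1) (ENNReal.ofReal u)
    rw [← ENNReal.ofReal_mul hl.le, hu'] at hP
    have hm : minPow r s (ENNReal.ofReal (u / σ)) ≤ ENNReal.ofReal ((σ / u) ^ (-r)) := by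
      refine (min_le_left _ _).trans_eq ?_
      rw [ENNReal.ofReal_rpow_of_pos (by positivity), e, Real.inv_rpow hl.le, ← Real.rpow_neg hl.le]
    calc _ ≤ ENNReal.ofReal ((σ / u) ^ (-r)) * ((ENNReal.ofReal ((σ / u) ^ a) *
            powerSup w a b (ENNReal.ofReal u)) * ENNReal.ofReal (1 / σ)) := by gcongr
      _ = _ := by
          have e : (σ / u) ^ (a - r) / σ = (σ / u) ^ (-r) * (σ / u) ^ a * (1 / σ) := by
            rw [← Real.rpow_add hl]; ring_nf
          rw [e, ENNReal.ofReal_mul (by positivity), ENNReal.ofReal_mul (by positivity)]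
          ring
  · rw [← lintegral_Ioi_div_rpow hu hb, ← lintegral_mul_const]
    swap
    · fun_prop
    refine setLIntegral_mono' measurableSet_Ioi fun σ hσ => ?_
    have hσ0 : 0 < σ := hu.trans hσ
    have hl : 0 < σ / u := by positivity
    have hl1 : 1 ≤ σ / u := (one_le_div hu).2 (le_of_lt hσ)
    have hP := powerSup_mul_le w (a := a) (b := b) (c := b) (hr.trans hra) hl
      (fun p hp => Real.rpow_le_rpow_of_exponent_le hl1 hp.2) (ENNReal.ofReal u)
    rw [← ENNReal.ofReal_mul hl.le, hu'] at hP
    have hm : minPow r s (ENNReal.ofReal (u / σ)) ≤ ENNReal.ofReal ((σ / u) ^ (-s)) := by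
      refine (min_le_right _ _).trans_eq ?_
      rw [ENNReal.ofReal_rpow_of_pos (by positivity), e, Real.inv_rpow hl.le, ← Real.rpow_neg hl.le]
    calc _ ≤ ENNReal.ofReal ((σ / u) ^ (-s)) * ((ENNReal.ofReal ((σ / u) ^ b) *
            powerSup w a b (ENNReal.ofReal u)) * ENNReal.ofReal (1 / σ)) := by gcongr
      _ = _ := by
          have e : (σ / u) ^ (-(s - b)) / σ = (σ / u) ^ (-s) * (σ / u) ^ b * (1 / σ) := by
            rw [← Real.rpow_add hl]; ring_nf
          rw [e, ENNReal.ofReal_mul (by positivity), ENNReal.ofReal_mul (by positivity)]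
          ring

lemma lintegral_rpow_div {X : Type*} [MeasurableSpace X] {μ : Measure X} {F : X → ℝ≥0∞}
    {c : ℝ≥0∞} (hc0 : c ≠ 0) {p : ℝ} (hp : 0 < p) :
    ∫⁻ x, (F x / c) ^ p ∂μ = (c⁻¹) ^ p * ∫⁻ x, F x ^ p ∂μ := by
  rw [← lintegral_const_mul' _ _ (ENNReal.rpow_ne_top_of_nonneg hp.le (ENNReal.inv_ne_top.2 hc0))]
  refine lintegral_congr fun x => ?_
  rw [div_eq_mul_inv, ENNReal.mul_rpow_of_nonneg _ _ hp.le, mul_comm]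

/-- Interpolation between weak estimates for the two truncations at one level. -/
lemma lintegral_minPow_le {X : Type*} [MeasurableSpace X] {μ : Measure X} {r s : ℝ} (hr : 0 < r)
    (hrs : r < s) {D : ℝ≥0} (hD : D ≠ 0) {f g g₁ g₂ : X → ℂ} {σ : ℝ} (hσ : 0 < σ)
    (hf : Measurable f) (hg₁ : Measurable g₁)
    (hg : ∀ x, ‖g x‖ₑ ≤ ‖g₁ x‖ₑ + ‖g₂ x‖ₑ)
    (h₁ : ∫⁻ x, ‖g₁ x‖ₑ ^ r ∂μ ≤
      (D : ℝ≥0∞) ^ r * ∫⁻ x, ‖{x | σ < ‖f x‖}.indicator f x‖ₑ ^ r ∂μ)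
    (h₂ : ∫⁻ x, ‖g₂ x‖ₑ ^ s ∂μ ≤
      (D : ℝ≥0∞) ^ s * ∫⁻ x, ‖{x | ‖f x‖ ≤ σ}.indicator f x‖ₑ ^ s ∂μ) :
    ∫⁻ x, minPow r s (‖g x‖ₑ / (2 * D) / ENNReal.ofReal σ) ∂μ ≤
      ∫⁻ x, minPow r s (‖f x‖ₑ / ENNReal.ofReal σ) ∂μ := by
  have hs : 0 < s := hr.trans hrs
  have hD' : (D : ℝ≥0∞) ≠ 0 := by exact_mod_cast hD
  have hDt : (D : ℝ≥0∞) ≠ ∞ := ENNReal.coe_ne_top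
  have hσ' : ENNReal.ofReal σ ≠ 0 := by simpa using hσ
  have hσt : ENNReal.ofReal σ ≠ ∞ := ENNReal.ofReal_ne_top
  set E := ENNReal.ofReal σ with hE
  have hpt : ∀ x, minPow r s (‖g x‖ₑ / (2 * D) / E) ≤
      (‖g₁ x‖ₑ / D / E) ^ r + (‖g₂ x‖ₑ / D / E) ^ s := by
    intro x
    -- The factor 2 replaces a sum by a maximum; `minPow` can then be estimated by the power suited
    -- to the larger piece.
    have hmax : ‖g x‖ₑ / (2 * D) ≤ max (‖g₁ x‖ₑ / D) (‖g₂ x‖ₑ / D) := by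
      refine ENNReal.div_le_of_le_mul ?_
      have hc : ∀ y : ℝ≥0∞, y = y / D * D := fun y => (ENNReal.div_mul_cancel hD' hDt).symm
      calc ‖g x‖ₑ ≤ ‖g₁ x‖ₑ + ‖g₂ x‖ₑ := hg x
        _ = ‖g₁ x‖ₑ / D * D + ‖g₂ x‖ₑ / D * D := by rw [← hc, ← hc]
        _ ≤ max (‖g₁ x‖ₑ / D) (‖g₂ x‖ₑ / D) * D + max (‖g₁ x‖ₑ / D) (‖g₂ x‖ₑ / D) * D := by
            gcongr
            · exact le_max_left _ _
            · exact le_max_right _ _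
        _ = _ := by ring
    refine (minPow_mono hr.le hs.le (ENNReal.div_le_div_right hmax E)).trans ?_
    rcases le_total (‖g₁ x‖ₑ / D) (‖g₂ x‖ₑ / D) with h | h
    · rw [max_eq_right h]
      exact (min_le_right _ _).trans le_add_self
    · rw [max_eq_left h]
      exact (min_le_left _ _).trans le_self_add
  have hcancel : ∀ p : ℝ, 0 < p → ∀ F G : X → ℝ≥0∞,
      ∫⁻ x, F x ^ p ∂μ ≤ (D : ℝ≥0∞) ^ p * ∫⁻ x, G x ^ p ∂μ →
      ∫⁻ x, (F x / D / E) ^ p ∂μ ≤ ∫⁻ x, (G x / E) ^ p ∂μ := by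
    intro p hp F G h
    rw [lintegral_rpow_div hσ' hp, lintegral_rpow_div hσ' hp,
      lintegral_rpow_div hD' hp]
    gcongr
    calc _ ≤ (D : ℝ≥0∞)⁻¹ ^ p * ((D : ℝ≥0∞) ^ p * ∫⁻ x, G x ^ p ∂μ) := by gcongr
      _ = _ := by
        rw [← mul_assoc, ← ENNReal.mul_rpow_of_nonneg _ _ hp.le, ENNReal.inv_mul_cancel hD' hDt,
          ENNReal.one_rpow, one_mul]
  have hS : MeasurableSet {x | σ < ‖f x‖} := measurableSet_lt measurable_const hf.norm
  calc _ ≤ ∫⁻ x, ((‖g₁ x‖ₑ / D / E) ^ r + (‖g₂ x‖ₑ / D / E) ^ s) ∂μ := lintegral_mono hpt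
    _ = (∫⁻ x, (‖g₁ x‖ₑ / D / E) ^ r ∂μ) + ∫⁻ x, (‖g₂ x‖ₑ / D / E) ^ s ∂μ :=
        lintegral_add_left (by fun_prop) _
    _ ≤ (∫⁻ x, (‖{x | σ < ‖f x‖}.indicator f x‖ₑ / E) ^ r ∂μ) +
        ∫⁻ x, (‖{x | ‖f x‖ ≤ σ}.indicator f x‖ₑ / E) ^ s ∂μ :=
        add_le_add (hcancel r hr _ _ h₁) (hcancel s hs _ _ h₂)
    _ = ∫⁻ x, ((‖{x | σ < ‖f x‖}.indicator f x‖ₑ / E) ^ r +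
        (‖{x | ‖f x‖ ≤ σ}.indicator f x‖ₑ / E) ^ s) ∂μ := by
        rw [lintegral_add_left]
        have := hf.indicator hS
        fun_prop
    _ = _ := by
        refine lintegral_congr fun x => ?_
        -- Above height `σ` the smaller power of `|f|/σ` is the `r`-th, below it the `s`-th, so the
        -- two truncated integrals recombine exactly into that of `minPow`.
        by_cases hx : σ < ‖f x‖
        · have h1 : (1 : ℝ≥0∞) ≤ ‖f x‖ₑ / E := by
            rw [ENNReal.le_div_iff_mul_le (Or.inl hσ') (Or.inl hσt), one_mul, ← ofReal_norm]
            exact ENNReal.ofReal_le_ofReal hx.le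
          rw [Set.indicator_of_mem (by exact hx), Set.indicator_of_notMem (by simpa using hx),
            enorm_zero, ENNReal.zero_div, ENNReal.zero_rpow_of_pos hs, add_zero, minPow,
            min_eq_left (ENNReal.rpow_le_rpow_of_exponent_le h1 hrs.le)]
        · have h1 : ‖f x‖ₑ / E ≤ 1 := by
            refine ENNReal.div_le_of_le_mul ?_
            rw [one_mul, ← ofReal_norm]
            exact ENNReal.ofReal_le_ofReal (not_lt.1 hx)
          rw [Set.indicator_of_notMem (by exact hx), Set.indicator_of_mem (by simpa using hx),
            enorm_zero, ENNReal.zero_div, ENNReal.zero_rpow_of_pos hr, zero_add, minPow,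
            min_eq_right (ENNReal.rpow_le_rpow_of_exponent_ge h1 hrs.le)]

/-- Interpolation of a modular inequality from two truncation estimates at every level. -/
lemma lintegral_powerSup_le {X : Type*} [MeasurableSpace X] {μ : Measure X} [SFinite μ]
    (w : ℝ → ℝ≥0∞) {r a b s : ℝ} (hr : 0 < r) (hra : r < a) (hab : a ≤ b) (hbs : b < s)
    {D : ℝ≥0} (hD : D ≠ 0) {f g : X → ℂ} (hf : Measurable f) (hg : Measurable g)
    (h : ∀ σ : ℝ, 0 < σ → ∃ g₁ g₂ : X → ℂ, Measurable g₁ ∧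
      (∀ x, ‖g x‖ₑ ≤ ‖g₁ x‖ₑ + ‖g₂ x‖ₑ) ∧
      (∫⁻ x, ‖g₁ x‖ₑ ^ r ∂μ ≤
        (D : ℝ≥0∞) ^ r * ∫⁻ x, ‖{x | σ < ‖f x‖}.indicator f x‖ₑ ^ r ∂μ) ∧
      (∫⁻ x, ‖g₂ x‖ₑ ^ s ∂μ ≤
        (D : ℝ≥0∞) ^ s * ∫⁻ x, ‖{x | ‖f x‖ ≤ σ}.indicator f x‖ₑ ^ s ∂μ)) :
    ∫⁻ x, powerSup w a b (‖g x‖ₑ / (2 * D)) ∂μ ≤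
      ENNReal.ofReal ((b - r) * (1 / (a - r) + 1 / (s - b))) *
        ∫⁻ x, powerSup w a b ‖f x‖ₑ ∂μ := by
  have hPm : Measurable (powerSup w a b) := (powerSup_mono w (hr.trans hra)).measurable
  have hmm := measurable_minPow r s
  have hgeq : ∀ x, ‖g x‖ₑ / (2 * D) = ENNReal.ofReal (‖g x‖ / (2 * D)) := by
    intro x
    have : 0 < (D : ℝ) := by positivity
    rw [ENNReal.ofReal_div_of_pos (by positivity), ofReal_norm, ENNReal.ofReal_mul (by norm_num)]
    simp
  have hdiv : ∀ u σ : ℝ, σ ∈ Set.Ioi (0 : ℝ) →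
      ENNReal.ofReal (u / σ) = ENNReal.ofReal u / ENNReal.ofReal σ :=
    fun u σ hσ => ENNReal.ofReal_div_of_pos hσ
  -- Tonelli exchanges the average over heights with the integral over the space, so that the
  -- estimate can be applied at each fixed height.
  have hswap : ∀ F : X → ℝ, Measurable F →
      ∫⁻ x, (∫⁻ σ in Set.Ioi (0 : ℝ), minPow r s (ENNReal.ofReal (F x / σ)) *
        (powerSup w a b (ENNReal.ofReal σ) * ENNReal.ofReal (1 / σ))) ∂μ =
      ∫⁻ σ in Set.Ioi (0 : ℝ), (∫⁻ x, minPow r s (ENNReal.ofReal (F x) / ENNReal.ofReal σ) ∂μ) *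
        (powerSup w a b (ENNReal.ofReal σ) * ENNReal.ofReal (1 / σ)) := by
    intro F hF
    rw [lintegral_lintegral_swap]
    · refine setLIntegral_congr_fun measurableSet_Ioi fun σ hσ => ?_
      rw [lintegral_mul_const _ (by fun_prop)]
      simp_rw [hdiv _ σ hσ]
    · apply Measurable.aemeasurable
      simp only [Function.uncurry_def]
      fun_prop
  calc _ ≤ ∫⁻ x, ENNReal.ofReal (b - r) *
        (∫⁻ σ in Set.Ioi (0 : ℝ), minPow r s (ENNReal.ofReal (‖g x‖ / (2 * D) / σ)) *
        (powerSup w a b (ENNReal.ofReal σ) * ENNReal.ofReal (1 / σ))) ∂μ := by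
        refine lintegral_mono fun x => ?_
        rw [hgeq]
        exact powerSup_le_lintegral w hr hra hab hbs (by positivity)
    _ = ENNReal.ofReal (b - r) * ∫⁻ σ in Set.Ioi (0 : ℝ),
        (∫⁻ x, minPow r s (ENNReal.ofReal (‖g x‖ / (2 * D)) / ENNReal.ofReal σ) ∂μ) *
        (powerSup w a b (ENNReal.ofReal σ) * ENNReal.ofReal (1 / σ)) := by
        rw [lintegral_const_mul' _ _ ENNReal.ofReal_ne_top,
          hswap (fun x => ‖g x‖ / (2 * D)) (by fun_prop)]
    _ ≤ ENNReal.ofReal (b - r) * ∫⁻ σ in Set.Ioi (0 : ℝ),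
        (∫⁻ x, minPow r s (ENNReal.ofReal ‖f x‖ / ENNReal.ofReal σ) ∂μ) *
        (powerSup w a b (ENNReal.ofReal σ) * ENNReal.ofReal (1 / σ)) := by
        refine mul_le_mul' le_rfl (setLIntegral_mono' measurableSet_Ioi fun σ hσ => ?_)
        refine mul_le_mul' ?_ le_rfl
        obtain ⟨g₁, g₂, hg₁, hle, h₁, h₂⟩ := h σ hσ
        simp_rw [← hgeq, ofReal_norm]
        exact lintegral_minPow_le hr (by linarith) hD hσ hf hg₁ hle h₁ h₂
    _ = ENNReal.ofReal (b - r) * ∫⁻ x, (∫⁻ σ in Set.Ioi (0 : ℝ),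
        minPow r s (ENNReal.ofReal (‖f x‖ / σ)) *
        (powerSup w a b (ENNReal.ofReal σ) * ENNReal.ofReal (1 / σ))) ∂μ := by
        rw [hswap _ hf.norm]
    _ ≤ ENNReal.ofReal (b - r) * ∫⁻ x, ENNReal.ofReal (1 / (a - r) + 1 / (s - b)) *
        powerSup w a b ‖f x‖ₑ ∂μ := by
        gcongr with x
        rw [← ofReal_norm]
        exact lintegral_le_powerSup w hr hra hab hbs (norm_nonneg _)
    _ = _ := by
        rw [lintegral_const_mul' _ _ ENNReal.ofReal_ne_top, ← mul_assoc,
          ← ENNReal.ofReal_mul (by linarith)]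

lemma DirichletBound.mono {M p : ℝ} {C C' : ℝ≥0} (hp : 0 ≤ p) (h : DirichletBound M p C)
    (hC : C ≤ C') : DirichletBound M p C' := fun f hf =>
  (h f hf).trans (by gcongr)

lemma IsBddCompact.indicator {X : Type*} [NormedAddCommGroup X] [MeasurableSpace X] {f : X → ℂ}
    (hf : IsBddCompact f) {S : Set X} (hS : MeasurableSet S) : IsBddCompact (S.indicator f) := by
  obtain ⟨C, hC0, hC⟩ := hf.bdd
  obtain ⟨R, hR0, hR⟩ := hf.supp
  refine ⟨hf.measurable.indicator hS, ⟨C, hC0, fun x => ?_⟩, ⟨R, hR0, fun x hx => ?_⟩⟩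
  · exact (norm_indicator_le_norm_self f x).trans (hC x)
  · by_cases h : x ∈ S
    · rw [Set.indicator_of_mem h, hR x hx]
    · rw [Set.indicator_of_notMem h]

/-- Modular interpolation for the partial integral operator. -/
lemma lintegral_powerSup_cubeOp_le {d : ℕ} {M : ℝ} (hM : 0 < M) (w : ℝ → ℝ≥0∞) {r a b s : ℝ}
    (hr : 0 < r) (hra : r < a) (hab : a ≤ b) (hbs : b < s) {C : ℝ≥0} (hC : C ≠ 0)
    (h₁ : DirichletBound M r C) (h₂ : DirichletBound M s C) {f : (Fin d → ℝ) → ℂ}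
    (hf : IsBddCompact f) :
    ∫⁻ x, powerSup w a b (‖cubeOp M f x‖ₑ / (2 * (C ^ d : ℝ≥0))) ≤
      ENNReal.ofReal ((b - r) * (1 / (a - r) + 1 / (s - b))) *
        ∫⁻ x, powerSup w a b ‖f x‖ₑ := by
  refine lintegral_powerSup_le w hr hra hab hbs (pow_ne_zero d hC) hf.measurable
    (measurable_cubeOp hf.measurable M) fun σ hσ => ?_
  have hS : MeasurableSet {x | σ < ‖f x‖} := measurableSet_lt measurable_const hf.measurable.norm
  have hS' : MeasurableSet {x | ‖f x‖ ≤ σ} := measurableSet_le hf.measurable.norm measurable_const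
  have hf₁ := hf.indicator hS
  have hf₂ := hf.indicator hS'
  -- The part of `f` above height `σ` is estimated in `L^r`, the part below in `L^s`.
  refine ⟨cubeOp M ({x | σ < ‖f x‖}.indicator f), cubeOp M ({x | ‖f x‖ ≤ σ}.indicator f),
    measurable_cubeOp hf₁.measurable M, fun x => ?_,
    lintegral_cubeOp_rpow_le hM hr h₁ d _ hf₁,
    lintegral_cubeOp_rpow_le hM (by linarith) h₂ d _ hf₂⟩
  have : cubeOp M f x = cubeOp M ({x | σ < ‖f x‖}.indicator f) x +
      cubeOp M ({x | ‖f x‖ ≤ σ}.indicator f) x := by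
    rw [cubeOp, cubeOp, cubeOp, ← integral_add
      (integrable_cubeKernel_smul (hf₁.integrable volume) hM x)
      (integrable_cubeKernel_smul (hf₂.integrable volume) hM x)]
    congr 1; ext y
    rw [← smul_add]
    congr 1
    by_cases hy : σ < ‖f y‖
    · rw [Set.indicator_of_mem (by exact hy), Set.indicator_of_notMem (by simpa using hy), add_zero]
    · rw [Set.indicator_of_notMem (by exact hy), Set.indicator_of_mem (by simpa using hy), zero_add]
  rw [this]
  exact enorm_add_le _ _

/-! ### Covering the range of exponents -/

/-- Exponents and constants for interpolating over a covering of `[α, ∞)` by the intervals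
`[a n, 2 n + 4]`. -/
lemma exists_dirichletBound_family {α : ℝ} (hα : 1 < α) :
    ∃ (E : ℝ≥0) (a r : ℕ → ℝ) (C : ℝ), 1 ≤ E ∧
      (∀ n, 0 < r n ∧ r n < a n ∧ n ≤ a n ∧ a n ≤ 2 * n + 4) ∧
      (∀ n, (2 * n + 4 - r n) * (1 / (a n - r n) + 1 / (2 * n + 6 - (2 * n + 4))) ≤ C) ∧
      (∀ M, 0 < M → ∀ n : ℕ, DirichletBound M (r n) (E * (n + 1)) ∧
        DirichletBound M (2 * n + 6) (E * (n + 1))) ∧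
      ∀ p, α ≤ p → ∃ n : ℕ, a n ≤ p ∧ p ≤ 2 * n + 4 ∧ (n : ℝ) + 1 ≤ p := by
  -- The minimum with 2 keeps the left end of the first interval below its right end 4.
  set a₀ := min α 2 with ha₀
  have ha1 : 1 < a₀ := lt_min hα one_lt_two
  -- For such `m` the conjugate exponent `2m / (2m - 1)` is smaller than `a₀`, so duality provides
  -- the lower endpoint `r₀` of the first interpolation.
  obtain ⟨m, hm⟩ := exists_nat_gt (a₀ / (a₀ - 1))
  have hm0 : (0 : ℝ) < m := lt_trans (by apply div_pos <;> linarith) hm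
  have hm1 : 1 ≤ m := by exact_mod_cast hm0
  have hm1' : (1 : ℝ) ≤ m := by exact_mod_cast hm1
  have hq : 1 < (2 * m : ℝ) := by linarith
  have hconj := Real.HolderConjugate.conjExponent hq
  set r₀ := (2 * m : ℝ).conjExponent with hr₀
  have hr₀lt : r₀ < a₀ := by
    rw [hr₀, Real.conjExponent, div_lt_iff₀ (by linarith)]
    rw [div_lt_iff₀ (by linarith)] at hm
    nlinarith
  -- For `n ≥ 1` the exponents are `2n < 2n + 2 < 2n + 4 < 2n + 6`, and the interpolation constant
  -- is `4 (1/2 + 1/2) = 4` for every `n`. The index 0 is the only one that needs `r₀`. The factor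
  -- `m + 3` covers the constants `1056 m`, `1056 n` and `1056 (n + 3)` at once.
  refine ⟨1056 * (m + 3), fun n => if n = 0 then a₀ else 2 * n + 2,
    fun n => if n = 0 then r₀ else 2 * n,
    max 4 ((2 * 0 + 4 - r₀) * (1 / (a₀ - r₀) + 1 / (2 * 0 + 6 - (2 * 0 + 4)))), ?_, ?_, ?_, ?_, ?_⟩
  · rw [← NNReal.coe_le_coe]; push_cast; linarith
  · intro n
    rcases Nat.eq_zero_or_pos n with rfl | hn
    · simp only [if_true, Nat.cast_zero]
      have := min_le_right α 2
      exact ⟨hconj.symm.pos, hr₀lt, by linarith, by linarith⟩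
    · have hn' : (1 : ℝ) ≤ n := by exact_mod_cast hn
      simp only [hn.ne', if_false]
      exact ⟨by linarith, by linarith, by linarith, by linarith⟩
  · intro n
    rcases Nat.eq_zero_or_pos n with rfl | hn
    · simp only [if_true, Nat.cast_zero]
      exact le_max_right _ _
    · simp only [hn.ne', if_false]
      refine le_trans (le_of_eq ?_) (le_max_left _ _)
      ring_nf
  · intro M hM n
    have hn0 : (0 : ℝ) ≤ n := n.cast_nonneg
    constructor
    · rcases Nat.eq_zero_or_pos n with rfl | hn
      · simp only [if_true]
        refine ((dirichletBound_even hM hm1).conj hM hconj.symm).mono hconj.symm.nonneg ?_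
        rw [← NNReal.coe_le_coe]; push_cast; linarith
      · have hn' : (1 : ℝ) ≤ n := by exact_mod_cast hn
        simp only [hn.ne', if_false]
        refine (dirichletBound_even hM hn).mono (by linarith) ?_
        rw [← NNReal.coe_le_coe]; push_cast; nlinarith
    · have h := dirichletBound_even hM (m := n + 3) (by omega)
      have e : (2 * ((n + 3 : ℕ) : ℝ)) = 2 * n + 6 := by push_cast; ring
      rw [e] at h
      refine h.mono (by positivity) ?_
      rw [← NNReal.coe_le_coe]; push_cast; nlinarith
  · intro p hp
    rcases le_or_gt p 4 with h4 | h4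
    · refine ⟨0, ?_, by simpa using h4, by simp; linarith⟩
      simp only [if_true]
      exact (min_le_left _ _).trans hp
    · have hn : 1 ≤ ⌊(p - 2) / 2⌋₊ := Nat.le_floor (by push_cast; linarith)
      have h1 := Nat.floor_le (a := (p - 2) / 2) (by linarith)
      have h2 := Nat.lt_floor_add_one ((p - 2) / 2)
      refine ⟨⌊(p - 2) / 2⌋₊, ?_, by linarith, ?_⟩
      · have hne : ⌊(p - 2) / 2⌋₊ ≠ 0 := by omega
        simp only [hne, if_false]
        linarith
      · have : (0 : ℝ) ≤ ⌊(p - 2) / 2⌋₊ := Nat.cast_nonneg _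
        linarith

/-- Modular inequality for the partial integral operator with arbitrary weights: the loss is the
factor `p^d` inside the power `p`. -/
lemma exists_lintegral_iSup_cubeOp_le (d : ℕ) {α : ℝ} (hα : 1 < α) :
    ∃ (K : ℝ≥0) (C : ℝ≥0), 1 ≤ K ∧ ∀ (w : ℝ → ℝ≥0∞) (M : ℝ), 0 < M →
      ∀ f : (Fin d → ℝ) → ℂ, IsBddCompact f →
        ∫⁻ x, ⨆ p ∈ Set.Ici α, w p * (‖cubeOp M f x‖ₑ / (K * ENNReal.ofReal p ^ d)) ^ p ≤
          C * ∫⁻ x, ⨆ p ∈ Set.Ici α, w p * ‖f x‖ₑ ^ p := by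
  obtain ⟨E, a, r, C, hE, har, hC, hB, hcov⟩ := exists_dirichletBound_family hα
  have hsum : ∑' n : ℕ, ((2 : ℝ≥0∞)⁻¹ ^ n * ENNReal.ofReal C) ≠ ∞ := by
    rw [ENNReal.tsum_mul_right, ENNReal.tsum_geometric, ENNReal.one_sub_inv_two, inv_inv]
    finiteness
  -- Of `4 = 2 · 2`, one factor is the loss in the interpolation and the other produces the
  -- geometric weights `2^(-n)`.
  refine ⟨4 * E ^ d, (∑' n : ℕ, ((2 : ℝ≥0∞)⁻¹ ^ n * ENNReal.ofReal C)).toNNReal, ?_, ?_⟩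
  · have := one_le_pow₀ hE (n := d)
    calc (1 : ℝ≥0) ≤ 4 * 1 := by norm_num
      _ ≤ _ := by gcongr
  intro w M hM f hf
  rw [ENNReal.coe_toNNReal hsum]
  -- The covering intervals may contain exponents below `α`; these are given weight zero.
  set w' : ℝ → ℝ≥0∞ := (Set.Ici α).indicator w with hw'
  set D : ℕ → ℝ≥0 := fun n => (E * (n + 1)) ^ d with hDdef
  have hDpos : ∀ n : ℕ, E * (n + 1) ≠ 0 := fun n =>
    mul_ne_zero (zero_lt_one.trans_le hE).ne' (by positivity)
  have hTm := measurable_cubeOp hf.measurable M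
  -- Each `p` lies in an interval with `n + 1 ≤ p`, so `p^d` dominates the operator constant `(n +
  -- 1)^d` and `2^(-p) ≤ 2^(-n)`.
  have hpt : ∀ u : ℝ≥0∞, ⨆ p ∈ Set.Ici α, w p * (u / ((4 * E ^ d : ℝ≥0) * ENNReal.ofReal p ^ d)) ^ p
      ≤ ∑' n, (2 : ℝ≥0∞)⁻¹ ^ n * powerSup w' (a n) (2 * n + 4) (u / (2 * D n)) := by
    intro u
    refine iSup₂_le fun p hp => ?_
    obtain ⟨n, hn1, hn2, hn3⟩ := hcov p hp
    have hp0 : 0 < p := by linarith [Set.mem_Ici.1 hp]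
    refine le_trans ?_ (ENNReal.le_tsum n)
    have h1 : u / ((4 * E ^ d : ℝ≥0) * ENNReal.ofReal p ^ d) ≤ 2⁻¹ * (u / (2 * D n)) := by
      have h2 : (2 : ℝ≥0∞) * (2 * D n) ≤ (4 * E ^ d : ℝ≥0) * ENNReal.ofReal p ^ d := by
        have e : (2 : ℝ≥0∞) * (2 * D n) = (4 * E ^ d : ℝ≥0) * ((n + 1 : ℝ≥0) : ℝ≥0∞) ^ d := by
          rw [hDdef]; push_cast; rw [mul_pow]; ring
        rw [e]
        gcongr
        rw [ENNReal.ofReal, ENNReal.coe_le_coe, ← NNReal.coe_le_coe, Real.coe_toNNReal _ hp0.le]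
        exact_mod_cast hn3
      calc _ ≤ u / (2 * (2 * D n)) := ENNReal.div_le_div_left h2 _
        _ = _ := by
          rw [div_eq_mul_inv, ENNReal.mul_inv (Or.inl (by norm_num)) (Or.inl (by norm_num)),
            div_eq_mul_inv]
          ring
    calc _ ≤ w p * (2⁻¹ * (u / (2 * D n))) ^ p := by gcongr
      _ = (2 : ℝ≥0∞)⁻¹ ^ p * (w' p * (u / (2 * D n)) ^ p) := by
          rw [ENNReal.mul_rpow_of_nonneg _ _ hp0.le, hw', Set.indicator_of_mem hp]; ring
      _ ≤ (2 : ℝ≥0∞)⁻¹ ^ n * powerSup w' (a n) (2 * n + 4) (u / (2 * D n)) := by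
          gcongr
          · rw [← ENNReal.rpow_natCast]
            exact ENNReal.rpow_le_rpow_of_exponent_ge (by simp) (by linarith)
          · exact le_iSup₂_of_le (f := fun p _ => w' p * (u / (2 * D n)) ^ p) p ⟨hn1, hn2⟩ le_rfl
  have hle : ∀ (n : ℕ) (u : ℝ≥0∞), powerSup w' (a n) (2 * n + 4) u ≤
      ⨆ p ∈ Set.Ici α, w p * u ^ p := by
    intro n u
    refine iSup₂_le fun p _ => ?_
    by_cases hpα : p ∈ Set.Ici α
    · rw [hw', Set.indicator_of_mem hpα]
      exact le_iSup₂_of_le (f := fun p _ => w p * u ^ p) p hpα le_rfl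
    · rw [hw', Set.indicator_of_notMem hpα, zero_mul]; exact zero_le
  calc _ ≤ ∫⁻ x, ∑' n, (2 : ℝ≥0∞)⁻¹ ^ n *
        powerSup w' (a n) (2 * n + 4) (‖cubeOp M f x‖ₑ / (2 * D n)) := lintegral_mono fun x => hpt _
    _ = ∑' n, (2 : ℝ≥0∞)⁻¹ ^ n *
        ∫⁻ x, powerSup w' (a n) (2 * n + 4) (‖cubeOp M f x‖ₑ / (2 * D n)) := by
        have hmeas : ∀ n : ℕ, Measurable fun x =>
            powerSup w' (a n) (2 * n + 4) (‖cubeOp M f x‖ₑ / (2 * D n)) := fun n =>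
          (powerSup_mono w' ((har n).1.trans (har n).2.1)).measurable.comp (by fun_prop)
        rw [lintegral_tsum fun n => ((hmeas n).const_mul _).aemeasurable]
        congr 1; ext n
        rw [lintegral_const_mul _ (hmeas n)]
    _ ≤ ∑' n, ((2 : ℝ≥0∞)⁻¹ ^ n * ENNReal.ofReal C) *
        ∫⁻ x, ⨆ p ∈ Set.Ici α, w p * ‖f x‖ₑ ^ p := by
        refine ENNReal.tsum_le_tsum fun n => ?_
        rw [mul_assoc]
        gcongr
        obtain ⟨h1, h2, h3, h4⟩ := har n
        refine (lintegral_powerSup_cubeOp_le hM w' h1 h2 h4 (by linarith) (hDpos n)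
          (hB M hM n).1 (hB M hM n).2 hf).trans ?_
        exact mul_le_mul' (ENNReal.ofReal_le_ofReal (hC n)) (lintegral_mono fun x => hle n _)
    _ = _ := ENNReal.tsum_mul_right

/-! ### Orlicz functions as suprema of powers -/

/-- The conditions on `ψ` used in the construction of the Orlicz functions. -/
structure IsWeakPsi (α : ℝ) (ψ : ℝ → ℝ) : Prop where
  pos : ∀ p, α ≤ p → 0 < ψ p
  monotoneOn : MonotoneOn ψ (Set.Ici α)
  tendsto : Tendsto ψ atTop atTop

lemma ExpOrlicz.IsPsi.isWeakPsi {α : ℝ} {ψ : ℝ → ℝ} (h : ExpOrlicz.IsPsi α ψ) : IsWeakPsi α ψ :=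
  ⟨h.pos, h.strictMonoOn.monotoneOn, h.tendsto⟩

lemma IsWeakPsi.psiPow {α : ℝ} {ψ : ℝ → ℝ} (h : IsWeakPsi α ψ) (hα : 1 < α) (d : ℕ) :
    IsWeakPsi α (ExpOrlicz.psiPow d ψ) := by
  refine ⟨fun p hp => ?_, fun p hp q hq hpq => ?_, ?_⟩
  · have := h.pos p hp
    have : 0 < p := by linarith
    unfold ExpOrlicz.psiPow
    positivity
  · have h1 := h.monotoneOn hp hq hpq
    have h2 := h.pos p hp
    have h3 : 0 < p := by linarith [Set.mem_Ici.1 hp]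
    have h4 : 0 < q := h3.trans_le hpq
    unfold ExpOrlicz.psiPow
    gcongr
  · refine tendsto_atTop_mono' _ ?_ h.tendsto
    filter_upwards [eventually_ge_atTop α] with p hp
    have h1 := h.pos p hp
    exact le_mul_of_one_le_left h1.le (one_le_pow₀ (by linarith))

/-- The function `sup_{p ≥ α} (|u| / ψ(p))^p`. -/
noncomputable def supPow (α : ℝ) (ψ : ℝ → ℝ) (u : ℝ) : ℝ :=
  ⨆ p : Set.Ici α, (|u| / ψ p) ^ (p : ℝ)

section supPow

variable {α : ℝ} {ψ : ℝ → ℝ}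

/-- Since `ψ → ∞`, all terms with large `p` are at most 1. Boundedness matters because the supremum
of an unbounded real family has the default value 0. -/
lemma bddAbove_supPow (hα : 1 < α) (h : IsWeakPsi α ψ) (u : ℝ) :
    BddAbove (Set.range fun p : Set.Ici α => (|u| / ψ p) ^ (p : ℝ)) := by
  obtain ⟨q, hq⟩ := (h.tendsto.eventually_ge_atTop |u|).exists_forall_of_atTop
  set t := max 1 (|u| / ψ α) with ht
  have ht1 : 1 ≤ t := le_max_left _ _
  refine ⟨t ^ max q 0, ?_⟩
  rintro _ ⟨⟨p, hp⟩, rfl⟩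
  have hp0 : 0 < p := by linarith [Set.mem_Ici.1 hp]
  have hψ := h.pos p hp
  have hnn : 0 ≤ |u| / ψ p := by positivity
  simp only
  rcases le_total q p with hqp | hpq
  · calc (|u| / ψ p) ^ p ≤ 1 := Real.rpow_le_one hnn ((div_le_one hψ).2 (hq p hqp)) hp0.le
      _ ≤ _ := Real.one_le_rpow ht1 (le_max_right _ _)
  · have h1 : |u| / ψ p ≤ t := by
      refine le_trans ?_ (le_max_right _ _)
      have := h.pos α le_rfl
      have := h.monotoneOn (Set.mem_Ici.2 le_rfl) hp hp
      gcongr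
    calc (|u| / ψ p) ^ p ≤ t ^ p := Real.rpow_le_rpow hnn h1 hp0.le
      _ ≤ _ := Real.rpow_le_rpow_of_exponent_le ht1 (hpq.trans (le_max_left _ _))

lemma le_supPow (hα : 1 < α) (h : IsWeakPsi α ψ) (u : ℝ) {p : ℝ} (hp : α ≤ p) :
    (|u| / ψ p) ^ p ≤ supPow α ψ u :=
  le_ciSup (bddAbove_supPow hα h u) (⟨p, hp⟩ : Set.Ici α)

lemma supPow_le {u B : ℝ} (hB : ∀ p, α ≤ p → (|u| / ψ p) ^ p ≤ B) : supPow α ψ u ≤ B :=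
  have : Nonempty (Set.Ici α) := ⟨⟨α, Set.self_mem_Ici⟩⟩
  ciSup_le fun p => hB p p.2

lemma supPow_neg (u : ℝ) : supPow α ψ (-u) = supPow α ψ u := by
  rw [supPow, abs_neg, supPow]

lemma supPow_abs (u : ℝ) : supPow α ψ |u| = supPow α ψ u := by
  rw [supPow, abs_abs, supPow]

lemma supPow_pos (hα : 1 < α) (h : IsWeakPsi α ψ) {u : ℝ} (hu : u ≠ 0) : 0 < supPow α ψ u := by
  refine lt_of_lt_of_le ?_ (le_supPow hα h u le_rfl)
  have := h.pos α le_rfl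
  have := abs_pos.2 hu
  positivity

lemma supPow_zero (hα : 1 < α) (h : IsWeakPsi α ψ) : supPow α ψ 0 = 0 := by
  have h0 : ∀ p, α ≤ p → (|(0 : ℝ)| / ψ p) ^ p = 0 := fun p hp => by
    rw [abs_zero, zero_div, Real.zero_rpow (by linarith)]
  exact le_antisymm (supPow_le fun p hp => (h0 p hp).le)
    ((h0 α le_rfl).symm.trans_le (le_supPow hα h 0 le_rfl))

/-- All exponents are at least `α`. Equivalently, `supPow(u) / u^α` is nondecreasing, which yields
strict monotonicity and the comparisons with powers. -/
lemma supPow_mul_le (hα : 1 < α) (h : IsWeakPsi α ψ) {l : ℝ} (h0 : 0 ≤ l) (h1 : l ≤ 1) (u : ℝ) :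
    supPow α ψ (l * u) ≤ l ^ α * supPow α ψ u := by
  refine supPow_le fun p hp => ?_
  have := h.pos p hp
  rw [abs_mul, abs_of_nonneg h0, mul_div_assoc, Real.mul_rpow h0 (by positivity)]
  have h2 : l ^ p ≤ l ^ α := by
    rcases h0.eq_or_lt with rfl | h0
    · rw [Real.zero_rpow (by linarith), Real.zero_rpow (by linarith)]
    · exact Real.rpow_le_rpow_of_exponent_ge h0 h1 hp
  have h3 := le_supPow hα h u hp
  gcongr

lemma convexOn_abs_rpow {p : ℝ} (hp : 1 ≤ p) : ConvexOn ℝ Set.univ fun u : ℝ => |u| ^ p := by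
  refine ⟨convex_univ, fun x _ y _ a b ha hb hab => ?_⟩
  have h1 : |a • x + b • y| ≤ a • |x| + b • |y| := by
    refine (abs_add_le _ _).trans_eq ?_
    simp [abs_mul, abs_of_nonneg ha, abs_of_nonneg hb]
  exact (Real.rpow_le_rpow (abs_nonneg _) h1 (by linarith)).trans
    ((convexOn_rpow hp).2 (Set.mem_Ici.2 (abs_nonneg x)) (Set.mem_Ici.2 (abs_nonneg y)) ha hb hab)

lemma convexOn_supPow (hα : 1 < α) (h : IsWeakPsi α ψ) : ConvexOn ℝ Set.univ (supPow α ψ) := by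
  refine ⟨convex_univ, fun x _ y _ a b ha hb hab => supPow_le fun p hp => ?_⟩
  have hψ := h.pos p hp
  have hc := (convexOn_abs_rpow (p := p) (by linarith)).2 (Set.mem_univ (x / ψ p))
    (Set.mem_univ (y / ψ p)) ha hb hab
  have e : ∀ z, |z| / ψ p = |z / ψ p| := fun z => by rw [abs_div, abs_of_pos hψ]
  have e2 : (a • x + b • y) / ψ p = a • (x / ψ p) + b • (y / ψ p) := by
    simp only [smul_eq_mul]; ring
  rw [e, e2]
  refine hc.trans ?_
  have hx := le_supPow hα h x hp
  have hy := le_supPow hα h y hp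
  rw [e] at hx hy
  simp only [smul_eq_mul]
  gcongr

lemma strictMonoOn_supPow (hα : 1 < α) (h : IsWeakPsi α ψ) :
    StrictMonoOn (supPow α ψ) (Set.Ici 0) := by
  intro u hu v _ huv
  have hv0 : 0 < v := lt_of_le_of_lt hu huv
  have h1 := supPow_mul_le hα h (l := u / v) (div_nonneg hu hv0.le) ((div_le_one hv0).2 huv.le) v
  rw [div_mul_cancel₀ _ hv0.ne'] at h1
  have h2 := supPow_pos hα h hv0.ne'
  have h3 : (u / v) ^ α < 1 :=
    Real.rpow_lt_one (div_nonneg hu hv0.le) ((div_lt_one hv0).2 huv) (by linarith)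
  nlinarith

lemma isNFunction_supPow (hα : 1 < α) (h : IsWeakPsi α ψ) :
    ExpOrlicz.IsNFunction (supPow α ψ) where
  even := supPow_neg
  continuous := by
    have := (convexOn_supPow hα h).continuousOn isOpen_univ
    rwa [continuousOn_univ] at this
  convex := convexOn_supPow hα h
  strictMono := strictMonoOn_supPow hα h
  zero_iff u := ⟨fun h0 => by_contra fun hu => (supPow_pos hα h hu).ne' h0,
    fun h0 => h0 ▸ supPow_zero hα h⟩
  superlinear := by
    have hψ := h.pos α le_rfl
    have h1 : Tendsto (fun u : ℝ => (ψ α ^ α)⁻¹ * u ^ (α - 1)) atTop atTop :=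
      (tendsto_rpow_atTop (by linarith)).const_mul_atTop (by positivity)
    refine tendsto_atTop_mono' _ ?_ h1
    filter_upwards [eventually_gt_atTop 0] with u hu
    have h2 := le_supPow hα h u le_rfl
    rw [abs_of_pos hu, Real.div_rpow hu.le hψ.le] at h2
    rw [le_div_iff₀ hu, mul_assoc, ← Real.rpow_add_one hu.ne', sub_add_cancel, ← div_eq_inv_mul]
    exact h2

/-- The exponential is increasing and continuous, so it commutes with the supremum of a family
bounded above. -/
lemma exp_youngFenchel (hα : 1 < α) (h : IsWeakPsi α ψ) {u : ℝ} (hu : u ≠ 0) :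
    Real.exp (ExpOrlicz.youngFenchel α (fun p => p * Real.log (ψ p)) (Real.log |u|)) =
      supPow α ψ u := by
  have hu' := abs_pos.2 hu
  have hterm : ∀ p : Set.Ici α, Real.exp ((p : ℝ) * Real.log |u| - p * Real.log (ψ p)) =
      (|u| / ψ p) ^ (p : ℝ) := by
    intro p
    have hψ := h.pos p p.2
    rw [Real.rpow_def_of_pos (by positivity), Real.log_div hu'.ne' hψ.ne']
    congr 1; ring
  have hb : BddAbove (Set.range fun p : Set.Ici α =>
      (p : ℝ) * Real.log |u| - p * Real.log (ψ p)) := by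
    obtain ⟨B, hB⟩ := bddAbove_supPow hα h u
    refine ⟨Real.log B, ?_⟩
    rintro _ ⟨p, rfl⟩
    have h1 : (|u| / ψ p) ^ (p : ℝ) ≤ B := hB ⟨p, rfl⟩
    have hψ := h.pos p p.2
    have h2 : 0 < (|u| / ψ p) ^ (p : ℝ) := by positivity
    rw [Real.le_log_iff_exp_le (h2.trans_le h1), hterm]
    exact h1
  have : Nonempty (Set.Ici α) := ⟨⟨α, Set.self_mem_Ici⟩⟩
  rw [ExpOrlicz.youngFenchel, Real.exp_monotone.map_ciSup_of_continuousAt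
    Real.continuous_exp.continuousAt hb, supPow]
  simp_rw [hterm]

lemma isExpNFunction_supPow (hα : 1 < α) (h : IsWeakPsi α ψ) :
    ExpOrlicz.IsExpNFunction α ψ (supPow α ψ) := by
  refine ⟨isNFunction_supPow hα h, fun u hu => (exp_youngFenchel hα h ?_).symm⟩
  rintro rfl
  have := Real.exp_pos 2
  simp at hu
  linarith

/-- Existence of a modification: the maximum of a power, a chord and the function itself. -/
lemma exists_isModifiedExpNFunction (hα : 1 < α) (h : IsWeakPsi α ψ) :
    ∃ A, ExpOrlicz.IsModifiedExpNFunction α ψ A := by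
  set N := supPow α ψ with hN
  have hNF : ExpOrlicz.IsNFunction N := isNFunction_supPow hα h
  have hmono : StrictMonoOn N (Set.Ici 0) := hNF.strictMono
  have hconv : ConvexOn ℝ Set.univ N := hNF.convex
  set c₁ := N 1
  have hc₁ : 0 < c₁ := supPow_pos hα h one_ne_zero
  -- `c₃ + c₄ |u|` is the chord of `N` between 1 and 2, and `N 1 |u|^α` meets `N` at 1, so the three
  -- pieces fit together.
  set c₄ := N 2 - N 1 with hc₄d
  have hc₄ : 0 < c₄ := by
    have : N 1 < N 2 := hmono (by simp) (by simp) (by norm_num)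
    linarith
  set c₃ := N 1 - c₄ with hc₃d
  have hNabs : ∀ u, N |u| = N u := fun u => supPow_abs u
  have hPow₁ : ∀ u, |u| ≤ 1 → N u ≤ c₁ * |u| ^ α := by
    intro u hu
    have := supPow_mul_le hα h (abs_nonneg u) hu 1
    rw [mul_one] at this
    rw [← hNabs, mul_comm]
    exact this
  have hPow₂ : ∀ u, 1 ≤ |u| → c₁ * |u| ^ α ≤ N u := by
    intro u hu
    have hu0 : 0 < |u| := by linarith
    have := supPow_mul_le hα h (l := |u|⁻¹) (by positivity) (inv_le_one_of_one_le₀ hu) |u|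
    rw [inv_mul_cancel₀ hu0.ne', Real.inv_rpow hu0.le, supPow_abs] at this
    rwa [← le_div_iff₀ (by positivity), div_eq_inv_mul]
  -- By convexity the chord lies above `N` between 1 and 2 and below it elsewhere. The maximum
  -- therefore selects the power, the chord and `N` on the three ranges, and it is convex as a
  -- maximum of convex functions.
  have hL₁ : ∀ u, |u| ≤ 1 → c₃ + c₄ * |u| ≤ N u := by
    intro u hu
    rcases hu.eq_or_lt with hu1 | hu1
    · rw [← hNabs, hu1]; linarith
    · have := hconv.slope_mono_adjacent (Set.mem_univ |u|) (Set.mem_univ 2) hu1 (by norm_num)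
      rw [div_le_iff₀ (by linarith), hNabs] at this
      norm_num at this
      nlinarith
  have hL₂ : ∀ u, 1 < |u| → |u| ≤ 2 → N u ≤ c₃ + c₄ * |u| := by
    intro u hu1 hu2
    rcases hu2.eq_or_lt with hu2 | hu2
    · rw [← hNabs, hu2]; linarith
    · have := hconv.slope_mono_adjacent (Set.mem_univ 1) (Set.mem_univ 2) hu1 hu2
      rw [div_le_div_iff₀ (by linarith) (by linarith), hNabs] at this
      nlinarith
  have hL₃ : ∀ u, 2 < |u| → c₃ + c₄ * |u| ≤ N u := by
    intro u hu
    have := hconv.slope_mono_adjacent (Set.mem_univ 1) (Set.mem_univ |u|) (by norm_num) hu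
    rw [le_div_iff₀ (by linarith), hNabs] at this
    norm_num at this
    nlinarith
  refine ⟨fun u => max (max (c₁ * |u| ^ α) (c₃ + c₄ * |u|)) (N u), N, isExpNFunction_supPow hα h,
    ⟨?_, ?_, ?_, ?_, ?_, ?_⟩, c₁, 1, c₃, c₄, 2, one_pos, by norm_num, ?_, ?_, ?_⟩
  · intro u
    simp only [abs_neg, hNF.even]
  · have := hNF.continuous
    have h2 : Continuous fun u : ℝ => |u| ^ α := continuous_abs.rpow_const fun _ => Or.inr (by linarith)
    fun_prop
  · refine ((((convexOn_abs_rpow hα.le).smul hc₁.le).sup ?_).sup hconv)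
    have h1 : ConvexOn ℝ Set.univ fun u : ℝ => |u| := convexOn_norm convex_univ
    exact (convexOn_const c₃ convex_univ).add (h1.smul hc₄.le)
  · intro u hu v hv huv
    have h1 := hmono hu hv huv
    have hu' : (0 : ℝ) ≤ u := hu
    simp only [abs_of_nonneg hu', abs_of_nonneg (hu'.trans huv.le)]
    refine max_lt_max (max_lt_max ?_ ?_) h1
    · have := Real.rpow_lt_rpow hu' huv (by linarith : 0 < α)
      gcongr
    · gcongr
  · intro u
    constructor
    · intro h0
      have h1 : N u ≤ 0 := (le_max_right _ _).trans_eq h0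
      by_contra hu
      exact absurd h1 (not_le.2 (supPow_pos hα h hu))
    · rintro rfl
      have h1 := hPow₁ 0 (by simp)
      have h2 := hL₁ 0 (by simp)
      have h0 : N 0 = 0 := (hNF.zero_iff 0).2 rfl
      have h3 : c₁ * |(0 : ℝ)| ^ α = 0 := by
        rw [abs_zero, Real.zero_rpow (by linarith), mul_zero]
      rw [h0] at h2 ⊢
      rw [h3, max_eq_left h2, max_self]
  · refine tendsto_atTop_mono' _ ?_ hNF.superlinear
    filter_upwards [eventually_gt_atTop 0] with u hu
    gcongr
    exact le_max_right _ _
  · intro u hu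
    simp only
    rw [max_eq_left ((hL₁ u hu).trans (hPow₁ u hu)), max_eq_left (hPow₁ u hu)]
  · intro u hu1 hu2
    simp only
    rw [max_eq_right ((hPow₂ u hu1.le).trans (hL₂ u hu1 hu2)), max_eq_left (hL₂ u hu1 hu2)]
  · intro u hu
    exact max_eq_right (max_le (hPow₂ u (by linarith)) (hL₃ u hu))

end supPow

/-! ### The partial integral as a convolution -/

lemma integral_Icc_exp {M : ℝ} (hM : 0 < M) (s : ℝ) :
    ((2 * Real.pi : ℝ) : ℂ)⁻¹ * ∫ t in Set.Icc (-M) M, Complex.exp (-(Complex.I * ((t * s : ℝ) : ℂ)))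
      = dirichletKernel M s := by
  have hpi : (Real.pi : ℂ) ≠ 0 := by exact_mod_cast Real.pi_ne_zero
  rw [integral_Icc_eq_integral_Ioc, ← intervalIntegral.integral_of_le (by linarith)]
  rcases eq_or_ne s 0 with rfl | hs
  · simp [dirichletKernel]
    field_simp
    ring
  · have hs' : (s : ℂ) ≠ 0 := by exact_mod_cast hs
    have hc : (-(Complex.I * s) : ℂ) ≠ 0 := neg_ne_zero.2 (mul_ne_zero Complex.I_ne_zero hs')
    have e : ∀ t : ℝ, Complex.exp (-(Complex.I * ((t * s : ℝ) : ℂ))) =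
        Complex.exp (-(Complex.I * s) * t) := fun t => by
      congr 1; push_cast; ring
    simp_rw [e]
    rw [integral_exp_mul_complex hc, dirichletKernel_of_ne_zero hM hs]
    push_cast
    rw [Complex.sin]
    have e1 : (-(Complex.I * s) * M : ℂ) = -(M * s) * Complex.I := by ring
    have e2 : (-(Complex.I * s) * -M : ℂ) = M * s * Complex.I := by ring
    rw [e1, e2]
    have hI := Complex.I_ne_zero
    field_simp
    have := Complex.I_sq
    linear_combination (Complex.exp (M * s * Complex.I) - Complex.exp (-(M * s * Complex.I))) * this

lemma cube_eq_pi (d : ℕ) (R : ℝ) : ExpOrlicz.cube d R = Set.univ.pi fun _ => Set.Icc (-R) R := by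
  ext x
  simp only [ExpOrlicz.cube, Set.mem_ofPred_eq, Set.mem_pi, Set.mem_univ, true_imp_iff, Set.mem_Icc,
    abs_le]

lemma measurableSet_cube (d : ℕ) (R : ℝ) : MeasurableSet (ExpOrlicz.cube d R) := by
  rw [cube_eq_pi]
  exact MeasurableSet.univ_pi fun _ => measurableSet_Icc

lemma isCompact_cube (d : ℕ) (R : ℝ) : IsCompact (ExpOrlicz.cube d R) := by
  rw [cube_eq_pi]
  exact isCompact_univ_pi fun _ => isCompact_Icc

lemma integral_cube_exp {d : ℕ} {M : ℝ} (hM : 0 < M) (s : Fin d → ℝ) :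
    ((2 * Real.pi : ℝ) : ℂ)⁻¹ ^ d * ∫ t in ExpOrlicz.cube d M,
      Complex.exp (-(Complex.I * ((∑ j, t j * s j : ℝ) : ℂ))) = cubeKernel M s := by
  have e : ∀ t : Fin d → ℝ, Complex.exp (-(Complex.I * ((∑ j, t j * s j : ℝ) : ℂ))) =
      ∏ j, Complex.exp (-(Complex.I * ((t j * s j : ℝ) : ℂ))) := by
    intro t
    rw [← Complex.exp_sum]
    congr 1
    push_cast
    rw [Finset.mul_sum, ← Finset.sum_neg_distrib]
  simp_rw [e]
  rw [cube_eq_pi, volume_pi, Measure.restrict_pi_pi,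
    integral_fintype_prod_eq_prod (fun (j : Fin d) (t : ℝ) =>
      Complex.exp (-(Complex.I * ((t * s j : ℝ) : ℂ)))), cubeKernel]
  push_cast
  rw [← Fin.prod_const, ← Finset.prod_mul_distrib]
  refine Finset.prod_congr rfl fun j _ => ?_
  rw [← integral_Icc_exp hM]
  push_cast
  rfl

/-- Fubini is legitimate: the exponentials are unimodular, the frequency cube has finite measure and
`f` is integrable on the space cube. -/
lemma invFourierCube_truncFourier {d : ℕ} {f : (Fin d → ℝ) → ℂ} {R M : ℝ} (hM : 0 < M)
    (hf : IntegrableOn f (ExpOrlicz.cube d R)) (x : Fin d → ℝ) :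
    ExpOrlicz.invFourierCube M (ExpOrlicz.truncFourier R f) x =
      ∫ y in ExpOrlicz.cube d R, cubeKernel M (x - y) • f y := by
  have : IsFiniteMeasure (volume.restrict (ExpOrlicz.cube d M)) :=
    ⟨by simpa using (isCompact_cube d M).measure_lt_top⟩
  rw [ExpOrlicz.invFourierCube]
  have hin : ∀ t : Fin d → ℝ, Complex.exp (-(Complex.I * ((∑ j, t j * x j : ℝ) : ℂ))) *
      ExpOrlicz.truncFourier R f t = ∫ y in ExpOrlicz.cube d R,
        Complex.exp (-(Complex.I * ((∑ j, t j * x j : ℝ) : ℂ))) *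
          (Complex.exp (Complex.I * ((∑ j, t j * y j : ℝ) : ℂ)) * f y) :=
    fun t => (integral_const_mul _ _).symm
  simp_rw [hin]
  rw [integral_integral_swap, ← integral_const_mul]
  · congr 1; ext y
    rw [Complex.real_smul, ← integral_cube_exp hM (x - y), mul_assoc, ← integral_mul_const]
    congr 2; ext t
    rw [← mul_assoc, ← Complex.exp_add]
    congr 2
    simp only [Pi.sub_apply, mul_sub, Finset.sum_sub_distrib]
    push_cast
    ring
  · have h1 : Integrable (fun _ : Fin d → ℝ => (1 : ℂ)) (volume.restrict (ExpOrlicz.cube d M)) :=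
      integrable_const _
    have h2 := h1.mul_prod hf
    refine h2.norm.mono' ?_ (ae_of_all _ fun p => ?_)
    · have h3 := hf.aestronglyMeasurable.comp_snd (μ := volume.restrict (ExpOrlicz.cube d M))
      simp only [Function.uncurry_def]
      refine (Continuous.aestronglyMeasurable (by fun_prop)).mul
        ((Continuous.aestronglyMeasurable (by fun_prop)).mul h3)
    · simp only [Function.uncurry]
      have e1 : ∀ a : ℝ, ‖Complex.exp (Complex.I * a)‖ = 1 := fun a => by
        rw [mul_comm]; exact Complex.norm_exp_ofReal_mul_I a
      have e2 : ∀ a : ℝ, ‖Complex.exp (-(Complex.I * a))‖ = 1 := fun a => by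
        have := e1 (-a)
        rwa [Complex.ofReal_neg, mul_neg] at this
      rw [norm_mul, norm_mul, e1, e2, one_mul, one_mul, one_mul]

/-- The kernel is bounded and decays like `1/|s|`. This is why `α > 1` is what convolution with
functions in `L^α` requires. -/
lemma integrable_abs_dirichletKernel_rpow {M q : ℝ} (hM : 0 < M) (hq : 1 < q) :
    Integrable fun s : ℝ => |dirichletKernel M s| ^ q := by
  have hpi := Real.pi_pos
  have hb : ∀ s : ℝ, |dirichletKernel M s| ≤ (M + 1) / Real.pi * (1 + ‖s‖)⁻¹ := by
    intro s
    rw [← div_eq_mul_inv, le_div_iff₀ (by positivity), mul_add, mul_one, add_div]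
    refine add_le_add (abs_dirichletKernel_le hM s) ?_
    rcases eq_or_ne s 0 with rfl | hs
    · simp; positivity
    · rw [dirichletKernel_of_ne_zero hM hs, abs_div, abs_mul, abs_of_pos hpi, Real.norm_eq_abs]
      have := abs_pos.2 hs
      rw [div_mul_eq_mul_div, div_le_div_iff₀ (by positivity) hpi]
      have := Real.abs_sin_le_one (M * s)
      nlinarith [mul_pos (abs_pos.2 hs) hpi]
  have hi := (integrable_one_add_norm (E := ℝ) (μ := volume) (r := q) (by simpa using hq)).const_mul
    (((M + 1) / Real.pi) ^ q)
  refine hi.mono' ?_ (ae_of_all _ fun s => ?_)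
  · have := continuous_dirichletKernel M
    exact (Continuous.rpow_const (by fun_prop) fun _ => Or.inr (by linarith)).aestronglyMeasurable
  · rw [Real.norm_of_nonneg (by positivity), Real.rpow_neg (by positivity), ← Real.inv_rpow (by positivity),
      ← Real.mul_rpow (by positivity) (by positivity)]
    exact Real.rpow_le_rpow (abs_nonneg _) (hb s) (by linarith)

lemma memLp_cubeKernel {d : ℕ} {M q : ℝ} (hM : 0 < M) (hq : 1 < q) :
    MemLp (cubeKernel (d := d) M) (ENNReal.ofReal q) volume := by
  have hq0 : 0 < q := by linarith
  rw [← integrable_norm_rpow_iff (continuous_cubeKernel M).aestronglyMeasurable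
    (by simpa using hq0) ENNReal.ofReal_ne_top, ENNReal.toReal_ofReal hq0.le]
  have h := Integrable.fintype_prod (ι := Fin d) (μ := fun _ => (volume : Measure ℝ))
    (f := fun _ s => |dirichletKernel M s| ^ q) fun _ => integrable_abs_dirichletKernel_rpow hM hq
  rw [← volume_pi] at h
  refine h.congr (ae_of_all _ fun s => ?_)
  simp only
  rw [cubeKernel, Real.norm_eq_abs, Finset.abs_prod, Real.finsetProd_rpow _ _ fun _ _ => abs_nonneg _]

lemma integrable_cubeKernel_smul_of_memLp {d : ℕ} {α M : ℝ} (hα : 1 < α) (hM : 0 < M)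
    {f : (Fin d → ℝ) → ℂ} (hf : MemLp f (ENNReal.ofReal α) volume) (x : Fin d → ℝ) :
    Integrable fun y => cubeKernel M (x - y) • f y := by
  have hc := Real.HolderConjugate.conjExponent hα
  have h1 := (memLp_cubeKernel (d := d) hM hc.symm.lt).comp_measurePreserving
    (Measure.measurePreserving_sub_left (volume : Measure (Fin d → ℝ)) x)
  have := hc.ennrealOfReal.symm
  have h2 := hf.smul h1 (r := 1)
  rw [memLp_one_iff_integrable] at h2
  exact h2

/-- For each `R` the expression is an integral of the kernel times `f` over a cube. Hölder's
inequality makes the full integrand integrable, and the cubes exhaust the space. -/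
lemma tendsto_invFourierCube_truncFourier {d : ℕ} {α M : ℝ} (hα : 1 < α) (hM : 0 < M)
    {f : (Fin d → ℝ) → ℂ} (hf : MemLp f (ENNReal.ofReal α) volume) (x : Fin d → ℝ) :
    Tendsto (fun R : ℝ => ExpOrlicz.invFourierCube M (ExpOrlicz.truncFourier R f) x) atTop
      (𝓝 (cubeOp M f x)) := by
  have hloc : ∀ R, IntegrableOn f (ExpOrlicz.cube d R) := fun R =>
    (hf.locallyIntegrable (by simpa using hα.le)).integrableOn_isCompact (isCompact_cube d R)
  simp_rw [fun R => invFourierCube_truncFourier hM (hloc R) x]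
  have hcov : AECover (volume : Measure (Fin d → ℝ)) atTop (ExpOrlicz.cube d) := by
    refine ⟨ae_of_all _ fun y => ?_, fun R => measurableSet_cube d R⟩
    filter_upwards [eventually_ge_atTop ‖y‖] with R hR j
    exact (norm_le_pi_norm y j).trans hR
  exact hcov.integral_tendsto_of_countably_generated
    (integrable_cubeKernel_smul_of_memLp hα hM hf x)

lemma aestronglyMeasurable_truncFourier {d : ℕ} {f : (Fin d → ℝ) → ℂ}
    (hf : AEStronglyMeasurable f) (R : ℝ) (μ : Measure (Fin d → ℝ)) :
    AEStronglyMeasurable (ExpOrlicz.truncFourier R f) μ := by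
  have h : ExpOrlicz.truncFourier R f = ExpOrlicz.truncFourier R (hf.mk f) := by
    ext t
    refine setIntegral_congr_ae (measurableSet_cube d R) ?_
    filter_upwards [hf.ae_eq_mk] with y hy _
    rw [← hy]
  rw [h]
  refine (StronglyMeasurable.integral_prod_right' (f := fun p : (Fin d → ℝ) × (Fin d → ℝ) =>
    Complex.exp (Complex.I * ((∑ j, p.1 j * p.2 j : ℝ) : ℂ)) * hf.mk f p.2)
    ?_).aestronglyMeasurable
  have := hf.stronglyMeasurable_mk.measurable
  apply Measurable.stronglyMeasurable
  fun_prop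

/-- No integrability is needed: if `f` is not integrable on the cube, the left side is the default
value 0. -/
lemma norm_truncFourier_le {d : ℕ} (f : (Fin d → ℝ) → ℂ) (R : ℝ) (t : Fin d → ℝ) :
    ‖ExpOrlicz.truncFourier R f t‖ ≤ ∫ y in ExpOrlicz.cube d R, ‖f y‖ := by
  refine (norm_integral_le_integral_norm _).trans_eq ?_
  congr 1; ext y
  rw [norm_mul, mul_comm Complex.I, Complex.norm_exp_ofReal_mul_I, one_mul]

lemma tendsto_invFourierCube_of_isFourierOnCube {d : ℕ} {M : ℝ} {f F : (Fin d → ℝ) → ℂ}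
    (hf : AEStronglyMeasurable f) (hF : ExpOrlicz.IsFourierOnCube M f F) (x : Fin d → ℝ) :
    Tendsto (fun R : ℝ => ExpOrlicz.invFourierCube M (ExpOrlicz.truncFourier R f) x) atTop
      (𝓝 (ExpOrlicz.invFourierCube M F x)) := by
  have : IsFiniteMeasure (volume.restrict (ExpOrlicz.cube d M)) :=
    ⟨by simpa using (isCompact_cube d M).measure_lt_top⟩
  have hn : ∀ t : Fin d → ℝ,
      ‖Complex.exp (-(Complex.I * ((∑ j, t j * x j : ℝ) : ℂ)))‖ = 1 := fun t => by
    have := Complex.norm_exp_ofReal_mul_I (-(∑ j, t j * x j))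
    rwa [Complex.ofReal_neg, neg_mul, mul_comm] at this
  have hexp : AEStronglyMeasurable
      (fun t : Fin d → ℝ => Complex.exp (-(Complex.I * ((∑ j, t j * x j : ℝ) : ℂ))))
      (volume.restrict (ExpOrlicz.cube d M)) :=
    Continuous.aestronglyMeasurable (by fun_prop)
  refine Tendsto.const_mul _ (tendsto_integral_of_L1 _ (hexp.mul hF.1)
    (Eventually.of_forall fun R => ?_) ?_)
  · refine Integrable.of_bound (hexp.mul (aestronglyMeasurable_truncFourier hf R _))
      (∫ y in ExpOrlicz.cube d R, ‖f y‖) (ae_of_all _ fun t => ?_)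
    rw [norm_mul, hn, one_mul]
    exact norm_truncFourier_le f R t
  · refine hF.2.congr fun R => lintegral_congr fun t => ?_
    rw [Pi.mul_apply, ← mul_sub, enorm_mul, ← ofReal_norm (Complex.exp _), hn, ENNReal.ofReal_one, one_mul]

/-! ### Modular inequality for the modified `N`-functions -/

lemma ofReal_supPow {α : ℝ} {ψ : ℝ → ℝ} (hα : 1 < α) (h : IsWeakPsi α ψ) {u : ℝ} (hu : 0 ≤ u) :
    ENNReal.ofReal (supPow α ψ u) = ⨆ p ∈ Set.Ici α, ENNReal.ofReal ((u / ψ p) ^ p) := by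
  have hle : ⨆ p ∈ Set.Ici α, ENNReal.ofReal ((u / ψ p) ^ p) ≤ ENNReal.ofReal (supPow α ψ u) := by
    refine iSup₂_le fun p hp => ENNReal.ofReal_le_ofReal ?_
    have := le_supPow hα h u hp
    rwa [abs_of_nonneg hu] at this
  have htop := ne_top_of_le_ne_top ENNReal.ofReal_ne_top hle
  refine le_antisymm ?_ hle
  rw [← ENNReal.ofReal_toReal htop]
  refine ENNReal.ofReal_le_ofReal (supPow_le fun p hp => ?_)
  rw [abs_of_nonneg hu, ← ENNReal.ofReal_le_iff_le_toReal htop]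
  exact le_iSup₂_of_le (f := fun p _ => ENNReal.ofReal ((u / ψ p) ^ p)) p hp le_rfl

/-- The modular inequality for `supPow`. -/
lemma exists_lintegral_supPow_cubeOp_le (d : ℕ) {α : ℝ} (hα : 1 < α) {ψ : ℝ → ℝ}
    (h : IsWeakPsi α ψ) :
    ∃ (K : ℝ) (C : ℝ≥0), 1 ≤ K ∧ ∀ M, 0 < M → ∀ f : (Fin d → ℝ) → ℂ, IsBddCompact f →
      ∫⁻ x, ENNReal.ofReal (supPow α (ExpOrlicz.psiPow d ψ) (‖cubeOp M f x‖ / K)) ≤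
        C * ∫⁻ x, ENNReal.ofReal (supPow α ψ ‖f x‖) := by
  obtain ⟨K, C, hK, hC⟩ := exists_lintegral_iSup_cubeOp_le d hα
  refine ⟨K, C, hK, fun M hM f hf => ?_⟩
  have hK0 : (0 : ℝ) < K := zero_lt_one.trans_le hK
  -- With the weight `ψ(p)^(-p)` the loss `p^d` joins `ψ(p)` in the denominator and forms `ψ_d(p)`.
  refine le_trans (le_of_eq ?_) ((hC (fun p => (ENNReal.ofReal (ψ p))⁻¹ ^ p) M hM f hf).trans
    (le_of_eq ?_))
  · refine lintegral_congr fun x => ?_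
    rw [ofReal_supPow hα (h.psiPow hα d) (by positivity)]
    refine iSup_congr fun p => iSup_congr fun hp => ?_
    have hp0 : 0 < p := by linarith [Set.mem_Ici.1 hp]
    have hψ := h.pos p hp
    have hdψ : 0 < ExpOrlicz.psiPow d ψ p := (h.psiPow hα d).pos p hp
    rw [← ENNReal.mul_rpow_of_nonneg _ _ hp0.le, ← ENNReal.ofReal_rpow_of_nonneg (by positivity) hp0.le]
    congr 1
    have e : ‖cubeOp M f x‖ / K / ExpOrlicz.psiPow d ψ p =
        (ψ p)⁻¹ * (‖cubeOp M f x‖ / (K * p ^ d)) := by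
      rw [ExpOrlicz.psiPow]; field_simp
    rw [e, ENNReal.ofReal_mul (by positivity), ENNReal.ofReal_inv_of_pos hψ,
      ENNReal.ofReal_div_of_pos (by positivity), ofReal_norm, ENNReal.ofReal_mul hK0.le,
      ENNReal.ofReal_pow hp0.le, ENNReal.ofReal_coe_nnreal]
  · congr 1
    refine lintegral_congr fun x => ?_
    rw [ofReal_supPow hα h (norm_nonneg _)]
    refine iSup_congr fun p => iSup_congr fun hp => ?_
    have hp0 : 0 < p := by linarith [Set.mem_Ici.1 hp]
    have hψ := h.pos p hp
    rw [← ENNReal.mul_rpow_of_nonneg _ _ hp0.le, ← ENNReal.ofReal_rpow_of_nonneg (by positivity) hp0.le,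
      div_eq_inv_mul, ENNReal.ofReal_mul (by positivity), ENNReal.ofReal_inv_of_pos hψ, ofReal_norm]

lemma ExpOrlicz.IsNFunction.nonneg {N : ℝ → ℝ} (hN : ExpOrlicz.IsNFunction N) (u : ℝ) :
    0 ≤ N u := by
  have h0 : N 0 = 0 := (hN.zero_iff 0).2 rfl
  rcases le_total 0 u with hu | hu
  · rw [← h0]; exact hN.strictMono.monotoneOn (by simp) hu hu
  · rw [← h0, ← hN.even u]; exact hN.strictMono.monotoneOn (by simp) (by simpa using hu) (by simpa)

/-- A modified function is a multiple of `|u|^α` near zero, monotone, and equal to `supPow` at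
infinity. -/
lemma exists_of_isModifiedExpNFunction {α : ℝ} {ψ A : ℝ → ℝ} (hα : 1 < α) (h : IsWeakPsi α ψ)
    (hA : ExpOrlicz.IsModifiedExpNFunction α ψ A) :
    ExpOrlicz.IsNFunction A ∧ ∃ c δ U : ℝ, 0 < c ∧ 0 < δ ∧ δ < U ∧
      (∀ u, 0 ≤ u → u ≤ δ → A u = c * u ^ α) ∧ (∀ u, U < u → A u = supPow α ψ u) := by
  obtain ⟨N, ⟨-, hN⟩, hA, c₁, c₂, c₃, c₄, c₅, hc₂, hc₅, h₁, -, h₃⟩ := hA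
  refine ⟨hA, c₁, c₂, max c₅ (Real.exp 2), ?_, hc₂, hc₅.trans_le (le_max_left _ _), ?_, ?_⟩
  · have h4 := h₁ c₂ (abs_of_pos hc₂).le
    have h5 : 0 < A c₂ := lt_of_le_of_ne (hA.nonneg c₂) fun h0 =>
      hc₂.ne' ((hA.zero_iff c₂).1 h0.symm)
    rw [h4, abs_of_pos hc₂] at h5
    exact pos_of_mul_pos_left h5 (by positivity)
  · intro u hu0 hu
    rw [h₁ u (by rwa [abs_of_nonneg hu0]), abs_of_nonneg hu0]
  · intro u hu
    have h4 : c₅ < u := (le_max_left _ _).trans_lt hu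
    have h5 : Real.exp 2 < u := (le_max_right _ _).trans_lt hu
    have hu0 : 0 < u := (Real.exp_pos 2).trans h5
    rw [h₃ u (by rwa [abs_of_pos hu0]), hN u (by rw [abs_of_pos hu0]; exact h5.le),
      exp_youngFenchel hα h hu0.ne']

/-- Beyond `U` the functions coincide. Below `U`, `supPow` is at most a multiple of `u^α` by
contraction from `U`, and `A` is at least such a multiple: it is a power up to `δ` and increasing
after that. -/
lemma exists_supPow_le {α : ℝ} {ψ A : ℝ → ℝ} (hα : 1 < α) (h : IsWeakPsi α ψ)
    (hA : ExpOrlicz.IsModifiedExpNFunction α ψ A) :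
    ∃ C : ℝ≥0, ∀ u, 0 ≤ u → supPow α ψ u ≤ C * A u := by
  obtain ⟨hN, c, δ, U, hc, hδ, hδU, h₁, h₂⟩ := exists_of_isModifiedExpNFunction hα h hA
  have hU : 0 < U := hδ.trans hδU
  set S := supPow α ψ U
  have hS : 0 < S := supPow_pos hα h hU.ne'
  set c' := c * (δ / U) ^ α
  have hc' : 0 < c' := by positivity
  -- The factor `min 1 (U^α)` is only ever used through its bound `U^α`, which turns `c' (u/U)^α`
  -- into at most `c u^α` for `u ≤ δ`, and into at most `c δ^α = A δ` afterwards.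
  have hlow : ∀ u, 0 ≤ u → u ≤ U → c' * (u / U) ^ α * min 1 (U ^ α) ≤ A u := by
    intro u hu0 huU
    have hm1 : min 1 (U ^ α) ≤ 1 := min_le_left _ _
    have hm2 : min 1 (U ^ α) ≤ U ^ α := min_le_right _ _
    have hm0 : 0 ≤ min 1 (U ^ α) := by positivity
    rcases le_total u δ with hu | hu
    · rw [h₁ u hu0 hu]
      have h3 : (δ / U) ^ α ≤ 1 := Real.rpow_le_one (by positivity) ((div_le_one hU).2 hδU.le) (by linarith)
      calc c' * (u / U) ^ α * min 1 (U ^ α) ≤ c' * (u / U) ^ α * U ^ α := by gcongr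
        _ = c * (δ / U) ^ α * u ^ α := by
            rw [mul_assoc c', ← Real.mul_rpow (by positivity) hU.le, div_mul_cancel₀ _ hU.ne']
        _ ≤ c * 1 * u ^ α := by gcongr
        _ = _ := by ring
    · have h3 : A δ ≤ A u := hN.strictMono.monotoneOn hδ.le hu0 hu
      rw [h₁ δ hδ.le le_rfl] at h3
      have h4 : (u / U) ^ α ≤ 1 := Real.rpow_le_one (by positivity) ((div_le_one hU).2 huU) (by linarith)
      calc c' * (u / U) ^ α * min 1 (U ^ α) ≤ c' * 1 * U ^ α := by gcongr
        _ = c * δ ^ α := by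
            rw [mul_one, mul_assoc, ← Real.mul_rpow (by positivity) hU.le, div_mul_cancel₀ _ hU.ne']
        _ ≤ _ := h3
  have hm : 0 < min 1 (U ^ α) := by positivity
  have hCnn : 0 ≤ max 1 (S / (c' * min 1 (U ^ α))) := le_max_of_le_left zero_le_one
  refine ⟨(max 1 (S / (c' * min 1 (U ^ α)))).toNNReal, fun u hu => ?_⟩
  rw [Real.coe_toNNReal _ hCnn]
  have hAu := hN.nonneg u
  rcases le_or_gt u U with huU | huU
  · have h3 := supPow_mul_le hα h (div_nonneg hu hU.le) ((div_le_one hU).2 huU) U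
    rw [div_mul_cancel₀ _ hU.ne'] at h3
    have h4 := hlow u hu huU
    calc supPow α ψ u ≤ (u / U) ^ α * S := h3
      _ = S / (c' * min 1 (U ^ α)) * (c' * (u / U) ^ α * min 1 (U ^ α)) := by field_simp
      _ ≤ S / (c' * min 1 (U ^ α)) * A u := by gcongr
      _ ≤ _ := by gcongr; exact le_max_right _ _
  · rw [← h₂ u huU]
    exact le_mul_of_one_le_left hAu (le_max_left _ _)

/-- Below `U`, `A` is at most a multiple of `u^α`, and `u^α` is controlled by the single term `p =
α` of the supremum. -/
lemma exists_le_supPow {α : ℝ} {ψ A : ℝ → ℝ} (hα : 1 < α) (h : IsWeakPsi α ψ)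
    (hA : ExpOrlicz.IsModifiedExpNFunction α ψ A) :
    ∃ C : ℝ≥0, ∀ u, 0 ≤ u → A u ≤ C * supPow α ψ u := by
  obtain ⟨hN, c, δ, U, hc, hδ, hδU, h₁, h₂⟩ := exists_of_isModifiedExpNFunction hα h hA
  have hU : 0 < U := hδ.trans hδU
  have hAU := hN.nonneg U
  have hψ := h.pos α le_rfl
  have hpow : ∀ u, 0 ≤ u → u ^ α ≤ ψ α ^ α * supPow α ψ u := by
    intro u hu
    have := le_supPow hα h u le_rfl
    rw [abs_of_nonneg hu, Real.div_rpow hu hψ.le, div_le_iff₀ (by positivity)] at this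
    rwa [mul_comm]
  have hCnn : 0 ≤ max 1 ((c + A U / δ ^ α) * ψ α ^ α) := le_max_of_le_left zero_le_one
  refine ⟨(max 1 ((c + A U / δ ^ α) * ψ α ^ α)).toNNReal, fun u hu => ?_⟩
  rw [Real.coe_toNNReal _ hCnn]
  have hS : 0 ≤ supPow α ψ u := (isNFunction_supPow hα h).nonneg u
  rcases le_or_gt u U with huU | huU
  · have h3 : A u ≤ (c + A U / δ ^ α) * u ^ α := by
      have hδα : 0 < δ ^ α := by positivity
      have huα : 0 ≤ u ^ α := by positivity
      rcases le_total u δ with huδ | huδ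
      · rw [h₁ u hu huδ]
        gcongr
        exact le_add_of_nonneg_right (by positivity)
      · have h4 : A u ≤ A U := hN.strictMono.monotoneOn hu hU.le huU
        have h5 : δ ^ α ≤ u ^ α := Real.rpow_le_rpow hδ.le huδ (by linarith)
        calc A u ≤ A U / δ ^ α * δ ^ α := by rwa [div_mul_cancel₀ _ hδα.ne']
          _ ≤ A U / δ ^ α * u ^ α := by gcongr
          _ ≤ _ := by gcongr; exact le_add_of_nonneg_left hc.le
    calc A u ≤ (c + A U / δ ^ α) * u ^ α := h3
      _ ≤ (c + A U / δ ^ α) * (ψ α ^ α * supPow α ψ u) := by gcongr; exact hpow u hu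
      _ = (c + A U / δ ^ α) * ψ α ^ α * supPow α ψ u := by ring
      _ ≤ _ := by gcongr; exact le_max_right _ _
  · rw [h₂ u huU]
    exact le_mul_of_one_le_left hS (le_max_left _ _)

section Modified

variable {d : ℕ} {α : ℝ} {ψ A B : ℝ → ℝ}

lemma exists_lintegral_modified_cubeOp_le_of_isBddCompact (hα : 1 < α) (h : IsWeakPsi α ψ)
    (hA : ExpOrlicz.IsModifiedExpNFunction α ψ A)
    (hB : ExpOrlicz.IsModifiedExpNFunction α (ExpOrlicz.psiPow d ψ) B) :
    ∃ (K : ℝ) (C : ℝ≥0), 1 ≤ K ∧ ∀ M, 0 < M → ∀ f : (Fin d → ℝ) → ℂ, IsBddCompact f →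
      ∫⁻ x, ENNReal.ofReal (B (‖cubeOp M f x‖ / K)) ≤ C * ∫⁻ x, ENNReal.ofReal (A ‖f x‖) := by
  obtain ⟨K, C, hK, hC⟩ := exists_lintegral_supPow_cubeOp_le d hα h
  obtain ⟨C₁, h₁⟩ := exists_supPow_le hα h hA
  obtain ⟨C₂, h₂⟩ := exists_le_supPow hα (h.psiPow hα d) hB
  refine ⟨K, C₂ * C * C₁, hK, fun M hM f hf => ?_⟩
  have hmul : ∀ (c : ℝ≥0) (t : ℝ), ENNReal.ofReal (c * t) = c * ENNReal.ofReal t := fun c t => by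
    rw [ENNReal.ofReal_mul c.coe_nonneg, ENNReal.ofReal_coe_nnreal]
  calc _ ≤ ∫⁻ x, C₂ * ENNReal.ofReal (supPow α (ExpOrlicz.psiPow d ψ) (‖cubeOp M f x‖ / K)) := by
        refine lintegral_mono fun x => ?_
        rw [← hmul]
        exact ENNReal.ofReal_le_ofReal (h₂ _ (by positivity))
    _ = C₂ * ∫⁻ x, ENNReal.ofReal (supPow α (ExpOrlicz.psiPow d ψ) (‖cubeOp M f x‖ / K)) :=
        lintegral_const_mul' _ _ ENNReal.coe_ne_top
    _ ≤ C₂ * (C * ∫⁻ x, C₁ * ENNReal.ofReal (A ‖f x‖)) := by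
        refine mul_le_mul' le_rfl ((hC M hM f hf).trans (mul_le_mul' le_rfl ?_))
        refine lintegral_mono fun x => ?_
        rw [← hmul]
        exact ENNReal.ofReal_le_ofReal (h₁ _ (norm_nonneg _))
    _ = _ := by
        rw [lintegral_const_mul' _ _ ENNReal.coe_ne_top]
        push_cast
        ring

/-- The term `p = α` of the supremum already controls `|f|^α`. -/
lemma memLp_of_lintegral_modified_ne_top (hα : 1 < α) (h : IsWeakPsi α ψ)
    (hA : ExpOrlicz.IsModifiedExpNFunction α ψ A) {f : (Fin d → ℝ) → ℂ}
    (hf : AEStronglyMeasurable f) (hfA : ∫⁻ x, ENNReal.ofReal (A ‖f x‖) ≠ ∞) :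
    MemLp f (ENNReal.ofReal α) volume := by
  have hα0 : 0 < α := by linarith
  have hψ := h.pos α le_rfl
  obtain ⟨C, hC⟩ := exists_supPow_le hα h hA
  refine ⟨hf, ?_⟩
  rw [eLpNorm_lt_top_iff_lintegral_rpow_enorm_lt_top (by simpa using hα0) ENNReal.ofReal_ne_top,
    ENNReal.toReal_ofReal hα0.le]
  calc ∫⁻ x, ‖f x‖ₑ ^ α ≤ ∫⁻ x, ENNReal.ofReal (ψ α ^ α * C) * ENNReal.ofReal (A ‖f x‖) := by
        refine lintegral_mono fun x => ?_
        rw [← ofReal_norm, ENNReal.ofReal_rpow_of_nonneg (norm_nonneg _) hα0.le,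
          ← ENNReal.ofReal_mul (by positivity)]
        refine ENNReal.ofReal_le_ofReal ?_
        have h1 := (le_supPow hα h ‖f x‖ le_rfl).trans (hC _ (norm_nonneg _))
        rw [abs_norm, Real.div_rpow (norm_nonneg _) hψ.le, div_le_iff₀ (by positivity)] at h1
        linarith
    _ = ENNReal.ofReal (ψ α ^ α * C) * ∫⁻ x, ENNReal.ofReal (A ‖f x‖) :=
        lintegral_const_mul' _ _ ENNReal.ofReal_ne_top
    _ < ∞ := ENNReal.mul_lt_top ENNReal.ofReal_lt_top hfA.lt_top

/-- Truncation both in space and in height: the truncated images converge pointwise by dominated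
convergence, Fatou's lemma passes to the limit on the left, and monotonicity of `N₁` removes the
truncation on the right. -/
lemma lintegral_cubeOp_le_of_memLp (hα : 1 < α) {N₁ N₂ : ℝ → ℝ} (hN₁ : ExpOrlicz.IsNFunction N₁)
    (hN₂ : ExpOrlicz.IsNFunction N₂) {K M : ℝ} {C : ℝ≥0} (hM : 0 < M)
    (hnice : ∀ f : (Fin d → ℝ) → ℂ, IsBddCompact f →
      ∫⁻ x, ENNReal.ofReal (N₂ (‖cubeOp M f x‖ / K)) ≤ C * ∫⁻ x, ENNReal.ofReal (N₁ ‖f x‖))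
    {f : (Fin d → ℝ) → ℂ} (hfm : Measurable f) (hf : MemLp f (ENNReal.ofReal α) volume) :
    ∫⁻ x, ENNReal.ofReal (N₂ (‖cubeOp M f x‖ / K)) ≤ C * ∫⁻ x, ENNReal.ofReal (N₁ ‖f x‖) := by
  set s : ℕ → Set (Fin d → ℝ) := fun n => {x | ‖x‖ ≤ n ∧ ‖f x‖ ≤ n} with hs
  have hsm : ∀ n, MeasurableSet (s n) := fun n =>
    (measurableSet_le measurable_norm measurable_const).inter
      (measurableSet_le hfm.norm measurable_const)
  have hnb : ∀ n, IsBddCompact ((s n).indicator f) := by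
    intro n
    refine ⟨hfm.indicator (hsm n), ⟨n, n.cast_nonneg, fun x => ?_⟩, ⟨n, n.cast_nonneg, fun x hx => ?_⟩⟩
    · by_cases hx : x ∈ s n
      · rw [Set.indicator_of_mem hx]; exact hx.2
      · rw [Set.indicator_of_notMem hx, norm_zero]; exact n.cast_nonneg
    · exact Set.indicator_of_notMem (fun h => not_le.2 hx h.1) _
  have hlim : ∀ x, Tendsto (fun n => cubeOp M ((s n).indicator f) x) atTop (𝓝 (cubeOp M f x)) := by
    intro x
    have hint := integrable_cubeKernel_smul_of_memLp hα hM hf x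
    refine tendsto_integral_of_dominated_convergence _
      (fun n => (integrable_cubeKernel_smul ((hnb n).integrable volume) hM x).aestronglyMeasurable)
      hint.norm (fun n => ae_of_all _ fun y => ?_) (ae_of_all _ fun y => ?_)
    · rw [norm_smul, norm_smul]
      gcongr
      exact norm_indicator_le_norm_self f y
    · refine tendsto_const_nhds.congr' ?_
      filter_upwards [eventually_ge_atTop ⌈‖y‖⌉₊, eventually_ge_atTop ⌈‖f y‖⌉₊] with n h1 h2
      have hy : y ∈ s n := ⟨Nat.ceil_le.1 h1, Nat.ceil_le.1 h2⟩
      rw [Set.indicator_of_mem hy]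
  have hcont := hN₂.continuous
  refine lintegral_le_of_tendsto
    (F := fun n x => ENNReal.ofReal (N₂ (‖cubeOp M ((s n).indicator f) x‖ / K)))
    (fun n => ?_) (fun x => ?_) fun n => ?_
  · have h1 := measurable_cubeOp (hnb n).measurable M
    have h2 := hcont.measurable
    fun_prop
  · have h1 : Continuous fun z : ℂ => ENNReal.ofReal (N₂ (‖z‖ / K)) :=
      ENNReal.continuous_ofReal.comp (by fun_prop)
    exact (h1.tendsto _).comp (hlim x)
  · refine (hnice _ (hnb n)).trans (mul_le_mul' le_rfl (lintegral_mono fun x => ?_))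
    exact ENNReal.ofReal_le_ofReal (hN₁.strictMono.monotoneOn (norm_nonneg _) (norm_nonneg _)
      (norm_indicator_le_norm_self f x))

lemma cubeOp_congr_ae {f g : (Fin d → ℝ) → ℂ} (hfg : f =ᵐ[volume] g) (M : ℝ) :
    cubeOp M f = cubeOp M g := by
  ext x
  refine integral_congr_ae ?_
  filter_upwards [hfg] with y hy
  rw [hy]

lemma cubeOp_const_mul (v : ℂ) (f : (Fin d → ℝ) → ℂ) (M : ℝ) (x : Fin d → ℝ) :
    cubeOp M (fun y => v * f y) x = v * cubeOp M f x := by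
  rw [cubeOp, cubeOp, ← integral_const_mul]
  congr 1; ext y
  rw [mul_smul_comm]

/-- The modular inequality for the partial integral operator. -/
lemma exists_lintegral_modified_cubeOp_le (hα : 1 < α) (h : IsWeakPsi α ψ)
    (hA : ExpOrlicz.IsModifiedExpNFunction α ψ A)
    (hB : ExpOrlicz.IsModifiedExpNFunction α (ExpOrlicz.psiPow d ψ) B) :
    ∃ (K : ℝ) (C : ℝ≥0), 1 ≤ K ∧ 1 ≤ C ∧ ∀ M, 0 < M → ∀ f : (Fin d → ℝ) → ℂ,
      AEStronglyMeasurable f →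
      ∫⁻ x, ENNReal.ofReal (B (‖cubeOp M f x‖ / K)) ≤ C * ∫⁻ x, ENNReal.ofReal (A ‖f x‖) := by
  obtain ⟨K, C, hK, hC⟩ := exists_lintegral_modified_cubeOp_le_of_isBddCompact hα h hA hB
  -- A positive constant is needed when the right-hand modular is infinite, since `0 * ∞ = 0`; the
  -- bound 1 serves the norm inequality.
  refine ⟨K, max 1 C, hK, le_max_left _ _, fun M hM f hf => ?_⟩
  by_cases hfA : ∫⁻ x, ENNReal.ofReal (A ‖f x‖) = ∞
  · rw [hfA, ENNReal.mul_top]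
    · exact le_top
    · have : (0 : ℝ≥0) < max 1 C := zero_lt_one.trans_le (le_max_left _ _)
      exact_mod_cast this.ne'
  have hLp := memLp_of_lintegral_modified_ne_top hα h hA hf hfA
  have hae := hf.ae_eq_mk
  obtain ⟨hNA, -⟩ := exists_of_isModifiedExpNFunction hα h hA
  obtain ⟨hNB, -⟩ := exists_of_isModifiedExpNFunction hα (h.psiPow hα d) hB
  have key := lintegral_cubeOp_le_of_memLp hα hNA hNB hM (hC M hM)
    hf.stronglyMeasurable_mk.measurable (hLp.ae_eq hae)
  have e : ∫⁻ x, ENNReal.ofReal (A ‖hf.mk f x‖) = ∫⁻ x, ENNReal.ofReal (A ‖f x‖) :=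
    lintegral_congr_ae (by filter_upwards [hae] with x hx; rw [hx])
  rw [e, ← cubeOp_congr_ae hae] at key
  refine key.trans (mul_le_mul' ?_ le_rfl)
  exact_mod_cast le_max_right _ _

/-! ### From the modular to the Orlicz norm -/

/-- Replacing `v` by `v / K` in the infimum costs the factor `K`, and since `C ≥ 1` the summand 1 is
bounded by `C · 1`. Hence `C` comes out as a factor without any use of convexity. -/
lemma orliczNorm_cubeOp_le {N₁ N₂ : ℝ → ℝ} {K M : ℝ} {C : ℝ≥0} (hK : 1 ≤ K) (hC1 : 1 ≤ C)
    (hC : ∀ f : (Fin d → ℝ) → ℂ, AEStronglyMeasurable f →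
      ∫⁻ x, ENNReal.ofReal (N₂ (‖cubeOp M f x‖ / K)) ≤ C * ∫⁻ x, ENNReal.ofReal (N₁ ‖f x‖))
    {f : (Fin d → ℝ) → ℂ} (hf : AEStronglyMeasurable f) :
    ExpOrlicz.orliczNorm N₂ (cubeOp M f) ≤
      (K.toNNReal * C : ℝ≥0) * ExpOrlicz.orliczNorm N₁ f := by
  have hK0 : 0 < K := zero_lt_one.trans_le hK
  have hC1' : (1 : ℝ≥0∞) ≤ C := by exact_mod_cast hC1
  have hne : (((K.toNNReal * C : ℝ≥0)) : ℝ≥0∞) ≠ 0 := by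
    have : 0 < K.toNNReal := Real.toNNReal_pos.2 hK0
    have h2 : 0 < C := zero_lt_one.trans_le hC1
    exact_mod_cast (mul_pos this h2).ne'
  rw [ExpOrlicz.orliczNorm, ExpOrlicz.orliczNorm, ENNReal.mul_iInf_of_ne hne ENNReal.coe_ne_top]
  refine le_iInf fun ⟨v, hv⟩ => ?_
  have hv0 : 0 < v := hv
  refine (iInf_le _ (⟨v / K, div_pos hv0 hK0⟩ : Set.Ioi (0 : ℝ))).trans ?_
  have key := hC (fun y => (v : ℂ) * f y) (hf.const_mul _)
  have hn : ∀ z : ℂ, ‖(v : ℂ) * z‖ = v * ‖z‖ := fun z => by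
    rw [norm_mul, Complex.norm_real, Real.norm_of_nonneg hv0.le]
  simp_rw [cubeOp_const_mul, hn] at key
  have e : ∀ x, v / K * ‖cubeOp M f x‖ = v * ‖cubeOp M f x‖ / K := fun x => by ring
  simp only
  simp_rw [e]
  calc ENNReal.ofReal (v / K)⁻¹ * (1 + ∫⁻ x, ENNReal.ofReal (N₂ (v * ‖cubeOp M f x‖ / K)))
      ≤ ENNReal.ofReal (v / K)⁻¹ * (C * 1 + C * ∫⁻ x, ENNReal.ofReal (N₁ (v * ‖f x‖))) := by
        gcongr
        rw [mul_one]; exact hC1'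
    _ = _ := by
        rw [inv_div, div_eq_mul_inv, ENNReal.ofReal_mul hK0.le, ENNReal.coe_mul, ← mul_add]
        rw [show ENNReal.ofReal K = (K.toNNReal : ℝ≥0∞) from rfl]
        ring

/-- A finite norm gives some `v > 0` with finite modular of `v f`, and `L^α` is invariant under
scaling. -/
lemma memLp_of_memOrlicz (hα : 1 < α) (h : IsWeakPsi α ψ)
    (hA : ExpOrlicz.IsModifiedExpNFunction α ψ A) {f : (Fin d → ℝ) → ℂ}
    (hf : ExpOrlicz.MemOrlicz A f) : MemLp f (ENNReal.ofReal α) volume := by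
  obtain ⟨⟨v, hv⟩, hlt⟩ := iInf_lt_iff.1 hf.2
  have hv0 : 0 < v := hv
  have h1 : (1 + ∫⁻ x, ENNReal.ofReal (A (v * ‖f x‖))) ≠ ∞ :=
    (ENNReal.lt_top_of_mul_ne_top_right hlt.ne (by simpa using hv0)).ne
  have h2 := (ENNReal.add_ne_top.1 h1).2
  have hn : ∀ z : ℂ, ‖(v : ℂ) * z‖ = v * ‖z‖ := fun z => by
    rw [norm_mul, Complex.norm_real, Real.norm_of_nonneg hv0.le]
  have h3 := memLp_of_lintegral_modified_ne_top hα h hA (f := fun y => (v : ℂ) * f y)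
    (hf.1.const_mul _) (by simpa only [hn] using h2)
  have h4 := h3.const_mul (v : ℂ)⁻¹
  have hvc : (v : ℂ) ≠ 0 := by exact_mod_cast hv0.ne'
  refine h4.ae_eq (ae_of_all _ fun y => ?_)
  exact inv_mul_cancel_left₀ hvc (f y)

end Modified

theorem theorem2 (d : ℕ) (hd : 1 ≤ d) (α : ℝ) (hα : 1 < α) (ψ : ℝ → ℝ)
    (hψ : ExpOrlicz.IsPsi α ψ) :
    (∃ A, ExpOrlicz.IsModifiedExpNFunction α ψ A) ∧
    (∃ B, ExpOrlicz.IsModifiedExpNFunction α (ExpOrlicz.psiPow d ψ) B) ∧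
    ∀ A B : ℝ → ℝ, ExpOrlicz.IsModifiedExpNFunction α ψ A →
      ExpOrlicz.IsModifiedExpNFunction α (ExpOrlicz.psiPow d ψ) B →
      ∃ C : ℝ≥0, ∀ f : (Fin d → ℝ) → ℂ, ExpOrlicz.MemOrlicz A f → ∀ M : ℝ, 1 ≤ M →
        (∀ x, Tendsto (fun R : ℝ => ExpOrlicz.invFourierCube M (ExpOrlicz.truncFourier R f) x)
          atTop (𝓝 (ExpOrlicz.partialIntegral M f x))) ∧
        (∀ F : (Fin d → ℝ) → ℂ, ExpOrlicz.IsFourierOnCube M f F →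
          ∀ x, ExpOrlicz.partialIntegral M f x = ExpOrlicz.invFourierCube M F x) ∧
        ExpOrlicz.MemOrlicz B (ExpOrlicz.partialIntegral M f) ∧
        ExpOrlicz.orliczNorm B (ExpOrlicz.partialIntegral M f) ≤
          C * ExpOrlicz.orliczNorm A f := by
  have h := hψ.isWeakPsi
  refine ⟨exists_isModifiedExpNFunction hα h, exists_isModifiedExpNFunction hα (h.psiPow hα d),
    fun A B hA hB => ?_⟩
  obtain ⟨K, C, hK, hC1, hC⟩ := exists_lintegral_modified_cubeOp_le hα h hA hB
  refine ⟨K.toNNReal * C, fun f hf M hM => ?_⟩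
  have hM0 : 0 < M := by linarith
  have hLp := memLp_of_memOrlicz hα h hA hf
  have hlim := tendsto_invFourierCube_truncFourier hα hM0 hLp
  -- The limit exists at every point, so `limUnder` is the true limit and not a default value.
  have heq : ExpOrlicz.partialIntegral M f = cubeOp M f := funext fun x => (hlim x).limUnder_eq
  have hnorm := orliczNorm_cubeOp_le hK hC1 (hC M hM0) hf.1
  rw [heq]
  refine ⟨hlim, fun F hF x => ?_, ⟨?_, ?_⟩, hnorm⟩
  · exact tendsto_nhds_unique (hlim x) (tendsto_invFourierCube_of_isFourierOnCube hf.1 hF x)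
  · rw [cubeOp_congr_ae hf.1.ae_eq_mk]
    exact (measurable_cubeOp hf.1.stronglyMeasurable_mk.measurable M).aestronglyMeasurable
  · exact hnorm.trans_lt (ENNReal.mul_lt_top ENNReal.coe_lt_top hf.2)
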